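/- Let $n\ge 1$, $\beta\in\mathbb R$, $p>1$, and consider the Cauchy problem $$u_{tt}-\Delta u-(1+t)^{-\beta}\Delta u_t=|u|^p,\quad x\in\mathbb R^n,\ t>0,\qquad u(0)=u_0,\ u_t(0)=u_1. \tag{$*$}$$ Definitions (all functions are real-valued). For $s\ge 0$ and $f,g\in H^2(\mathbb R^n)$, the strong solution of the linear equation $u_{tt}-\Delta u-(1+t)^{-\beta}\Delta u_t=0$ on $[s,\infty)$ with data $u(s)=f$, $u_t(s)=g$ is the solution in $C^1([s,\infty);H^2)\cap C^2([s,\infty);L^2)$, the equation holding in $L^2$. For $t\ge s$, $R(t,s)$ denotes the extension by continuity to $H^1(\mathbb R^n)\times L^2(\mathbb R^n)\to H^1(\mathbb R^n)$ of the map $(f,g)\mapsto u(t)$, and $S(t,s)g:=R(t,s)(0,g)$. A mild solution of $(*)$ on $[0,T]$ is a function $u\in C([0,T];H^1)\cap C^1([0,T];L^2)$ with $u(0)=u_0$, $u_t(0)=u_1$ and $$u(t)=R(t,0)(u_0,u_1)+\int_0^t S(t,s)|u(s)|^p\,ds\quad\text{in } H^1(\mathbb R^n),\qquad 0\le t\le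 T .$$ A mild solution on $[0,T_{\max})$, $0<T_{\max}\le\infty$, is a function that is a mild solution on $[0,T]$ for every $0<T<T_{\max}$; it is maximal if it cannot be extended to a mild solution on a larger interval $[0,T')$. Theorem. Let $u_0\in L^1(\mathbb R^n)\cap H^1(\mathbb R^n)$ and $u_1\in L^1(\mathbb R^n)\cap L^2(\mathbb R^n)$ with $\int_{\mathbb R^n}u_1(x)\,dx>0$. Assume that $$1<p\le\frac{n+1}{(n-1)_+}\ \text{ if }\beta\ge-1,\qquad 1<p\le\frac{n(1-\beta)+2}{(n(1-\beta)-2)_+}\ \text{ if }\beta\le-1,$$ where $(a)_+=\max\{0,a\}$ and a quotient with denominator $0$ is read as $+\infty$. Then the maximal mild solution $u$ of $(*)$ blows up in finite time: if $[0,T_{\max})$ is its interval of existence, then $T_{\max}<\infty$ and $$\|u(t)\|_{H^1}+\|u_t(t)\|_{L^2}\to\infty\quad\text{as } t\to T_{\max}^- .$$ -/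

import Mathlib

open MeasureTheory Filter Topology Set
open scoped ENNReal ContDiff

/-! ### The spaces `L²(ℝⁿ)`, `H¹(ℝⁿ)`, `H²(ℝⁿ)` of real-valued functions -/

/-- `L²(ℝⁿ)`. -/
abbrev L2 (n : ℕ) : Type :=
  Lp ℝ 2 (volume : Measure (EuclideanSpace ℝ (Fin n)))

/-- Partial derivative `∂φ/∂xᵢ` of a differentiable function. -/
noncomputable def partialDeriv {n : ℕ} (i : Fin n) (φ : EuclideanSpace ℝ (Fin n) → ℝ)
    (x : EuclideanSpace ℝ (Fin n)) : ℝ :=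
  fderiv ℝ φ x (EuclideanSpace.single i 1)

/-- `g ∈ L²` is the weak partial derivative `∂ᵢ f` of `f ∈ L²`. -/
def IsWeakPartial {n : ℕ} (i : Fin n) (f g : L2 n) : Prop :=
  ∀ φ : EuclideanSpace ℝ (Fin n) → ℝ, ContDiff ℝ ∞ φ → HasCompactSupport φ →
    ∫ x, f x * partialDeriv i φ x = - ∫ x, g x * φ x

theorem L2.integral_mul_eq_inner {n : ℕ} (f : L2 n) {ψ : EuclideanSpace ℝ (Fin n) → ℝ}
    (h : MemLp ψ 2 volume) : ∫ x, f x * ψ x = inner ℝ (h.toLp ψ) f := by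
  rw [L2.inner_def]
  refine integral_congr_ae ?_
  filter_upwards [h.coeFn_toLp] with x hx
  simp [hx]

theorem memLp_testFunction {n : ℕ} {φ : EuclideanSpace ℝ (Fin n) → ℝ}
    (h : ContDiff ℝ ∞ φ) (hc : HasCompactSupport φ) : MemLp φ 2 volume :=
  h.continuous.memLp_of_hasCompactSupport hc

theorem memLp_partialDeriv {n : ℕ} (i : Fin n) {φ : EuclideanSpace ℝ (Fin n) → ℝ}
    (h : ContDiff ℝ ∞ φ) (hc : HasCompactSupport φ) : MemLp (partialDeriv i φ) 2 volume := by
  have h1 : Continuous (partialDeriv i φ) :=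
    (h.continuous_fderiv (by simp)).clm_apply continuous_const
  refine h1.memLp_of_hasCompactSupport ?_
  exact (hc.fderiv ℝ).comp_left (g := fun L => L (EuclideanSpace.single i 1)) (by simp)

theorem isWeakPartial_iff {n : ℕ} (i : Fin n) (f g : L2 n) :
    IsWeakPartial i f g ↔
      ∀ (φ : EuclideanSpace ℝ (Fin n) → ℝ) (h : ContDiff ℝ ∞ φ) (hc : HasCompactSupport φ),
        inner ℝ ((memLp_partialDeriv i h hc).toLp _) f
          + inner ℝ ((memLp_testFunction h hc).toLp _) g = 0 := by
  unfold IsWeakPartial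
  refine forall_congr' fun φ => forall_congr' fun h => forall_congr' fun hc => ?_
  rw [L2.integral_mul_eq_inner f (memLp_partialDeriv i h hc),
    L2.integral_mul_eq_inner g (memLp_testFunction h hc), eq_neg_iff_add_eq_zero]

/-- `H¹(ℝⁿ)`, realized as the set of pairs `(f, ∇f)` with `f ∈ L²` and weak gradient in `L²`;
the norm is `(‖f‖₂² + ∑ᵢ ‖∂ᵢ f‖₂²)^(1/2)`. -/
def H1Submodule (n : ℕ) : Submodule ℝ (WithLp 2 (L2 n × PiLp 2 (fun _ : Fin n => L2 n))) where
  carrier := {x | ∀ i, IsWeakPartial i x.fst (x.snd i)}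
  add_mem' := by
    intro x y hx hy i
    rw [isWeakPartial_iff]
    intro φ h hc
    have h1 := (isWeakPartial_iff i _ _).1 (hx i) φ h hc
    have h2 := (isWeakPartial_iff i _ _).1 (hy i) φ h hc
    simp only [WithLp.add_fst, WithLp.add_snd, PiLp.add_apply, inner_add_right]
    linarith
  zero_mem' := by
    intro i
    rw [isWeakPartial_iff]
    intro φ h hc
    simp
  smul_mem' := by
    intro c x hx i
    rw [isWeakPartial_iff]
    intro φ h hc
    have h1 := (isWeakPartial_iff i _ _).1 (hx i) φ h hc
    simp only [WithLp.smul_fst, WithLp.smul_snd, PiLp.smul_apply, inner_smul_right]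
    rw [← mul_add, h1, mul_zero]

theorem H1Submodule.isClosed (n : ℕ) :
    IsClosed (H1Submodule n : Set (WithLp 2 (L2 n × PiLp 2 (fun _ : Fin n => L2 n)))) := by
  have : (H1Submodule n : Set (WithLp 2 (L2 n × PiLp 2 (fun _ : Fin n => L2 n)))) =
      {x | ∀ (i : Fin n) (φ : EuclideanSpace ℝ (Fin n) → ℝ) (h : ContDiff ℝ ∞ φ)
        (hc : HasCompactSupport φ),
        inner ℝ ((memLp_partialDeriv i h hc).toLp _) x.fst
          + inner ℝ ((memLp_testFunction h hc).toLp _) (x.snd i) = 0} := by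
    ext x
    exact forall_congr' fun i => isWeakPartial_iff i _ _
  rw [this]
  simp only [ofPred_forall]
  refine isClosed_iInter fun i => isClosed_iInter fun φ => isClosed_iInter fun h =>
    isClosed_iInter fun hc => isClosed_eq ?_ continuous_const
  have c1 : Continuous fun x : WithLp 2 (L2 n × PiLp 2 (fun _ : Fin n => L2 n)) => x.fst := by
    fun_prop
  have c2 : Continuous fun x : WithLp 2 (L2 n × PiLp 2 (fun _ : Fin n => L2 n)) => x.snd i := by
    fun_prop
  exact (continuous_const.inner c1).add (continuous_const.inner c2)

/-- `H¹(ℝⁿ)` as a normed space. -/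
abbrev H1 (n : ℕ) : Type := H1Submodule n

noncomputable instance H1.instNormedAddCommGroup (n : ℕ) : NormedAddCommGroup (H1 n) :=
  Submodule.normedAddCommGroup (H1Submodule n)

noncomputable instance H1.instNormedSpace (n : ℕ) : NormedSpace ℝ (H1 n) :=
  Submodule.normedSpace (H1Submodule n)

instance H1.instCompleteSpace (n : ℕ) : CompleteSpace (H1 n) :=
  (H1Submodule.isClosed n).completeSpace_coe

/-- The underlying `L²` function of an element of `H¹`. -/
def H1.toL2 {n : ℕ} (f : H1 n) : L2 n := f.1.fst

/-- The weak partial derivative `∂ᵢ f ∈ L²` of `f ∈ H¹`. -/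
def H1.partial {n : ℕ} (i : Fin n) (f : H1 n) : L2 n := f.1.snd i

/-- `H²(ℝⁿ)`, realized as the set of pairs `(f, ∇f)` with `f ∈ H¹` and all `∂ᵢ f ∈ H¹`,
with the norm `(‖f‖²_{H¹} + ∑ᵢ ‖∂ᵢ f‖²_{H¹})^(1/2)`. -/
def H2Submodule (n : ℕ) : Submodule ℝ (WithLp 2 (H1 n × PiLp 2 (fun _ : Fin n => H1 n))) where
  carrier := {x | ∀ i, (x.snd i).toL2 = x.fst.partial i}
  add_mem' := by
    intro x y hx hy i
    have h1 := hx i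
    have h2 := hy i
    simp only [H1.toL2, H1.partial] at h1 h2 ⊢
    simp [h1, h2]
  zero_mem' := by
    intro i
    simp [H1.toL2, H1.partial]
  smul_mem' := by
    intro c x hx i
    have h1 := hx i
    simp only [H1.toL2, H1.partial] at h1 ⊢
    simp [h1]

/-- `H²(ℝⁿ)` as a normed space. -/
abbrev H2 (n : ℕ) : Type := H2Submodule n

noncomputable instance H2.instNormedAddCommGroup (n : ℕ) : NormedAddCommGroup (H2 n) :=
  Submodule.normedAddCommGroup (H2Submodule n)

noncomputable instance H2.instNormedSpace (n : ℕ) : NormedSpace ℝ (H2 n) :=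
  Submodule.normedSpace (H2Submodule n)

/-- The inclusion `H² ⊆ H¹`. -/
def H2.toH1 {n : ℕ} (f : H2 n) : H1 n := f.1.fst

/-- The Laplacian `Δf = ∑ᵢ ∂ᵢ(∂ᵢ f) ∈ L²` of `f ∈ H²`. -/
noncomputable def H2.laplacian {n : ℕ} (f : H2 n) : L2 n :=
  ∑ i, (f.1.snd i).partial i

/-! ### The linear equation `u_tt - Δu - (1+t)^{-β} Δu_t = 0` -/

/-- `u ∈ C¹([s,∞); H²) ∩ C²([s,∞); L²)` is the strong solution of
`u_tt - Δu - (1+t)^{-β} Δu_t = 0` for `t ≥ s` with `u(s) = f`, `u_t(s) = g`.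
Here `v` and `w` are the first and second time derivatives of `u`. -/
def IsStrongSolution {n : ℕ} (β s : ℝ) (f g : H2 n) (u : ℝ → H2 n) : Prop :=
  ∃ (v : ℝ → H2 n) (w : ℝ → L2 n),
    (∀ t ∈ Ici s, HasDerivWithinAt u (v t) (Ici s) t) ∧
    ContinuousOn v (Ici s) ∧
    (∀ t ∈ Ici s, HasDerivWithinAt (fun τ => (v τ).toH1.toL2) (w t) (Ici s) t) ∧
    ContinuousOn w (Ici s) ∧
    u s = f ∧ v s = g ∧
    ∀ t ∈ Ici s,
      w t - (u t).laplacian - (1 + t) ^ (-β) • (v t).laplacian = 0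

/-- `r = R(t,s)(f,g)` for `f ∈ H¹`, `g ∈ L²`, `t ≥ s`, where `R(t,s)` is the extension by
continuity to `H¹ × L²` of the operator which maps data in `H² × H²` at time `s` to the value
at time `t` of the strong solution of the linear equation. -/
def IsPropagated {n : ℕ} (β t s : ℝ) (f : H1 n) (g : L2 n) (r : H1 n) : Prop :=
  ∃ (F G : ℕ → H2 n) (U : ℕ → ℝ → H2 n),
    (∀ k, IsStrongSolution β s (F k) (G k) (U k)) ∧
    Tendsto (fun k => (F k).toH1) atTop (𝓝 f) ∧
    Tendsto (fun k => (G k).toH1.toL2) atTop (𝓝 g) ∧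
    Tendsto (fun k => (U k t).toH1) atTop (𝓝 r)

/-! ### Mild solutions of `u_tt - Δu - (1+t)^{-β} Δu_t = |u|^p` -/

/-- `u ∈ C([0,T]; H¹) ∩ C¹([0,T]; L²)`, with time derivative `v = u_t`, is a mild solution on
`[0,T]` with data `(u₀,u₁)`: for all `t ∈ [0,T]`,
`u(t) = R(t,0)(u₀,u₁) + ∫₀ᵗ S(t,s)|u(s)|^p ds` in `H¹`, where `S(t,s)g = R(t,s)(0,g)`.
In the definition `r` stands for `R(t,0)(u₀,u₁)`, `N` for `|u(s)|^p`
and `w s` for `S(t,s)|u(s)|^p`. -/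
def IsMildSolution {n : ℕ} (β p : ℝ) (u₀ : H1 n) (u₁ : L2 n) (T : ℝ)
    (u : ℝ → H1 n) (v : ℝ → L2 n) : Prop :=
  ContinuousOn u (Icc 0 T) ∧
  (∀ t ∈ Icc 0 T, HasDerivWithinAt (fun τ => (u τ).toL2) (v t) (Icc 0 T) t) ∧
  ContinuousOn v (Icc 0 T) ∧
  u 0 = u₀ ∧ v 0 = u₁ ∧
  ∀ t ∈ Icc 0 T, ∃ (r : H1 n) (w : ℝ → H1 n),
    IsPropagated β t 0 u₀ u₁ r ∧
    (∀ s ∈ Icc 0 t, ∃ N : L2 n,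
      (∀ᵐ x, N x = |(u s).toL2 x| ^ p) ∧ IsPropagated β t s 0 N (w s)) ∧
    IntervalIntegrable w volume 0 t ∧
    u t = r + ∫ s in (0 : ℝ)..t, w s

/-- `u` is a mild solution on the half-open interval `[0,Tmax)`, `0 < Tmax ≤ ∞`. -/
def IsMildSolutionBefore {n : ℕ} (β p : ℝ) (u₀ : H1 n) (u₁ : L2 n) (Tmax : EReal)
    (u : ℝ → H1 n) (v : ℝ → L2 n) : Prop :=
  0 < Tmax ∧ ∀ T : ℝ, 0 < T → (T : EReal) < Tmax → IsMildSolution β p u₀ u₁ T u v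

/-- `u` is a maximal mild solution, with maximal existence time `Tmax ∈ (0,∞]`: it is a mild
solution on `[0,Tmax)` which has no extension to a mild solution on a larger interval. -/
def IsMaximalMildSolution {n : ℕ} (β p : ℝ) (u₀ : H1 n) (u₁ : L2 n) (Tmax : EReal)
    (u : ℝ → H1 n) (v : ℝ → L2 n) : Prop :=
  IsMildSolutionBefore β p u₀ u₁ Tmax u v ∧
  ∀ (T' : EReal) (u' : ℝ → H1 n) (v' : ℝ → L2 n),
    IsMildSolutionBefore β p u₀ u₁ T' u' v' →
    (∀ t : ℝ, 0 ≤ t → (t : EReal) < Tmax → u' t = u t) →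
    T' ≤ Tmax

/-! The theorem has two halves: a solution whose lifetime is finite has norm tending to infinity,
and no solution lives forever.

The first half is the usual continuation argument. The hypotheses on p force p(n-1) ≤ n+1, so H¹
embeds into L^{2p} and u ↦ |u|^p is Lipschitz on bounded sets from H¹ to L² (`exists_isPowerMap`). A
contraction argument then gives an existence time depending only on a bound for the data
(`exists_local_isWeakSolution`). If the norm stayed below some M along times approaching a finite T,
restarting at one such time close to T would extend the solution past T, contradicting maximality
(`IsMaximalMildSolution.tendsto_atTop`).

The second half is the test function method. The equation is paired with φ_R(t,x) = e(t/R) g(x/R^σ),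
where σ = 1 if β ≥ -1 and σ = (1-β)/2 if β ≤ -1. With this σ all terms in which derivatives fall on
φ_R, including those carrying (1+t)^{-β} and its derivative, are O(R^{-2}) times φ_R^{1/p}. Young's
inequality bounds them by a multiple of ∫∫|u|^p φ_R plus an error of order R^{1+nσ-2p/(p-1)}, and
the condition on p says exactly that this exponent is not positive. At the critical p the error is
merely bounded. The missing smallness comes from two refinements. The derivatives of φ_R live where
φ_{R/2} vanishes, so only ∫∫|u|^p(φ_R - φ_{R/2}) is needed on the right (`weight_le`,
`slice_estimate`); and Young's inequality is used with a free parameter θ, the error being O(θ^{-r})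
with r = p/(p-1). Along R = 2^k, the integrals I_k = ∫∫|u|^p φ_R increase and are bounded, so their
increments tend to 0; taking θ large and then k large contradicts the positive limit ∫u₁ of the data
term (`false_of_forall_le_rpow`, `not_global_of_integral_pos`).

Both halves need mild solutions in a form that can be differentiated, estimated and glued.
Restricting the Fourier transform to |ξ| ≤ k makes the Laplacian bounded, and the equation becomes a
linear ODE in L² × L² with its own propagator and Duhamel formula. Every value of R(t,s) is
identified frequency band by frequency band (`IsPropagated.freqProj_eq`). This makes mild solutions
equivalent to `IsWeakSolution`, the equation required on each band (`IsMildSolution.isWeakSolution`,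
`IsWeakSolution.isMildSolution`). An energy inequality with constants independent of k
(`IsRegularSolution.energy_le`) passes to the limit and gives existence, uniqueness and continuous
dependence for the forced linear equation. Pairing a weak solution with a test function and letting
k → ∞ yields the identity used in the second half. -/

/-! ### Linear ordinary differential equations in Banach spaces -/

section LinearODE

variable {X : Type*} [NormedAddCommGroup X] [NormedSpace ℝ X]

/-- The Picard iterates of the affine equation `x' = A x + H`, as increments. -/
noncomputable def linearPicard (A : ℝ → X →L[ℝ] X) (f : ℝ → X) (a : ℝ) : ℕ → ℝ → X
  | 0 => f
  | k + 1 => fun t => ∫ τ in a..t, A τ (linearPicard A f a k τ)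

theorem continuous_linearPicard [CompleteSpace X] {A : ℝ → X →L[ℝ] X} (hA : Continuous A) {f : ℝ → X}
    (hf : Continuous f) (a : ℝ) (k : ℕ) : Continuous (linearPicard A f a k) := by
  induction k with
  | zero => exact hf
  | succ k ih =>
    exact intervalIntegral.continuous_primitive
      (fun _ _ => (hA.clm_apply ih).intervalIntegrable _ _) a

/-- Each integration of the k-th bound raises the power of |t-a| and contributes a factor 1/(k+1),
whence the factorial. -/
theorem norm_linearPicard_le {A : ℝ → X →L[ℝ] X} {f : ℝ → X} {a R C D : ℝ}
    (hC : ∀ t, |t - a| ≤ R → ‖A t‖ ≤ C) (hD : ∀ t, |t - a| ≤ R → ‖f t‖ ≤ D) (k : ℕ) :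
    ∀ t, |t - a| ≤ R → ‖linearPicard A f a k t‖ ≤ D * (C * |t - a|) ^ k / k.factorial := by
  induction k with
  | zero => intro t ht; simpa [linearPicard] using hD t ht
  | succ k ih =>
    intro t ht
    have hC0 : 0 ≤ C := (norm_nonneg _).trans (hC t ht)
    have hsub : ∀ τ ∈ uIoc a t, |τ - a| ≤ R := by
      intro τ hτ
      refine le_trans ?_ ht
      rcases le_total a t with h | h
      · rw [uIoc_of_le h] at hτ
        rw [abs_of_nonneg (by linarith [hτ.1]), abs_of_nonneg (by linarith)]
        linarith [hτ.2]
      · rw [uIoc_of_ge h] at hτ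
        rw [abs_of_nonpos (by linarith [hτ.2]), abs_of_nonpos (by linarith)]
        linarith [hτ.1]
    have hcont : Continuous fun τ : ℝ => C * (D * (C * |τ - a|) ^ k / k.factorial) := by fun_prop
    have h1 : ‖linearPicard A f a (k + 1) t‖ ≤
        ∫ τ in uIoc a t, C * (D * (C * |τ - a|) ^ k / k.factorial) := by
      refine (intervalIntegral.norm_integral_le_integral_norm_uIoc).trans ?_
      refine integral_mono_of_nonneg (Eventually.of_forall fun _ => norm_nonneg _)
        (hcont.integrableOn_uIoc) ?_
      refine (ae_restrict_iff' measurableSet_uIoc).2 (Eventually.of_forall fun τ hτ => ?_)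
      refine (ContinuousLinearMap.le_opNorm _ _).trans ?_
      exact mul_le_mul (hC τ (hsub τ hτ)) (ih τ (hsub τ hτ)) (norm_nonneg _) hC0
    refine h1.trans (le_of_eq ?_)
    have h2 : (fun τ : ℝ => C * (D * (C * |τ - a|) ^ k / k.factorial)) =
        fun τ : ℝ => (C ^ (k + 1) * D / k.factorial) * |τ - a| ^ k := by
      funext τ; rw [mul_pow]; ring
    rw [h2, integral_const_mul, integral_pow_abs_sub_uIoc, Nat.factorial_succ]
    have : (k.factorial : ℝ) ≠ 0 := by positivity
    push_cast
    rw [mul_pow]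
    field_simp

/-- Global solvability of affine equations with continuous coefficients. -/
theorem exists_hasDerivAt_affine [CompleteSpace X] {A : ℝ → X →L[ℝ] X} (hA : Continuous A)
    {H : ℝ → X} (hH : Continuous H) (a : ℝ) (x₀ : X) :
    ∃ x : ℝ → X, x a = x₀ ∧ ∀ t, HasDerivAt x (A t (x t) + H t) t := by
  set f : ℝ → X := fun t => x₀ + ∫ τ in a..t, H τ with hfdef
  have hfd : ∀ t, HasDerivAt f (H t) t := fun t =>
    (intervalIntegral.integral_hasDerivAt_right (hH.intervalIntegrable _ _)
      (hH.stronglyMeasurableAtFilter _ _) hH.continuousAt).const_add x₀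
  have hf : Continuous f := continuous_iff_continuousAt.2 fun t => (hfd t).continuousAt
  set g := linearPicard A f a with hg
  have hgc : ∀ k, Continuous (g k) := continuous_linearPicard hA hf a
  set g' : ℕ → ℝ → X := fun k t => Nat.casesOn k (H t) (fun j => A t (g j t)) with hg'
  have hgd : ∀ k t, HasDerivAt (g k) (g' k t) t := by
    intro k t
    cases k with
    | zero => exact hfd t
    | succ j =>
      have hc : Continuous fun τ => A τ (g j τ) := hA.clm_apply (hgc j)
      exact intervalIntegral.integral_hasDerivAt_right (hc.intervalIntegrable _ _)
        (hc.stronglyMeasurableAtFilter _ _) hc.continuousAt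
  have hga : ∀ k, g (k + 1) a = 0 := fun k => by simp [hg, linearPicard]
  -- The solution is the sum of the Picard increments. It is differentiated termwise: g_{k+1}' = A
  -- g_k, so the derivatives sum to A x + H.
  refine ⟨fun t => ∑' k, g k t, ?_, ?_⟩
  · show ∑' k, g k a = x₀
    rw [tsum_eq_single 0]
    · simp [hg, linearPicard, hfdef]
    · intro k hk
      obtain ⟨j, rfl⟩ := Nat.exists_eq_succ_of_ne_zero hk
      exact hga j
  intro t
  -- Termwise differentiation needs a summable bound on one open ball that contains both a and t; on
  -- this ball the exponential series of CR serves.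
  set R : ℝ := |t - a| + 1
  have hK : IsCompact (Metric.closedBall a R) := isCompact_closedBall a R
  have hmem : ∀ s, |s - a| ≤ R → s ∈ Metric.closedBall a R := fun s hs => by
    rwa [Metric.mem_closedBall, Real.dist_eq]
  obtain ⟨C, hC⟩ := hK.exists_bound_of_continuousOn hA.continuousOn
  obtain ⟨D, hD⟩ := hK.exists_bound_of_continuousOn hf.continuousOn
  obtain ⟨D', hD'⟩ := hK.exists_bound_of_continuousOn hH.continuousOn
  have hR : 0 ≤ R := by positivity
  have hC0 : 0 ≤ C := (norm_nonneg _).trans (hC a (hmem a (by simpa using hR)))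
  have hD0 : 0 ≤ D := (norm_nonneg _).trans (hD a (hmem a (by simpa using hR)))
  have hgb : ∀ k s, |s - a| ≤ R → ‖g k s‖ ≤ D * ((C * R) ^ k / k.factorial) := by
    intro k s hs
    refine (norm_linearPicard_le (fun s hs => hC s (hmem s hs)) (fun s hs => hD s (hmem s hs))
      k s hs).trans ?_
    rw [mul_div_assoc]
    gcongr
  have hsumm : Summable fun k : ℕ => D * ((C * R) ^ k / k.factorial) :=
    (Real.summable_pow_div_factorial _).mul_left D
  set u : ℕ → ℝ := fun k => Nat.casesOn k D' (fun j => C * (D * ((C * R) ^ j / j.factorial)))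
  have hu : Summable u := (summable_nat_add_iff 1).1 (hsumm.mul_left C)
  have htI : t ∈ Metric.ball a R := by
    rw [Metric.mem_ball, Real.dist_eq]; exact lt_add_one _
  have hball : ∀ s ∈ Metric.ball a R, |s - a| ≤ R := fun s hs => by
    rw [Metric.mem_ball, Real.dist_eq] at hs; exact hs.le
  have key := hasDerivAt_tsum_of_isPreconnected hu Metric.isOpen_ball
    (convex_ball a R).isPreconnected (g := g) (g' := g')
    (fun k s _ => hgd k s) (fun k s hs => by
      cases k with
      | zero => exact hD' s (hmem s (hball s hs))
      | succ j =>
        refine (ContinuousLinearMap.le_opNorm _ _).trans ?_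
        exact mul_le_mul (hC s (hmem s (hball s hs))) (hgb j s (hball s hs)) (norm_nonneg _) hC0)
    (Metric.mem_ball_self (by positivity) : a ∈ Metric.ball a R)
    ((summable_nat_add_iff 1).1 (by simp only [hga]; exact summable_zero)) htI
  have hsg : Summable fun k => g k t :=
    Summable.of_norm_bounded hsumm (fun k => hgb k t (hball t htI))
  have hsg' : Summable fun k => A t (g k t) := hsg.map (A t) (A t).continuous
  have hs' : Summable fun k => g' k t := (summable_nat_add_iff 1).1 hsg'
  have : ∑' k, g' k t = A t (∑' k, g k t) + H t := by
    rw [hs'.tsum_eq_zero_add, (A t).map_tsum hsg, add_comm]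
    rfl
  rwa [this] at key

end LinearODE

/-! ### Calculus on closed intervals: Duhamel's formula and gluing -/

section Calculus

variable {X : Type*} [NormedAddCommGroup X] [NormedSpace ℝ X]

theorem HasDerivWithinAt.hasDerivWithinAt_Ioi_of_Icc {f : ℝ → X} {f' : X} {a b t : ℝ}
    (h : HasDerivWithinAt f f' (Icc a b) t) (ht : t ∈ Ico a b) : HasDerivWithinAt f f' (Ioi t) t :=
  (h.mono_of_mem_nhdsWithin (Icc_mem_nhdsGT_of_mem ht))

theorem integral_eq_sub_of_hasDerivWithinAt_Icc [CompleteSpace X] {f f' : ℝ → X} {a b : ℝ}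
    (hab : a ≤ b) (h : ∀ t ∈ Icc a b, HasDerivWithinAt f (f' t) (Icc a b) t)
    (hi : IntervalIntegrable f' volume a b) : ∫ t in a..b, f' t = f b - f a :=
  intervalIntegral.integral_eq_sub_of_hasDeriv_right_of_le hab
    (fun t ht => (h t ht).continuousWithinAt)
    (fun t ht => (h t (Ioo_subset_Icc_self ht)).hasDerivWithinAt_Ioi_of_Icc (Ioo_subset_Ico_self ht))
    hi

/-- A continuous function which is an indefinite integral is differentiable on the interval. -/
theorem hasDerivWithinAt_of_eq_integral [CompleteSpace X] {f f' : ℝ → X} {a b : ℝ} {c : X}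
    (hf' : ContinuousOn f' (Icc a b)) (h : ∀ t ∈ Icc a b, f t = c + ∫ s in a..t, f' s) :
    ∀ t ∈ Icc a b, HasDerivWithinAt f (f' t) (Icc a b) t := by
  intro t ht
  have hab : a ≤ b := ht.1.trans ht.2
  -- Extending f' by constants beyond the endpoints gives a two-sided derivative everywhere, so the
  -- endpoints need no separate treatment.
  have hc : Continuous fun s => f' (projIcc a b hab s) :=
    (continuousOn_iff_continuous_domRestrict.1 hf').comp continuous_projIcc
  have heq : ∀ s ∈ Icc a b, f s = c + ∫ τ in a..s, f' (projIcc a b hab τ) := by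
    intro s hs
    rw [h s hs]
    congr 1
    refine intervalIntegral.integral_congr fun τ hτ => ?_
    rw [uIcc_of_le hs.1] at hτ
    rw [projIcc_of_mem hab ⟨hτ.1, hτ.2.trans hs.2⟩]
  have hd : HasDerivAt (fun s => c + ∫ τ in a..s, f' (projIcc a b hab τ)) (f' t) t := by
    have := (intervalIntegral.integral_hasDerivAt_right (hc.intervalIntegrable a t)
      (hc.stronglyMeasurableAtFilter _ _) hc.continuousAt).const_add c
    rwa [projIcc_of_mem hab ht] at this
  exact hd.hasDerivWithinAt.congr heq (heq t ht)

/-- Representation of solutions of an affine equation by the solution `Θ` of the backward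
operator equation. -/
theorem eq_add_integral_of_hasDerivWithinAt_affine [CompleteSpace X] {A : ℝ → X →L[ℝ] X}
    {H x : ℝ → X} {s t : ℝ} (hst : s ≤ t) (hH : ContinuousOn H (Icc s t))
    {Θ : ℝ → X →L[ℝ] X} (hΘ : ∀ τ ∈ Icc s t, HasDerivAt Θ (-(Θ τ ∘L A τ)) τ) (hΘt : Θ t = 1)
    (hx : ∀ τ ∈ Icc s t, HasDerivWithinAt x (A τ (x τ) + H τ) (Icc s t) τ) :
    x t = Θ s (x s) + ∫ τ in s..t, Θ τ (H τ) := by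
  -- In the product rule the terms with A cancel, because Θ' = -ΘA.
  have hd : ∀ τ ∈ Icc s t, HasDerivWithinAt (fun τ => Θ τ (x τ)) (Θ τ (H τ)) (Icc s t) τ := by
    intro τ hτ
    have := (hΘ τ hτ).hasDerivWithinAt.clm_apply (hx τ hτ)
    convert this using 1
    simp
  have hΘc : ContinuousOn Θ (Icc s t) := fun τ hτ => (hΘ τ hτ).continuousAt.continuousWithinAt
  have hi : IntervalIntegrable (fun τ => Θ τ (H τ)) volume s t :=
    (hΘc.clm_apply hH).intervalIntegrable_of_Icc hst
  have := integral_eq_sub_of_hasDerivWithinAt_Icc hst hd hi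
  rw [this, hΘt]
  simp

/-- Solvability of the backward operator equation `Θ' = -Θ A`, `Θ(t) = 1`. -/
theorem exists_backward_propagator [CompleteSpace X] {A : ℝ → X →L[ℝ] X} (hA : Continuous A)
    (t : ℝ) : ∃ Θ : ℝ → X →L[ℝ] X, Θ t = 1 ∧ ∀ τ, HasDerivAt Θ (-(Θ τ ∘L A τ)) τ := by
  have hc : Continuous fun τ => -((ContinuousLinearMap.compL ℝ X X X).flip (A τ)) := by fun_prop
  obtain ⟨Θ, h1, h2⟩ := exists_hasDerivAt_affine hc (continuous_const (y := (0 : X →L[ℝ] X))) t 1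
  refine ⟨Θ, h1, fun τ => ?_⟩
  have h := h2 τ
  rw [add_zero] at h
  exact h

/-- Two differentiable functions with matching values and derivatives can be glued. -/
theorem hasDerivWithinAt_glue {f g f' g' : ℝ → X} {a b c : ℝ} (hab : a ≤ b) (hbc : b ≤ c)
    (hf : ∀ t ∈ Icc a b, HasDerivWithinAt f (f' t) (Icc a b) t)
    (hg : ∀ t ∈ Icc b c, HasDerivWithinAt g (g' t) (Icc b c) t)
    (h : f b = g b) (h' : f' b = g' b) :
    ∀ t ∈ Icc a c, HasDerivWithinAt (fun t => if t ≤ b then f t else g t)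
      (if t ≤ b then f' t else g' t) (Icc a c) t := by
  intro t ht
  have hF : ∀ s ∈ Icc a b, (if s ≤ b then f s else g s) = f s := fun s hs => if_pos hs.2
  have hG : ∀ s ∈ Icc b c, (if s ≤ b then f s else g s) = g s := by
    intro s hs
    split_ifs with hsb
    · rw [le_antisymm hsb hs.1, h]
    · rfl
  have hG' : ∀ s ∈ Icc b c, (if s ≤ b then f' s else g' s) = g' s := by
    intro s hs
    split_ifs with hsb
    · rw [le_antisymm hsb hs.1, h']
    · rfl
  rcases lt_trichotomy t b with hlt | rfl | hgt
  · rw [if_pos hlt.le]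
    refine (((hf t ⟨ht.1, hlt.le⟩).congr hF (hF t ⟨ht.1, hlt.le⟩))).mono_of_mem_nhdsWithin ?_
    filter_upwards [self_mem_nhdsWithin, mem_nhdsWithin_of_mem_nhds (Iio_mem_nhds hlt)] with s h1 h2
    exact ⟨h1.1, le_of_lt h2⟩
  · rw [← Icc_union_Icc_eq_Icc hab hbc, if_pos le_rfl]
    refine HasDerivWithinAt.union ?_ ?_
    · exact (hf t ⟨hab, le_rfl⟩).congr hF (hF t ⟨hab, le_rfl⟩)
    · rw [h']
      exact (hg t ⟨le_rfl, hbc⟩).congr hG (hG t ⟨le_rfl, hbc⟩)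
  · rw [if_neg (not_le.2 hgt)]
    refine (((hg t ⟨hgt.le, ht.2⟩).congr hG (hG t ⟨hgt.le, ht.2⟩))).mono_of_mem_nhdsWithin ?_
    filter_upwards [self_mem_nhdsWithin, mem_nhdsWithin_of_mem_nhds (Ioi_mem_nhds hgt)] with s h1 h2
    exact ⟨le_of_lt h2, h1.2⟩

theorem continuousOn_glue {Y : Type*} [TopologicalSpace Y] {f g : ℝ → Y} {a b c : ℝ} (hab : a ≤ b)
    (hbc : b ≤ c) (hf : ContinuousOn f (Icc a b)) (hg : ContinuousOn g (Icc b c)) (h : f b = g b) :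
    ContinuousOn (fun t => if t ≤ b then f t else g t) (Icc a c) := by
  rw [← Icc_union_Icc_eq_Icc hab hbc]
  refine ContinuousOn.union_of_isClosed ?_ ?_ isClosed_Icc isClosed_Icc
  · exact hf.congr fun s hs => if_pos hs.2
  · refine hg.congr fun s hs => ?_
    show (if s ≤ b then f s else g s) = g s
    split_ifs with hsb
    · rw [le_antisymm hsb hs.1, h]
    · rfl

end Calculus

open scoped FourierTransform LineDeriv

/-! ### The Fourier transform of real-valued square integrable functions -/

/-- The Euclidean space `ℝⁿ`. -/
abbrev Eucl (n : ℕ) : Type := EuclideanSpace ℝ (Fin n)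

/-- `L²(ℝⁿ; ℂ)`. -/
abbrev L2C (n : ℕ) : Type := Lp ℂ 2 (volume : Measure (Eucl n))

section Fourier

variable {n : ℕ}

/-- The inclusion `L²(ℝⁿ; ℝ) ⊆ L²(ℝⁿ; ℂ)`. -/
noncomputable def L2.toComplex (n : ℕ) : L2 n →L[ℝ] L2C n := Complex.ofRealCLM.compLpL 2 volume

/-- The real part of a square integrable function. -/
noncomputable def L2C.re (n : ℕ) : L2C n →L[ℝ] L2 n := Complex.reCLM.compLpL 2 volume

/-- The Fourier transform as a real linear isometry. -/
noncomputable def L2C.fourier (n : ℕ) : L2C n →ₗᵢ[ℝ] L2C n where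
  toLinearMap :=
    ((Lp.fourierTransformₗᵢ (Eucl n) ℂ).toLinearEquiv.toLinearMap).restrictScalars ℝ
  norm_map' := (Lp.fourierTransformₗᵢ (Eucl n) ℂ).norm_map

/-- The inverse Fourier transform as a real linear isometry. -/
noncomputable def L2C.fourierInv (n : ℕ) : L2C n →ₗᵢ[ℝ] L2C n where
  toLinearMap :=
    ((Lp.fourierTransformₗᵢ (Eucl n) ℂ).symm.toLinearEquiv.toLinearMap).restrictScalars ℝ
  norm_map' := (Lp.fourierTransformₗᵢ (Eucl n) ℂ).symm.norm_map

theorem L2C.fourier_fourierInv (Y : L2C n) : L2C.fourier n (L2C.fourierInv n Y) = Y :=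
  (Lp.fourierTransformₗᵢ (Eucl n) ℂ).apply_symm_apply Y

theorem L2C.fourierInv_fourier (Y : L2C n) : L2C.fourierInv n (L2C.fourier n Y) = Y :=
  (Lp.fourierTransformₗᵢ (Eucl n) ℂ).symm_apply_apply Y

/-- The Fourier transform of real-valued functions. -/
noncomputable def fourierL (n : ℕ) : L2 n →L[ℝ] L2C n :=
  (L2C.fourier n).toContinuousLinearMap ∘L L2.toComplex n

/-- The real part of the inverse Fourier transform. -/
noncomputable def fourierInvL (n : ℕ) : L2C n →L[ℝ] L2 n :=
  L2C.re n ∘L (L2C.fourierInv n).toContinuousLinearMap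

theorem L2.coeFn_toComplex (f : L2 n) : L2.toComplex n f =ᵐ[volume] fun x => (f x : ℂ) :=
  ContinuousLinearMap.coeFn_compLpL _ _

theorem L2C.coeFn_re (f : L2C n) : L2C.re n f =ᵐ[volume] fun x => (f x).re :=
  ContinuousLinearMap.coeFn_compLpL _ _

theorem L2C.re_toComplex (f : L2 n) : L2C.re n (L2.toComplex n f) = f := by
  refine Lp.ext ?_
  filter_upwards [L2C.coeFn_re (L2.toComplex n f), L2.coeFn_toComplex f] with x h1 h2
  rw [h1, h2, Complex.ofReal_re]

/-- Taking real parts is adjoint to including real functions into complex ones, for the real inner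
product. Inverse transforms can therefore be projected to real functions without tracking Hermitian
symmetry of the Fourier side. -/
theorem L2C.inner_re (Y : L2C n) (f : L2 n) :
    inner ℝ (L2C.re n Y) f = inner ℝ Y (L2.toComplex n f) := by
  rw [L2.inner_def, L2.inner_def]
  refine integral_congr_ae ?_
  filter_upwards [L2C.coeFn_re Y, L2.coeFn_toComplex f] with x h1 h2
  rw [h1, h2]
  simp [Complex.inner]

theorem fourierInvL_fourierL (f : L2 n) : fourierInvL n (fourierL n f) = f := by
  simp only [fourierInvL, fourierL, ContinuousLinearMap.comp_apply,
    LinearIsometry.coe_toContinuousLinearMap, L2C.fourierInv_fourier, L2C.re_toComplex]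

theorem fourierL_injective : Function.Injective (fourierL n) :=
  Function.LeftInverse.injective fourierInvL_fourierL

theorem inner_fourierInvL (Y : L2C n) (f : L2 n) :
    inner ℝ (fourierInvL n Y) f = inner ℝ Y (fourierL n f) := by
  simp only [fourierInvL, fourierL, ContinuousLinearMap.comp_apply,
    LinearIsometry.coe_toContinuousLinearMap, L2C.inner_re]
  conv_rhs => rw [← L2C.fourier_fourierInv Y]
  rw [LinearIsometry.inner_map_map]

theorem inner_fourierL (f g : L2 n) : inner ℝ (fourierL n f) (fourierL n g) = inner ℝ f g := by
  rw [← inner_fourierInvL, fourierInvL_fourierL]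

/-! ### Truncated Fourier multipliers -/

theorem memLp_indicator_closedBall (q : C(Eucl n, ℂ)) (k : ℕ) :
    MemLp ((Metric.closedBall (0 : Eucl n) k).indicator q) ∞ volume := by
  obtain ⟨C, hC⟩ := (isCompact_closedBall (0 : Eucl n) (k : ℝ)).exists_bound_of_continuousOn
    q.continuous.continuousOn
  refine memLp_top_of_bound
    (q.continuous.measurable.indicator Metric.isClosed_closedBall.measurableSet).aestronglyMeasurable
    (max C 0) (Eventually.of_forall fun x => ?_)
  by_cases hx : x ∈ Metric.closedBall (0 : Eucl n) k
  · rw [indicator_of_mem hx]; exact (hC x hx).trans (le_max_left _ _)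
  · rw [indicator_of_notMem hx, norm_zero]; exact le_max_right _ _

/-- Multiplication by `1_{|ξ| ≤ k} q(ξ)`. -/
noncomputable def freqMul (q : C(Eucl n, ℂ)) (k : ℕ) : L2C n →L[ℝ] L2C n :=
  (ContinuousLinearMap.mul ℝ ℂ).holderL volume ∞ 2 2 ((memLp_indicator_closedBall q k).toLp _)

theorem coeFn_freqMul (q : C(Eucl n, ℂ)) (k : ℕ) (Y : L2C n) :
    freqMul q k Y =ᵐ[volume] fun ξ => (Metric.closedBall (0 : Eucl n) k).indicator q ξ * Y ξ := by
  have h := ContinuousLinearMap.coeFn_holder (r := 2) (ContinuousLinearMap.mul ℝ ℂ)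
    ((memLp_indicator_closedBall q k).toLp _) Y
  filter_upwards [h, (memLp_indicator_closedBall q k).coeFn_toLp] with ξ h1 h2
  rw [← h2]
  exact h1

theorem freqMul_freqMul (q r : C(Eucl n, ℂ)) (k : ℕ) (Y : L2C n) :
    freqMul q k (freqMul r k Y) = freqMul (q * r) k Y := by
  refine Lp.ext ?_
  filter_upwards [coeFn_freqMul q k (freqMul r k Y), coeFn_freqMul r k Y,
    coeFn_freqMul (q * r) k Y] with ξ h1 h2 h3
  rw [h1, h2, h3]
  by_cases hξ : ξ ∈ Metric.closedBall (0 : Eucl n) k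
  · simp [hξ, mul_assoc]
  · simp [hξ]

theorem freqMul_sum {ι : Type*} (s : Finset ι) (q : ι → C(Eucl n, ℂ)) (k : ℕ) (Y : L2C n) :
    freqMul (∑ i ∈ s, q i) k Y = ∑ i ∈ s, freqMul (q i) k Y := by
  classical
  induction s using Finset.induction_on with
  | empty =>
    refine Lp.ext ?_
    filter_upwards [coeFn_freqMul (0 : C(Eucl n, ℂ)) k Y, Lp.coeFn_zero ℂ 2 volume] with ξ h1 h2
    simp only [Finset.sum_empty]
    rw [h1, h2]
    simp
  | insert a s ha ih =>
    rw [Finset.sum_insert ha, Finset.sum_insert ha, ← ih]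
    refine Lp.ext ?_
    filter_upwards [coeFn_freqMul (q a + ∑ i ∈ s, q i) k Y, coeFn_freqMul (q a) k Y,
      coeFn_freqMul (∑ i ∈ s, q i) k Y,
      Lp.coeFn_add (freqMul (q a) k Y) (freqMul (∑ i ∈ s, q i) k Y)] with ξ h1 h2 h3 h4
    rw [h1, h4, Pi.add_apply, h2, h3]
    by_cases hξ : ξ ∈ Metric.closedBall (0 : Eucl n) k
    · simp only [indicator_of_mem hξ, ContinuousMap.add_apply, add_mul]
    · simp [hξ]

theorem inner_freqMul_of_skew {q : C(Eucl n, ℂ)} (hq : ∀ ξ, (q ξ).re = 0) (k : ℕ) (Y W : L2C n) :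
    inner ℝ (freqMul q k Y) W = - inner ℝ Y (freqMul q k W) := by
  rw [L2.inner_def, L2.inner_def, ← integral_neg]
  refine integral_congr_ae ?_
  filter_upwards [coeFn_freqMul q k Y, coeFn_freqMul q k W] with ξ h1 h2
  rw [h1, h2]
  by_cases hξ : ξ ∈ Metric.closedBall (0 : Eucl n) k
  · simp only [indicator_of_mem hξ, Complex.inner, Complex.mul_re, Complex.mul_im, hq, map_mul,
      Complex.conj_re, Complex.conj_im]
    ring
  · simp [hξ]

theorem inner_freqMul_of_real {q : C(Eucl n, ℂ)} (hq : ∀ ξ, (q ξ).im = 0) (k : ℕ) (Y W : L2C n) :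
    inner ℝ (freqMul q k Y) W = inner ℝ Y (freqMul q k W) := by
  rw [L2.inner_def, L2.inner_def]
  refine integral_congr_ae ?_
  filter_upwards [coeFn_freqMul q k Y, coeFn_freqMul q k W] with ξ h1 h2
  rw [h1, h2]
  by_cases hξ : ξ ∈ Metric.closedBall (0 : Eucl n) k
  · simp only [indicator_of_mem hξ, Complex.inner, Complex.mul_re, Complex.mul_im, hq, map_mul,
      Complex.conj_re, Complex.conj_im]
    ring
  · simp [hξ]

/-- The squared error is the integral of |Y|² outside the ball of radius k, which vanishes by
dominated convergence. -/
theorem tendsto_freqMul_one (Y : L2C n) :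
    Tendsto (fun k : ℕ => freqMul 1 k Y) atTop (𝓝 Y) := by
  rw [tendsto_iff_norm_sub_tendsto_zero]
  have h2 : Tendsto (fun k : ℕ => ‖freqMul 1 k Y - Y‖ ^ 2) atTop (𝓝 0) := by
    have heq : ∀ k : ℕ, ‖freqMul 1 k Y - Y‖ ^ 2 =
        ∫ ξ, (Metric.closedBall (0 : Eucl n) k)ᶜ.indicator (fun ξ => ‖Y ξ‖ ^ 2) ξ := by
      intro k
      rw [← real_inner_self_eq_norm_sq, L2.inner_def]
      refine integral_congr_ae ?_
      filter_upwards [Lp.coeFn_sub (freqMul 1 k Y) Y, coeFn_freqMul 1 k Y] with ξ h1 h2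
      rw [h1, Pi.sub_apply, h2, real_inner_self_eq_norm_sq]
      by_cases hξ : ξ ∈ Metric.closedBall (0 : Eucl n) k
      · rw [indicator_of_mem hξ, indicator_of_notMem (by simpa using hξ)]; simp
      · rw [indicator_of_notMem hξ, indicator_of_mem (by simpa using hξ)]; simp
    simp only [heq]
    have hint : Integrable (fun ξ => ‖Y ξ‖ ^ 2) volume :=
      (memLp_two_iff_integrable_sq_norm (Lp.aestronglyMeasurable Y)).1 (Lp.memLp Y)
    have := tendsto_integral_of_dominated_convergence (μ := (volume : Measure (Eucl n)))
      (F := fun (k : ℕ) ξ => (Metric.closedBall (0 : Eucl n) k)ᶜ.indicator (fun ξ => ‖Y ξ‖ ^ 2) ξ)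
      (f := fun _ => (0 : ℝ)) (fun ξ => ‖Y ξ‖ ^ 2)
      (fun k => (hint.indicator Metric.isClosed_closedBall.measurableSet.compl).aestronglyMeasurable)
      hint
      (fun k => Eventually.of_forall fun ξ => by
        refine (norm_indicator_le_norm_self _ _).trans (le_of_eq ?_)
        simp)
      (Eventually.of_forall fun ξ => by
        refine tendsto_const_nhds.congr' ?_
        filter_upwards [eventually_ge_atTop ⌈‖ξ‖⌉₊] with k hk
        rw [indicator_of_notMem]
        simpa using (Nat.ceil_le.1 hk))
    simpa using this
  have := h2.sqrt
  simpa [Real.sqrt_sq] using this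

/-- The symbol `2πiξᵢ` of `∂ᵢ`. -/
noncomputable def derivSymbol (i : Fin n) : C(Eucl n, ℂ) where
  toFun ξ := 2 * Real.pi * Complex.I * ((inner ℝ ξ (EuclideanSpace.single i (1 : ℝ)) : ℝ) : ℂ)
  continuous_toFun := by fun_prop

theorem derivSymbol_apply (i : Fin n) (ξ : Eucl n) : derivSymbol i ξ =
    2 * Real.pi * Complex.I * ((inner ℝ ξ (EuclideanSpace.single i (1 : ℝ)) : ℝ) : ℂ) := rfl

theorem derivSymbol_re (i : Fin n) (ξ : Eucl n) : (derivSymbol i ξ).re = 0 := by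
  simp [derivSymbol_apply]

/-- The symbol of the Laplacian. -/
noncomputable def laplaceSymbol (n : ℕ) : C(Eucl n, ℂ) := ∑ i, derivSymbol i * derivSymbol i

theorem laplaceSymbol_im (ξ : Eucl n) : (laplaceSymbol n ξ).im = 0 := by
  simp [laplaceSymbol, ContinuousMap.sum_apply, derivSymbol_re]

end Fourier

/-! ### Weak derivatives and multiplication by the symbol -/

section WeakDerivative

variable {n : ℕ}

theorem partialDeriv_mul (i : Fin n) {φ ψ : Eucl n → ℝ} {x : Eucl n}
    (hφ : DifferentiableAt ℝ φ x) (hψ : DifferentiableAt ℝ ψ x) :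
    partialDeriv i (fun x => φ x * ψ x) x =
      φ x * partialDeriv i ψ x + partialDeriv i φ x * ψ x := by
  unfold partialDeriv
  rw [fderiv_fun_mul hφ hψ]
  simp [mul_comm]

theorem partialDeriv_comp_smul (i : Fin n) (φ : Eucl n → ℝ) (c : ℝ)
    (x : Eucl n) : partialDeriv i (fun x => φ (c • x)) x = c * partialDeriv i φ (c • x) := by
  unfold partialDeriv
  rw [fderiv_comp_smul]
  simp

theorem continuous_partialDeriv (i : Fin n) {φ : Eucl n → ℝ} (hφ : ContDiff ℝ ∞ φ) :
    Continuous (partialDeriv i φ) :=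
  (hφ.continuous_fderiv (by simp)).clm_apply continuous_const

theorem contDiff_partialDeriv (i : Fin n) {φ : Eucl n → ℝ} (hφ : ContDiff ℝ ∞ φ) :
    ContDiff ℝ ∞ (partialDeriv i φ) :=
  (hφ.fderiv_right (m := ∞) (by simp)).clm_apply contDiff_const

theorem hasCompactSupport_partialDeriv (i : Fin n) {φ : Eucl n → ℝ} (hc : HasCompactSupport φ) :
    HasCompactSupport (partialDeriv i φ) :=
  (hc.fderiv ℝ).comp_left (g := fun L : Eucl n →L[ℝ] ℝ => L (EuclideanSpace.single i 1)) (by simp)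

/-- A smooth cutoff function. -/
noncomputable def cutoff (n : ℕ) : ContDiffBump (0 : Eucl n) := ⟨1, 2, one_pos, one_lt_two⟩

theorem exists_bound_partialDeriv (i : Fin n) {φ : Eucl n → ℝ} (hφ : ContDiff ℝ ∞ φ)
    (hc : HasCompactSupport φ) : ∃ C : ℝ, 0 ≤ C ∧ ∀ x, |partialDeriv i φ x| ≤ C := by
  obtain ⟨C, hC⟩ := (hasCompactSupport_partialDeriv i hc).exists_bound_of_continuous (continuous_partialDeriv i hφ)
  exact ⟨C, (norm_nonneg _).trans (hC 0), hC⟩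

/-- The dilated cutoff functions. -/
noncomputable def dilatedCutoff (n k : ℕ) (x : Eucl n) : ℝ := cutoff n (((k : ℝ) + 1)⁻¹ • x)

theorem contDiff_dilatedCutoff (k : ℕ) : ContDiff ℝ ∞ (dilatedCutoff n k) :=
  (cutoff n).contDiff.comp (contDiff_const_smul _)

theorem hasCompactSupport_dilatedCutoff (k : ℕ) : HasCompactSupport (dilatedCutoff n k) :=
  (cutoff n).hasCompactSupport.comp_smul (by positivity)

theorem abs_dilatedCutoff_le (k : ℕ) (x : Eucl n) : |dilatedCutoff n k x| ≤ 1 := by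
  unfold dilatedCutoff
  rw [abs_of_nonneg (cutoff n).nonneg]
  exact (cutoff n).le_one

theorem tendsto_inv_succ : Tendsto (fun k : ℕ => ((k : ℝ) + 1)⁻¹) atTop (𝓝 0) :=
  tendsto_inv_atTop_zero.comp (tendsto_atTop_add_const_right _ _ tendsto_natCast_atTop_atTop)

theorem tendsto_dilatedCutoff (x : Eucl n) :
    Tendsto (fun k : ℕ => dilatedCutoff n k x) atTop (𝓝 1) := by
  have h1 : Tendsto (fun k : ℕ => ((k : ℝ) + 1)⁻¹ • x) atTop (𝓝 0) := by
    simpa using tendsto_inv_succ.smul_const x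
  have h2 := ((cutoff n).continuous.tendsto (0 : Eucl n)).comp h1
  have h3 : cutoff n (0 : Eucl n) = 1 :=
    (cutoff n).one_of_mem_closedBall (Metric.mem_closedBall_self (cutoff n).rIn_pos.le)
  rwa [h3] at h2

theorem exists_bound_partialDeriv_dilatedCutoff (i : Fin n) : ∃ C : ℝ, 0 ≤ C ∧
    ∀ (k : ℕ) (x : Eucl n), |partialDeriv i (dilatedCutoff n k) x| ≤ ((k : ℝ) + 1)⁻¹ * C := by
  obtain ⟨C, hC0, hC⟩ := exists_bound_partialDeriv i (cutoff n).contDiff (cutoff n).hasCompactSupport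
  refine ⟨C, hC0, fun k x => ?_⟩
  have : partialDeriv i (dilatedCutoff n k) x = ((k : ℝ) + 1)⁻¹ *
      partialDeriv i (cutoff n) (((k : ℝ) + 1)⁻¹ • x) :=
    partialDeriv_comp_smul i _ _ x
  rw [this, abs_mul, abs_of_nonneg (by positivity)]
  gcongr
  exact hC _

theorem tendsto_partialDeriv_dilatedCutoff (i : Fin n) (x : Eucl n) :
    Tendsto (fun k : ℕ => partialDeriv i (dilatedCutoff n k) x) atTop (𝓝 0) := by
  obtain ⟨C, -, hC⟩ := exists_bound_partialDeriv_dilatedCutoff i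
  refine squeeze_zero_norm (fun k => hC k x) ?_
  simpa using tendsto_inv_succ.mul_const C

theorem partialDeriv_dilatedCutoff_mul (i : Fin n) (k : ℕ) {φ : Eucl n → ℝ} (hφ : ContDiff ℝ ∞ φ)
    (x : Eucl n) : partialDeriv i (fun x => dilatedCutoff n k x * φ x) x =
      dilatedCutoff n k x * partialDeriv i φ x + partialDeriv i (dilatedCutoff n k) x * φ x :=
  partialDeriv_mul i ((contDiff_dilatedCutoff k).differentiable (by simp) x)
    (hφ.differentiable (by simp) x)

/-- The identity defining weak derivatives extends to all smooth functions `φ` with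
`φ, ∂ᵢφ ∈ L²`. -/
theorem IsWeakPartial.integral_mul_partialDeriv {i : Fin n} {f g : L2 n} (h : IsWeakPartial i f g)
    {φ : Eucl n → ℝ} (hφ : ContDiff ℝ ∞ φ) (h0 : MemLp φ 2 volume)
    (h1 : MemLp (partialDeriv i φ) 2 volume) :
    ∫ x, f x * partialDeriv i φ x = - ∫ x, g x * φ x := by
  obtain ⟨C, hC0, hC⟩ := exists_bound_partialDeriv_dilatedCutoff (n := n) i
  have hfφ : Integrable (fun x => f x * φ x) := (Lp.memLp f).integrable_mul h0
  have hfd : Integrable (fun x => f x * partialDeriv i φ x) := (Lp.memLp f).integrable_mul h1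
  have hgφ : Integrable (fun x => g x * φ x) := (Lp.memLp g).integrable_mul h0
  -- The compactly supported product of φ with the dilated cutoff is an admissible test function;
  -- the Leibniz term with the derivative on the cutoff is O(1/k).
  have hk : ∀ k : ℕ, ∫ x, f x * (dilatedCutoff n k x * partialDeriv i φ x +
      partialDeriv i (dilatedCutoff n k) x * φ x) =
      - ∫ x, g x * (dilatedCutoff n k x * φ x) := by
    intro k
    rw [← h _ ((contDiff_dilatedCutoff k).mul hφ) (hasCompactSupport_dilatedCutoff k).mul_right]
    simp only [partialDeriv_dilatedCutoff_mul i k hφ]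
  have hL : Tendsto (fun k : ℕ => ∫ x, f x * (dilatedCutoff n k x * partialDeriv i φ x +
      partialDeriv i (dilatedCutoff n k) x * φ x)) atTop (𝓝 (∫ x, f x * partialDeriv i φ x)) := by
    refine tendsto_integral_of_dominated_convergence
      (fun x => |f x * partialDeriv i φ x| + C * |f x * φ x|) (fun k => ?_)
      (hfd.abs.add (hfφ.abs.const_mul C)) (fun k => Eventually.of_forall fun x => ?_)
      (Eventually.of_forall fun x => ?_)
    · refine (Lp.aestronglyMeasurable f).mul (Continuous.aestronglyMeasurable ?_)
      have c1 := (contDiff_dilatedCutoff (n := n) k).continuous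
      have c2 := continuous_partialDeriv i (contDiff_dilatedCutoff (n := n) k)
      have c3 := continuous_partialDeriv i hφ
      have c4 := hφ.continuous
      fun_prop
    · rw [mul_add, Real.norm_eq_abs]
      refine (abs_add_le _ _).trans (add_le_add ?_ ?_)
      · rw [mul_left_comm, abs_mul]
        exact mul_le_of_le_one_left (abs_nonneg _) (abs_dilatedCutoff_le k x)
      · rw [mul_left_comm, abs_mul]
        gcongr
        refine (hC k x).trans (mul_le_of_le_one_left hC0 ?_)
        exact inv_le_one_of_one_le₀ (by linarith [Nat.cast_nonneg (α := ℝ) k])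
    · have := ((tendsto_dilatedCutoff x).mul_const (partialDeriv i φ x)).add
        ((tendsto_partialDeriv_dilatedCutoff i x).mul_const (φ x))
      simpa using this.const_mul (f x)
  have hR : Tendsto (fun k : ℕ => - ∫ x, g x * (dilatedCutoff n k x * φ x)) atTop
      (𝓝 (- ∫ x, g x * φ x)) := by
    refine Tendsto.neg (tendsto_integral_of_dominated_convergence
      (fun x => |g x * φ x|) (fun k => ?_) hgφ.abs (fun k => Eventually.of_forall fun x => ?_)
      (Eventually.of_forall fun x => ?_))
    · refine (Lp.aestronglyMeasurable g).mul (Continuous.aestronglyMeasurable ?_)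
      exact (contDiff_dilatedCutoff (n := n) k).continuous.mul hφ.continuous
    · rw [Real.norm_eq_abs, mul_left_comm, abs_mul]
      exact mul_le_of_le_one_left (abs_nonneg _) (abs_dilatedCutoff_le k x)
    · simpa using ((tendsto_dilatedCutoff x).mul_const (φ x)).const_mul (g x)
  simp only [hk] at hL
  exact tendsto_nhds_unique hL hR

open scoped FourierTransform LineDeriv SchwartzMap

theorem contDiff_schwartz_re (φ : 𝓢(Eucl n, ℂ)) : ContDiff ℝ ∞ fun x => (φ x).re :=
  Complex.reCLM.contDiff.comp (φ.smooth ⊤)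

theorem contDiff_schwartz_im (φ : 𝓢(Eucl n, ℂ)) : ContDiff ℝ ∞ fun x => (φ x).im :=
  Complex.imCLM.contDiff.comp (φ.smooth ⊤)

theorem partialDeriv_schwartz_re (i : Fin n) (φ : 𝓢(Eucl n, ℂ)) (x : Eucl n) :
    partialDeriv i (fun x => (φ x).re) x = (∂_{EuclideanSpace.single i (1 : ℝ)} φ x).re := by
  rw [SchwartzMap.lineDerivOp_apply_eq_fderiv, partialDeriv]
  have h := (Complex.reCLM.hasFDerivAt.comp x (φ.hasFDerivAt x)).fderiv
  have h' : fderiv ℝ (fun x => (φ x).re) x = Complex.reCLM ∘L fderiv ℝ (⇑φ) x := h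
  rw [h']
  rfl

theorem partialDeriv_schwartz_im (i : Fin n) (φ : 𝓢(Eucl n, ℂ)) (x : Eucl n) :
    partialDeriv i (fun x => (φ x).im) x = (∂_{EuclideanSpace.single i (1 : ℝ)} φ x).im := by
  rw [SchwartzMap.lineDerivOp_apply_eq_fderiv, partialDeriv]
  have h := (Complex.imCLM.hasFDerivAt.comp x (φ.hasFDerivAt x)).fderiv
  have h' : fderiv ℝ (fun x => (φ x).im) x = Complex.imCLM ∘L fderiv ℝ (⇑φ) x := h
  rw [h']
  rfl

theorem memLp_schwartz_re (φ : 𝓢(Eucl n, ℂ)) : MemLp (fun x => (φ x).re) 2 volume :=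
  (φ.memLp 2).re

theorem memLp_schwartz_im (φ : 𝓢(Eucl n, ℂ)) : MemLp (fun x => (φ x).im) 2 volume :=
  (φ.memLp 2).im

/-- Real and imaginary parts of a Schwartz function are smooth with all derivatives in L², so the
extended weak identity applies to each. -/
theorem IsWeakPartial.integral_schwartz {i : Fin n} {f g : L2 n} (h : IsWeakPartial i f g)
    (φ : 𝓢(Eucl n, ℂ)) :
    ∫ x, ∂_{EuclideanSpace.single i (1 : ℝ)} φ x * (f x : ℂ) = - ∫ x, φ x * (g x : ℂ) := by
  have key : ∀ (F : L2 n) (ψ : 𝓢(Eucl n, ℂ)), ∫ x, ψ x * (F x : ℂ) =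
      ((∫ x, F x * (ψ x).re : ℝ) : ℂ) + ((∫ x, F x * (ψ x).im : ℝ) : ℂ) * Complex.I := by
    intro F ψ
    have e1 : Integrable fun x => ((F x * (ψ x).re : ℝ) : ℂ) :=
      ((Lp.memLp F).integrable_mul (memLp_schwartz_re ψ)).ofReal
    have e2 : Integrable fun x => ((F x * (ψ x).im : ℝ) : ℂ) * Complex.I :=
      (((Lp.memLp F).integrable_mul (memLp_schwartz_im ψ)).ofReal).mul_const _
    rw [← integral_complex_ofReal, ← integral_complex_ofReal, ← integral_mul_const, ← integral_add e1 e2]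
    refine integral_congr_ae (Eventually.of_forall fun x => ?_)
    apply Complex.ext <;> simp [mul_comm]
  rw [key, key]
  have h1 := h.integral_mul_partialDeriv (contDiff_schwartz_re φ) (memLp_schwartz_re φ)
    (by rw [funext (partialDeriv_schwartz_re i φ)]; exact memLp_schwartz_re (∂_{EuclideanSpace.single i (1 : ℝ)} φ))
  have h2 := h.integral_mul_partialDeriv (contDiff_schwartz_im φ) (memLp_schwartz_im φ)
    (by rw [funext (partialDeriv_schwartz_im i φ)]; exact memLp_schwartz_im (∂_{EuclideanSpace.single i (1 : ℝ)} φ))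
  simp only [partialDeriv_schwartz_re] at h1
  simp only [partialDeriv_schwartz_im] at h2
  rw [h1, h2]
  push_cast
  ring

/-- On the Fourier side, weak differentiation is multiplication by the symbol. -/
theorem IsWeakPartial.fourierL_eq {i : Fin n} {f g : L2 n} (h : IsWeakPartial i f g) :
    fourierL n g =ᵐ[volume] fun ξ => derivSymbol i ξ * fourierL n f ξ := by
  set e : Eucl n := EuclideanSpace.single i (1 : ℝ)
  have hdist : ∂_{e} (Lp.toTemperedDistribution (L2.toComplex n f)) =
      Lp.toTemperedDistribution (L2.toComplex n g) := by
    ext φ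
    rw [TemperedDistribution.lineDerivOp_apply_apply, Lp.toTemperedDistribution_apply,
      Lp.toTemperedDistribution_apply]
    have e1 : ∫ x, (-∂_{e} φ) x • (L2.toComplex n f) x = -∫ x, ∂_{e} φ x * (f x : ℂ) := by
      rw [← integral_neg]
      refine integral_congr_ae ?_
      filter_upwards [L2.coeFn_toComplex f] with x hx
      rw [hx]
      simp
    have e2 : ∫ x, φ x • (L2.toComplex n g) x = ∫ x, φ x * (g x : ℂ) := by
      refine integral_congr_ae ?_
      filter_upwards [L2.coeFn_toComplex g] with x hx
      rw [hx]
      simp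
    rw [e1, e2, h.integral_schwartz, neg_neg]
  -- The identity of tempered distributions ∂ᵢf = g becomes, after Fourier transform, multiplication
  -- by the symbol. Testing with smooth compactly supported functions then compares two locally
  -- integrable functions almost everywhere.
  have hF := congrArg (fun T => 𝓕 T) hdist
  simp only [TemperedDistribution.fourier_lineDerivOp_eq,
    Lp.fourier_toTemperedDistribution_eq] at hF
  have hloc : ∀ W : L2C n, LocallyIntegrable W volume := fun W =>
    (Lp.memLp W).locallyIntegrable (by norm_num)
  have hcont : Continuous fun ξ : Eucl n => derivSymbol i ξ := (derivSymbol i).continuous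
  refine ae_eq_of_integral_contDiff_smul_eq (hloc _) ?_ ?_
  · have := (hloc (fourierL n f)).continuous_smul hcont
    exact this
  intro φ hφ hc
  have hΦ : ContDiff ℝ ∞ fun x => (φ x : ℂ) := Complex.ofRealCLM.contDiff.comp hφ
  have hcΦ : HasCompactSupport fun x => (φ x : ℂ) := hc.comp_left (g := fun r : ℝ => (r : ℂ)) rfl
  have := congrArg (fun T => T (hcΦ.toSchwartzMap hΦ)) hF
  simp only [smul_apply, TemperedDistribution.smulLeftCLM_apply_apply,
    Lp.toTemperedDistribution_apply] at this
  have hg : ∫ x, φ x • (fourierL n g) x =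
      ∫ x, (hcΦ.toSchwartzMap hΦ) x • (𝓕 (L2.toComplex n g) : L2C n) x := by
    refine integral_congr_ae (Eventually.of_forall fun x => ?_)
    simp only [HasCompactSupport.toSchwartzMap_toFun]
    exact (Complex.real_smul).trans rfl
  rw [hg, ← this, smul_eq_mul, ← integral_const_mul]
  refine integral_congr_ae (Eventually.of_forall fun x => ?_)
  dsimp only
  rw [SchwartzMap.smulLeftCLM_apply_apply (by fun_prop)]
  simp only [HasCompactSupport.toSchwartzMap_toFun, derivSymbol_apply, smul_eq_mul,
    Complex.real_smul]
  have : (𝓕 (L2.toComplex n f) : L2C n) x = fourierL n f x := rfl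
  rw [this]
  ring

end WeakDerivative

/-! ### H¹ and H² on the Fourier side -/

section SobolevSpaces

variable {n : ℕ}

/-- The inclusion `H¹ ⊆ L²` as a continuous linear map. -/
noncomputable def H1.toL2L (n : ℕ) : H1 n →L[ℝ] L2 n :=
  (ContinuousLinearMap.fst ℝ _ _) ∘L
    (WithLp.prodContinuousLinearEquiv 2 ℝ (L2 n) (PiLp 2 (fun _ : Fin n => L2 n))).toContinuousLinearMap
    ∘L (H1Submodule n).subtypeL

/-- The partial derivative `∂ᵢ : H¹ → L²` as a continuous linear map. -/
noncomputable def H1.partialL (i : Fin n) : H1 n →L[ℝ] L2 n :=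
  (ContinuousLinearMap.proj i) ∘L
    (PiLp.continuousLinearEquiv 2 ℝ (fun _ : Fin n => L2 n)).toContinuousLinearMap ∘L
    (ContinuousLinearMap.snd ℝ _ _) ∘L
    (WithLp.prodContinuousLinearEquiv 2 ℝ (L2 n) (PiLp 2 (fun _ : Fin n => L2 n))).toContinuousLinearMap
    ∘L (H1Submodule n).subtypeL

@[simp] theorem H1.toL2L_apply (f : H1 n) : H1.toL2L n f = f.toL2 := rfl

@[simp] theorem H1.partialL_apply (i : Fin n) (f : H1 n) : H1.partialL i f = f.partial i := rfl

/-- The inclusion `H² ⊆ H¹` as a continuous linear map. -/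
noncomputable def H2.toH1L (n : ℕ) : H2 n →L[ℝ] H1 n :=
  (ContinuousLinearMap.fst ℝ _ _) ∘L
    (WithLp.prodContinuousLinearEquiv 2 ℝ (H1 n) (PiLp 2 (fun _ : Fin n => H1 n))).toContinuousLinearMap
    ∘L (H2Submodule n).subtypeL

/-- The partial derivative `∂ᵢ : H² → H¹`. -/
noncomputable def H2.partialL (i : Fin n) : H2 n →L[ℝ] H1 n :=
  (ContinuousLinearMap.proj i) ∘L
    (PiLp.continuousLinearEquiv 2 ℝ (fun _ : Fin n => H1 n)).toContinuousLinearMap ∘L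
    (ContinuousLinearMap.snd ℝ _ _) ∘L
    (WithLp.prodContinuousLinearEquiv 2 ℝ (H1 n) (PiLp 2 (fun _ : Fin n => H1 n))).toContinuousLinearMap
    ∘L (H2Submodule n).subtypeL

@[simp] theorem H2.toH1L_apply (f : H2 n) : H2.toH1L n f = f.toH1 := rfl

theorem H2.toL2_partialL (i : Fin n) (f : H2 n) : (H2.partialL i f).toL2 = f.toH1.partial i :=
  f.2 i

theorem H2.laplacian_eq (f : H2 n) : f.laplacian = ∑ i, (H2.partialL i f).partial i := rfl

theorem H1.isWeakPartial (f : H1 n) (i : Fin n) : IsWeakPartial i f.toL2 (f.partial i) := f.2 i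

theorem H1.norm_sq_eq (f : H1 n) : ‖f‖ ^ 2 = ‖f.toL2‖ ^ 2 + ∑ i, ‖f.partial i‖ ^ 2 := by
  have h : ‖f‖ ^ 2 = ‖f.1‖ ^ 2 := rfl
  rw [h, WithLp.prod_norm_sq_eq_of_L2, PiLp.norm_sq_eq_of_L2]
  rfl

theorem H1.norm_toL2_le (f : H1 n) : ‖f.toL2‖ ≤ ‖f‖ := by
  refine le_of_sq_le_sq ?_ (norm_nonneg _)
  rw [H1.norm_sq_eq]
  exact le_add_of_nonneg_right (Finset.sum_nonneg fun i _ => sq_nonneg _)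

theorem H1.tendsto_iff {ι : Type*} {l : Filter ι} {F : ι → H1 n} {f : H1 n} :
    Tendsto F l (𝓝 f) ↔ Tendsto (fun k => (F k).toL2) l (𝓝 f.toL2) ∧
      ∀ i, Tendsto (fun k => (F k).partial i) l (𝓝 (f.partial i)) := by
  refine ⟨fun h => ⟨((H1.toL2L n).continuous.tendsto f).comp h,
    fun i => ((H1.partialL i).continuous.tendsto f).comp h⟩, fun ⟨h0, h1⟩ => ?_⟩
  rw [tendsto_iff_norm_sub_tendsto_zero] at h0 ⊢
  replace h1 := fun i => tendsto_iff_norm_sub_tendsto_zero.1 (h1 i)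
  have h2 : Tendsto (fun k => ‖F k - f‖ ^ 2) l (𝓝 0) := by
    have e : ∀ k, ‖F k - f‖ ^ 2 =
        ‖(F k).toL2 - f.toL2‖ ^ 2 + ∑ i, ‖(F k).partial i - f.partial i‖ ^ 2 := fun k =>
      H1.norm_sq_eq (F k - f)
    simp only [e]
    have := (h0.pow 2).add (tendsto_finsetSum (Finset.univ : Finset (Fin n)) fun i _ => (h1 i).pow 2)
    simpa using this
  simpa [Real.sqrt_sq] using h2.sqrt

/-! ### Frequency truncation -/

/-- The Fourier transform truncated to frequencies `|ξ| ≤ k`. -/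
noncomputable def freqProj (n k : ℕ) : L2 n →L[ℝ] L2C n := freqMul 1 k ∘L fourierL n

theorem freqProj_apply (k : ℕ) (f : L2 n) : freqProj n k f = freqMul 1 k (fourierL n f) := rfl

theorem tendsto_freqProj (f : L2 n) : Tendsto (fun k => freqProj n k f) atTop (𝓝 (fourierL n f)) :=
  tendsto_freqMul_one _

theorem eq_of_freqProj_eq {f g : L2 n} (h : ∀ k, freqProj n k f = freqProj n k g) : f = g := by
  refine fourierL_injective (tendsto_nhds_unique (tendsto_freqProj f) ?_)
  simp only [h]
  exact tendsto_freqProj g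

theorem IsWeakPartial.freqMul_one_fourierL {i : Fin n} {f g : L2 n} (h : IsWeakPartial i f g)
    (k : ℕ) : freqMul 1 k (fourierL n g) = freqMul (derivSymbol i) k (fourierL n f) := by
  refine Lp.ext ?_
  filter_upwards [coeFn_freqMul 1 k (fourierL n g), coeFn_freqMul (derivSymbol i) k (fourierL n f),
    h.fourierL_eq] with ξ h1 h2 h3
  rw [h1, h2, h3]
  by_cases hξ : ξ ∈ Metric.closedBall (0 : Eucl n) k
  · simp [hξ]
  · simp [hξ]

theorem H1.freqProj_partial (f : H1 n) (i : Fin n) (k : ℕ) :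
    freqProj n k (f.partial i) = freqMul (derivSymbol i) k (freqProj n k f.toL2) := by
  rw [freqProj_apply, (f.isWeakPartial i).freqMul_one_fourierL, freqProj_apply, freqMul_freqMul,
    mul_one]

/-- On each frequency band the weak gradient is the symbol times the transform of the function, so
it carries no independent information and a pair in H¹ is determined by its first entry. -/
theorem H1.toL2_injective : Function.Injective (H1.toL2 : H1 n → L2 n) := by
  intro f g h
  have hp : ∀ i, f.partial i = g.partial i := fun i =>
    eq_of_freqProj_eq fun k => by rw [H1.freqProj_partial, H1.freqProj_partial, h]
  have h0 : ‖f - g‖ ^ 2 = 0 := by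
    rw [H1.norm_sq_eq]
    have e1 : (f - g).toL2 = f.toL2 - g.toL2 := rfl
    have e2 : ∀ i, (f - g).partial i = f.partial i - g.partial i := fun i => rfl
    simp [e1, e2, h, hp]
  rwa [sq_eq_zero_iff, norm_eq_zero, sub_eq_zero] at h0

/-- Integration by parts without boundary terms: the symbol is purely imaginary, and Plancherel does
the rest. -/
theorem H1.inner_partial (f g : H1 n) (i : Fin n) :
    inner ℝ (f.partial i) g.toL2 = - inner ℝ f.toL2 (g.partial i) := by
  rw [← inner_fourierL, ← inner_fourierL, L2.inner_def, L2.inner_def, ← integral_neg]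
  refine integral_congr_ae ?_
  filter_upwards [(f.isWeakPartial i).fourierL_eq, (g.isWeakPartial i).fourierL_eq] with ξ h1 h2
  rw [h1, h2]
  simp only [Complex.inner, Complex.mul_re, Complex.mul_im, derivSymbol_re, map_mul,
    Complex.conj_re, Complex.conj_im]
  ring

theorem H2.inner_laplacian (f : H2 n) (g : H1 n) :
    inner ℝ f.laplacian g.toL2 = - ∑ i, inner ℝ (f.toH1.partial i) (g.partial i) := by
  rw [H2.laplacian_eq, sum_inner, ← Finset.sum_neg_distrib]
  refine Finset.sum_congr rfl fun i _ => ?_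
  rw [H1.inner_partial, H2.toL2_partialL]

theorem H2.freqProj_laplacian (f : H2 n) (k : ℕ) :
    freqProj n k f.laplacian = freqMul (laplaceSymbol n) k (freqProj n k f.toH1.toL2) := by
  rw [H2.laplacian_eq, map_sum, laplaceSymbol, freqMul_sum]
  refine Finset.sum_congr rfl fun i _ => ?_
  rw [H1.freqProj_partial, H2.toL2_partialL, H1.freqProj_partial, freqMul_freqMul]

theorem isWeakPartial_toLp {φ : Eucl n → ℝ} (hφ : ContDiff ℝ ∞ φ) (hc : HasCompactSupport φ)
    (i : Fin n) : IsWeakPartial i ((memLp_testFunction hφ hc).toLp φ)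
      ((memLp_partialDeriv i hφ hc).toLp _) := by
  intro ψ hψ hcψ
  have e1 : ∫ x, ((memLp_testFunction hφ hc).toLp φ) x * partialDeriv i ψ x =
      ∫ x, φ x * partialDeriv i ψ x := by
    refine integral_congr_ae ?_
    filter_upwards [(memLp_testFunction hφ hc).coeFn_toLp] with x hx
    rw [hx]
  have e2 : ∫ x, ((memLp_partialDeriv i hφ hc).toLp _) x * ψ x =
      ∫ x, partialDeriv i φ x * ψ x := by
    refine integral_congr_ae ?_
    filter_upwards [(memLp_partialDeriv i hφ hc).coeFn_toLp] with x hx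
    rw [hx]
  rw [e1, e2]
  unfold partialDeriv
  refine integral_mul_fderiv_eq_neg_fderiv_mul_of_integrable ?_ ?_ ?_
    (fun x _ => hφ.differentiable (by simp) x) (fun x _ => hψ.differentiable (by simp) x)
  · exact ((continuous_partialDeriv i hφ).mul hψ.continuous).integrable_of_hasCompactSupport
      hcψ.mul_left
  · exact (hφ.continuous.mul (continuous_partialDeriv i hψ)).integrable_of_hasCompactSupport
      hc.mul_right
  · exact (hφ.continuous.mul hψ.continuous).integrable_of_hasCompactSupport hc.mul_right

/-- Test functions form such pairs in L², so testing against weak derivatives in L² is enough. In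
this form the criterion can be checked after a Fourier transform. -/
theorem isWeakPartial_of_forall_toLp {i : Fin n} {f g : L2 n}
    (h : ∀ (φ ψ : L2 n), IsWeakPartial i φ ψ → inner ℝ f ψ = - inner ℝ g φ) :
    IsWeakPartial i f g := by
  rw [isWeakPartial_iff]
  intro φ hφ hc
  have := h _ _ (isWeakPartial_toLp hφ hc i)
  rw [real_inner_comm, this, real_inner_comm, neg_add_cancel]

/-- By duality: the projected inverse transform is adjoint to the transform, and multiplication by
the symbol of ∂ᵢ is skew. -/
theorem isWeakPartial_fourierInvL (i : Fin n) (k : ℕ) (Y : L2C n) :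
    IsWeakPartial i (fourierInvL n (freqMul 1 k Y)) (fourierInvL n (freqMul (derivSymbol i) k Y)) := by
  refine isWeakPartial_of_forall_toLp fun φ ψ h => ?_
  rw [inner_fourierInvL, inner_fourierInvL, inner_freqMul_of_skew (derivSymbol_re i), neg_neg,
    inner_freqMul_of_real (by simp), h.freqMul_one_fourierL]

/-- The element of `H¹` with Fourier transform `1_{|ξ| ≤ k} Y` (up to taking real parts). -/
noncomputable def H1.ofFreq (n k : ℕ) : L2C n →L[ℝ] H1 n :=
  ContinuousLinearMap.codRestrict
    ((WithLp.prodContinuousLinearEquiv 2 ℝ (L2 n) (PiLp 2 (fun _ : Fin n => L2 n))).symm.toContinuousLinearMap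
      ∘L ((fourierInvL n ∘L freqMul 1 k).prod
        ((PiLp.continuousLinearEquiv 2 ℝ (fun _ : Fin n => L2 n)).symm.toContinuousLinearMap ∘L
          ContinuousLinearMap.pi fun i => fourierInvL n ∘L freqMul (derivSymbol i) k)))
    (H1Submodule n) fun Y i => isWeakPartial_fourierInvL i k Y

theorem H1.toL2_ofFreq (k : ℕ) (Y : L2C n) :
    (H1.ofFreq n k Y).toL2 = fourierInvL n (freqMul 1 k Y) := rfl

theorem H1.partial_ofFreq (k : ℕ) (Y : L2C n) (i : Fin n) :
    (H1.ofFreq n k Y).partial i = fourierInvL n (freqMul (derivSymbol i) k Y) := rfl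

/-- The element of `H²` with Fourier transform `1_{|ξ| ≤ k} Y` (up to taking real parts). -/
noncomputable def H2.ofFreq (n k : ℕ) : L2C n →L[ℝ] H2 n :=
  ContinuousLinearMap.codRestrict
    ((WithLp.prodContinuousLinearEquiv 2 ℝ (H1 n) (PiLp 2 (fun _ : Fin n => H1 n))).symm.toContinuousLinearMap
      ∘L ((H1.ofFreq n k).prod
        ((PiLp.continuousLinearEquiv 2 ℝ (fun _ : Fin n => H1 n)).symm.toContinuousLinearMap ∘L
          ContinuousLinearMap.pi fun i => H1.ofFreq n k ∘L freqMul (derivSymbol i) k)))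
    (H2Submodule n) fun Y i => by
      show fourierInvL n (freqMul 1 k (freqMul (derivSymbol i) k Y)) =
        fourierInvL n (freqMul (derivSymbol i) k Y)
      rw [freqMul_freqMul, one_mul]

theorem H2.toH1_ofFreq (k : ℕ) (Y : L2C n) : (H2.ofFreq n k Y).toH1 = H1.ofFreq n k Y := rfl

theorem H2.laplacian_ofFreq (k : ℕ) (Y : L2C n) :
    (H2.ofFreq n k Y).laplacian = fourierInvL n (freqMul (laplaceSymbol n) k Y) := by
  rw [laplaceSymbol, freqMul_sum, map_sum]
  refine Finset.sum_congr rfl fun i _ => ?_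
  show fourierInvL n (freqMul (derivSymbol i) k (freqMul (derivSymbol i) k Y)) = _
  rw [freqMul_freqMul]

theorem freqMul_freqProj (q : C(Eucl n, ℂ)) (k : ℕ) (f : L2 n) :
    freqMul q k (freqProj n k f) = freqMul q k (fourierL n f) := by
  rw [freqProj_apply, freqMul_freqMul, mul_one]

theorem tendsto_fourierInvL_freqProj (f : L2 n) :
    Tendsto (fun k => fourierInvL n (freqProj n k f)) atTop (𝓝 f) := by
  have := ((fourierInvL n).continuous.tendsto _).comp (tendsto_freqProj f)
  rwa [fourierInvL_fourierL] at this

theorem H1.tendsto_ofFreq (f : H1 n) :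
    Tendsto (fun k => H1.ofFreq n k (freqProj n k f.toL2)) atTop (𝓝 f) := by
  rw [H1.tendsto_iff]
  constructor
  · simp only [H1.toL2_ofFreq, freqMul_freqProj]
    exact tendsto_fourierInvL_freqProj f.toL2
  · intro i
    simp only [H1.partial_ofFreq, freqMul_freqProj, ← (f.isWeakPartial i).freqMul_one_fourierL]
    exact tendsto_fourierInvL_freqProj (f.partial i)

theorem L2.norm_toComplex (f : L2 n) : ‖L2.toComplex n f‖ = ‖f‖ := by
  have h : inner ℝ (L2.toComplex n f) (L2.toComplex n f) = inner ℝ f f := by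
    rw [← L2C.inner_re, L2C.re_toComplex]
  rw [real_inner_self_eq_norm_sq, real_inner_self_eq_norm_sq] at h
  exact (pow_left_inj₀ (norm_nonneg _) (norm_nonneg _) two_ne_zero).1 h

theorem norm_fourierL (f : L2 n) : ‖fourierL n f‖ = ‖f‖ := by
  rw [← L2.norm_toComplex f]
  exact (L2C.fourier n).norm_map _

theorem norm_freqMul_one_le (k : ℕ) (Y : L2C n) : ‖freqMul 1 k Y‖ ≤ ‖Y‖ := by
  refine Lp.norm_le_norm_of_ae_le ?_
  filter_upwards [coeFn_freqMul 1 k Y] with ξ h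
  rw [h]
  by_cases hξ : ξ ∈ Metric.closedBall (0 : Eucl n) k
  · simp [hξ]
  · simp [hξ]

theorem norm_freqProj_le (k : ℕ) (f : L2 n) : ‖freqProj n k f‖ ≤ ‖f‖ :=
  (norm_freqMul_one_le k _).trans (norm_fourierL f).le

theorem norm_fourierInvL_le (Y : L2C n) : ‖fourierInvL n Y‖ ≤ ‖Y‖ := by
  have h : ‖fourierInvL n Y‖ ^ 2 ≤ ‖Y‖ * ‖fourierInvL n Y‖ := by
    rw [← real_inner_self_eq_norm_sq, inner_fourierInvL]
    refine (real_inner_le_norm _ _).trans ?_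
    rw [norm_fourierL]
  by_contra! hlt
  nlinarith [norm_nonneg Y]

end SobolevSpaces

/-! ### Energy estimate and the frequency-truncated evolution -/

section Evolution

variable {n : ℕ}

/-- The damping coefficient `(1+t)^{-β}`, extended by its value at `0` to negative times. -/
noncomputable def damping (β t : ℝ) : ℝ := (1 + max t 0) ^ (-β)

theorem damping_of_nonneg {β t : ℝ} (ht : 0 ≤ t) : damping β t = (1 + t) ^ (-β) := by
  rw [damping, max_eq_left ht]

theorem damping_nonneg (β t : ℝ) : 0 ≤ damping β t := by unfold damping; positivity

theorem continuous_damping (β : ℝ) : Continuous (damping β) := by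
  unfold damping
  refine Continuous.rpow_const (by fun_prop) fun t => Or.inl ?_
  positivity

/-- `u` with `u_t = v` is an `H²`-valued solution on `S` of
`u_tt - Δu - (1+t)^{-β} Δu_t = h`, the time derivatives being taken in `L²`. -/
structure IsRegularSolution (β : ℝ) (S : Set ℝ) (h : ℝ → L2 n) (u v : ℝ → H2 n) : Prop where
  deriv_u : ∀ t ∈ S, HasDerivWithinAt (fun τ => (u τ).toH1.toL2) (v t).toH1.toL2 S t
  deriv_partial : ∀ i, ∀ t ∈ S,
    HasDerivWithinAt (fun τ => (u τ).toH1.partial i) ((v t).toH1.partial i) S t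
  deriv_v : ∀ t ∈ S, HasDerivWithinAt (fun τ => (v τ).toH1.toL2)
    ((u t).laplacian + damping β t • (v t).laplacian + h t) S t

theorem H2.laplacian_sub (f g : H2 n) : (f - g).laplacian = f.laplacian - g.laplacian := by
  simp only [H2.laplacian]
  rw [← Finset.sum_sub_distrib]
  rfl

theorem IsRegularSolution.mono {β : ℝ} {S S' : Set ℝ} {h : ℝ → L2 n} {u v : ℝ → H2 n}
    (H : IsRegularSolution β S h u v) (hS : S' ⊆ S) : IsRegularSolution β S' h u v :=
  ⟨fun t ht => (H.deriv_u t (hS ht)).mono hS, fun i t ht => (H.deriv_partial i t (hS ht)).mono hS,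
    fun t ht => (H.deriv_v t (hS ht)).mono hS⟩

theorem IsRegularSolution.sub {β : ℝ} {S : Set ℝ} {h h' : ℝ → L2 n} {u v u' v' : ℝ → H2 n}
    (H : IsRegularSolution β S h u v) (H' : IsRegularSolution β S h' u' v') :
    IsRegularSolution β S (fun t => h t - h' t) (fun t => u t - u' t) (fun t => v t - v' t) := by
  refine ⟨fun t ht => (H.deriv_u t ht).sub (H'.deriv_u t ht),
    fun i t ht => (H.deriv_partial i t ht).sub (H'.deriv_partial i t ht), fun t ht => ?_⟩
  refine ((H.deriv_v t ht).sub (H'.deriv_v t ht)).congr_deriv ?_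
  simp only [H2.laplacian_sub, smul_sub]
  abel

theorem IsStrongSolution.exists_isRegularSolution {β s : ℝ} (hs : 0 ≤ s) {f g : H2 n} {u : ℝ → H2 n}
    (H : IsStrongSolution β s f g u) :
    ∃ v, IsRegularSolution β (Ici s) 0 u v ∧ u s = f ∧ v s = g := by
  obtain ⟨v, w, h1, h2, h3, -, h5, h6, h7⟩ := H
  refine ⟨v, ⟨fun t ht => ?_, fun i t ht => ?_, fun t ht => ?_⟩, h5, h6⟩
  · exact (H1.toL2L n ∘L H2.toH1L n).hasFDerivAt.comp_hasDerivWithinAt t (h1 t ht)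
  · exact (H1.partialL i ∘L H2.toH1L n).hasFDerivAt.comp_hasDerivWithinAt t (h1 t ht)
  · have := h7 t ht
    rw [sub_sub, sub_eq_zero] at this
    rw [damping_of_nonneg (hs.trans ht), Pi.zero_apply, add_zero, ← this]
    exact h3 t ht

/-- The energy estimate for regular solutions. -/
theorem IsRegularSolution.energy_le {β a b : ℝ} {h : ℝ → L2 n} {u v : ℝ → H2 n}
    (H : IsRegularSolution β (Icc a b) h u v) (hh : ContinuousOn h (Icc a b)) :
    ∀ t ∈ Icc a b, ‖(u t).toH1‖ ^ 2 + ‖(v t).toH1.toL2‖ ^ 2 ≤ Real.exp (2 * (t - a)) *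
      (‖(u a).toH1‖ ^ 2 + ‖(v a).toH1.toL2‖ ^ 2 + ∫ s in a..t, ‖h s‖ ^ 2) := by
  intro t ht
  have hab : a ≤ b := ht.1.trans ht.2
  set E : ℝ → ℝ := fun t => ‖(u t).toH1‖ ^ 2 + ‖(v t).toH1.toL2‖ ^ 2 with hE
  set E' : ℝ → ℝ := fun t => 2 * inner ℝ (u t).toH1.toL2 (v t).toH1.toL2
    + ∑ i, 2 * inner ℝ ((u t).toH1.partial i) ((v t).toH1.partial i)
    + 2 * inner ℝ (v t).toH1.toL2 ((u t).laplacian + damping β t • (v t).laplacian + h t) with hE'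
  have hEd : ∀ t ∈ Icc a b, HasDerivWithinAt E (E' t) (Icc a b) t := by
    intro t ht
    have e : E = fun t => ‖(u t).toH1.toL2‖ ^ 2 + ∑ i, ‖(u t).toH1.partial i‖ ^ 2
        + ‖(v t).toH1.toL2‖ ^ 2 := by
      funext t; rw [hE]; simp only [H1.norm_sq_eq]
    rw [e]
    exact ((H.deriv_u t ht).norm_sq.add
      (HasDerivWithinAt.fun_sum fun i _ => (H.deriv_partial i t ht).norm_sq)).add
      (H.deriv_v t ht).norm_sq
  -- Integration by parts makes the Δu term cancel the pairing of gradients and turns the damping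
  -- term into a multiple of -‖∇v‖², which is dropped. The two remaining products are bounded by 2ab
  -- ≤ a² + b².
  have hE'le : ∀ t, E' t ≤ 2 * E t + ‖h t‖ ^ 2 := by
    intro t
    have e1 : inner ℝ (v t).toH1.toL2 (u t).laplacian =
        - ∑ i, inner ℝ ((u t).toH1.partial i) ((v t).toH1.partial i) := by
      rw [real_inner_comm, H2.inner_laplacian]
    have e2 : inner ℝ (v t).toH1.toL2 (v t).laplacian =
        - ∑ i, ‖(v t).toH1.partial i‖ ^ 2 := by
      rw [real_inner_comm, H2.inner_laplacian]
      simp only [real_inner_self_eq_norm_sq]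
    have e3 : 0 ≤ damping β t * ∑ i, ‖(v t).toH1.partial i‖ ^ 2 :=
      mul_nonneg (damping_nonneg _ _) (Finset.sum_nonneg fun i _ => sq_nonneg _)
    have e4 := (real_inner_le_norm (u t).toH1.toL2 (v t).toH1.toL2)
    have e5 := (real_inner_le_norm (v t).toH1.toL2 (h t))
    have e6 := sq_nonneg (‖(u t).toH1.toL2‖ - ‖(v t).toH1.toL2‖)
    have e7 := sq_nonneg (‖(v t).toH1.toL2‖ - ‖h t‖)
    have e8 : ‖(u t).toH1.toL2‖ ^ 2 ≤ ‖(u t).toH1‖ ^ 2 :=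
      pow_le_pow_left₀ (norm_nonneg _) (H1.norm_toL2_le _) 2
    have e9 := sq_nonneg ‖(u t).toH1‖
    simp only [hE, hE', inner_add_right, inner_smul_right, e1, e2, ← Finset.mul_sum]
    nlinarith
  set P : ℝ → ℝ := fun t => ∫ s in a..t, ‖h s‖ ^ 2 with hP
  have hhc : ContinuousOn (fun s => ‖h s‖ ^ 2) (Icc a b) := (hh.norm).pow 2
  have hPd : ∀ t ∈ Icc a b, HasDerivWithinAt P (‖h t‖ ^ 2) (Icc a b) t :=
    hasDerivWithinAt_of_eq_integral (c := 0) hhc fun t _ => by rw [zero_add]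
  -- Grönwall with an integrating factor; since the factor is at most 1 for t ≥ a, the forcing
  -- integral can be kept without weight.
  set G : ℝ → ℝ := fun t => Real.exp (-(2 * (t - a))) * E t - P t with hG
  have hGd : ∀ t ∈ Icc a b, HasDerivWithinAt G
      (Real.exp (-(2 * (t - a))) * (-2) * E t + Real.exp (-(2 * (t - a))) * E' t - ‖h t‖ ^ 2)
      (Icc a b) t := by
    intro t ht
    have d : HasDerivAt (fun t : ℝ => Real.exp (-(2 * (t - a)))) (Real.exp (-(2 * (t - a))) * (-2)) t := by
      have : HasDerivAt (fun t : ℝ => -(2 * (t - a))) (-2) t := by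
        refine (((hasDerivAt_id t).sub_const a).const_mul 2).neg.congr_deriv ?_
        rw [mul_one]
      exact this.exp
    exact (d.hasDerivWithinAt.mul (hEd t ht)).sub (hPd t ht)
  have hanti : AntitoneOn G (Icc a b) := by
    refine antitoneOn_of_hasDerivWithinAt_nonpos (convex_Icc a b)
      (fun t ht => (hGd t ht).continuousWithinAt)
      (fun t ht => (hGd t (interior_subset ht)).mono interior_subset) fun t ht => ?_
    have hta : a ≤ t := (interior_subset ht).1
    have h1 : Real.exp (-(2 * (t - a))) ≤ 1 := Real.exp_le_one_iff.2 (by linarith)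
    have h2 := Real.exp_pos (-(2 * (t - a)))
    have h3 := hE'le t
    have h4 : Real.exp (-(2 * (t - a))) * (E' t - 2 * E t) ≤ 1 * ‖h t‖ ^ 2 := by
      refine (mul_le_mul_of_nonneg_left (by linarith : E' t - 2 * E t ≤ ‖h t‖ ^ 2) h2.le).trans ?_
      exact mul_le_mul_of_nonneg_right h1 (sq_nonneg _)
    linarith
  have hfin := hanti (left_mem_Icc.2 hab) ht ht.1
  simp only [hG, hP, sub_self, mul_zero, neg_zero, Real.exp_zero, one_mul,
    intervalIntegral.integral_same, sub_zero] at hfin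
  rw [sub_le_iff_le_add] at hfin
  have : E t = Real.exp (2 * (t - a)) * (Real.exp (-(2 * (t - a))) * E t) := by
    rw [← mul_assoc, ← Real.exp_add, add_neg_cancel, Real.exp_zero, one_mul]
  show E t ≤ _
  rw [this]
  exact mul_le_mul_of_nonneg_left hfin (Real.exp_pos _).le

/-- The generator of the frequency-truncated evolution, written as a first order system. -/
noncomputable def freqGen (n : ℕ) (β : ℝ) (k : ℕ) (t : ℝ) :
    (L2C n × L2C n) →L[ℝ] (L2C n × L2C n) :=
  (ContinuousLinearMap.snd ℝ _ _).prod (freqMul (laplaceSymbol n) k ∘L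
    (ContinuousLinearMap.fst ℝ (L2C n) (L2C n) + damping β t • ContinuousLinearMap.snd ℝ _ _))

theorem freqGen_apply (β : ℝ) (k : ℕ) (t : ℝ) (x : L2C n × L2C n) : freqGen n β k t x =
    (x.2, freqMul (laplaceSymbol n) k (x.1 + damping β t • x.2)) := rfl

theorem continuous_freqGen (β : ℝ) (k : ℕ) : Continuous (freqGen n β k) := by
  have h1 : freqGen n β k = fun t =>
      (ContinuousLinearMap.inl ℝ _ _ ∘L ContinuousLinearMap.snd ℝ (L2C n) (L2C n)
        + ContinuousLinearMap.inr ℝ _ _ ∘L freqMul (laplaceSymbol n) k ∘L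
          ContinuousLinearMap.fst ℝ (L2C n) (L2C n))
        + damping β t • (ContinuousLinearMap.inr ℝ _ _ ∘L freqMul (laplaceSymbol n) k ∘L
          ContinuousLinearMap.snd ℝ (L2C n) (L2C n)) := by
    funext t
    refine ContinuousLinearMap.ext fun x => ?_
    rw [freqGen_apply]
    ext1 <;> simp
  rw [h1]
  exact continuous_const.add ((continuous_damping β).smul continuous_const)

/-- Differentiability through truncated synthesis of frequencies. -/
theorem IsRegularSolution.of_freq {β : ℝ} {k : ℕ} {S : Set ℝ} {h : ℝ → L2 n} {y z : ℝ → L2C n}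
    (hy : ∀ t ∈ S, HasDerivWithinAt y (z t) S t)
    (hz : ∀ t ∈ S, HasDerivWithinAt z
      (freqMul (laplaceSymbol n) k (y t + damping β t • z t) + freqProj n k (h t)) S t) :
    IsRegularSolution β S (fun t => fourierInvL n (freqProj n k (h t)))
      (fun t => H2.ofFreq n k (y t)) (fun t => H2.ofFreq n k (z t)) := by
  refine ⟨fun t ht => ?_, fun i t ht => ?_, fun t ht => ?_⟩
  · exact (fourierInvL n ∘L freqMul 1 k).hasFDerivAt.comp_hasDerivWithinAt t (hy t ht)
  · exact (fourierInvL n ∘L freqMul (derivSymbol i) k).hasFDerivAt.comp_hasDerivWithinAt t (hy t ht)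
  · refine ((fourierInvL n ∘L freqMul 1 k).hasFDerivAt.comp_hasDerivWithinAt t
      (hz t ht)).congr_deriv ?_
    simp only [H2.laplacian_ofFreq, ContinuousLinearMap.comp_apply, map_add, map_smul,
      freqMul_freqMul, freqProj_apply, one_mul]

/-- Solvability of the frequency-truncated equation. -/
theorem exists_freq_solution (β : ℝ) (k : ℕ) {h : ℝ → L2 n} (hh : Continuous h) (a : ℝ)
    (y₀ z₀ : L2C n) : ∃ y z : ℝ → L2C n, y a = y₀ ∧ z a = z₀ ∧ (∀ t, HasDerivAt y (z t) t) ∧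
      ∀ t, HasDerivAt z
        (freqMul (laplaceSymbol n) k (y t + damping β t • z t) + freqProj n k (h t)) t := by
  obtain ⟨x, hx0, hx⟩ := exists_hasDerivAt_affine (continuous_freqGen (n := n) β k)
    (H := fun t => ((0 : L2C n), freqProj n k (h t)))
    (continuous_const.prodMk ((freqProj n k).continuous.comp hh)) a (y₀, z₀)
  refine ⟨fun t => (x t).1, fun t => (x t).2, by simp only [hx0], by simp only [hx0],
    fun t => ?_, fun t => ?_⟩
  · exact ((ContinuousLinearMap.fst ℝ (L2C n) (L2C n)).hasFDerivAt.comp_hasDerivAt t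
      (hx t)).congr_deriv (by simp [freqGen_apply])
  · exact (ContinuousLinearMap.snd ℝ (L2C n) (L2C n)).hasFDerivAt.comp_hasDerivAt t (hx t)

/-- Frequency-truncated solutions are strong solutions. -/
theorem isStrongSolution_ofFreq {β : ℝ} {k : ℕ} {s : ℝ} (hs : 0 ≤ s) {y z : ℝ → L2C n}
    (hy : ∀ t, HasDerivAt y (z t) t)
    (hz : ∀ t, HasDerivAt z
      (freqMul (laplaceSymbol n) k (y t + damping β t • z t)) t) :
    IsStrongSolution β s (H2.ofFreq n k (y s)) (H2.ofFreq n k (z s))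
      (fun t => H2.ofFreq n k (y t)) := by
  have cy : Continuous y := continuous_iff_continuousAt.2 fun t => (hy t).continuousAt
  have cz : Continuous z := continuous_iff_continuousAt.2 fun t => (hz t).continuousAt
  refine ⟨fun t => H2.ofFreq n k (z t), fun t => fourierInvL n (freqMul 1 k
    (freqMul (laplaceSymbol n) k (y t + damping β t • z t))), fun t _ => ?_, ?_, fun t _ => ?_, ?_,
    rfl, rfl, fun t ht => ?_⟩
  · exact ((H2.ofFreq n k).hasFDerivAt.comp_hasDerivAt t (hy t)).hasDerivWithinAt
  · exact ((H2.ofFreq n k).continuous.comp cz).continuousOn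
  · exact ((fourierInvL n ∘L freqMul 1 k).hasFDerivAt.comp_hasDerivAt t (hz t)).hasDerivWithinAt
  · have cd := continuous_damping β
    exact Continuous.continuousOn (by fun_prop)
  · dsimp only
    rw [← damping_of_nonneg (hs.trans ht), H2.laplacian_ofFreq, H2.laplacian_ofFreq,
      freqMul_freqMul, one_mul, map_add, map_add, map_smul, map_smul]
    abel

end Evolution

/-! ### Limits of sequences of differentiable functions -/

section UniformLimits

variable {X : Type*} [NormedAddCommGroup X]

/-- The hypothesis is the shape in which energy estimates for differences of approximate solutions
arrive; it makes the sequence uniformly Cauchy. -/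
theorem exists_tendstoUniformlyOn_of_norm_sub_sq_le {ι : Type*} [CompleteSpace X] {F : ℕ → ι → X}
    {S : Set ι} {δ : ℕ → ℝ} (hδ : Tendsto δ atTop (𝓝 0))
    (h : ∀ k j, ∀ t ∈ S, ‖F k t - F j t‖ ^ 2 ≤ δ k + δ j) :
    ∃ f : ι → X, TendstoUniformlyOn F f atTop S := by
  have hU : UniformCauchySeqOn F atTop S := by
    rw [Metric.uniformCauchySeqOn_iff]
    intro ε hε
    obtain ⟨N, hN⟩ := eventually_atTop.1 (hδ.eventually (gt_mem_nhds (by positivity : 0 < ε ^ 2 / 2)))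
    refine ⟨N, fun k hk j hj t ht => ?_⟩
    rw [dist_eq_norm]
    refine lt_of_pow_lt_pow_left₀ 2 hε.le ((h k j t ht).trans_lt ?_)
    linarith [hN k hk, hN j hj]
  have hlim : ∀ t, ∃ x, t ∈ S → Tendsto (fun k => F k t) atTop (𝓝 x) := by
    intro t
    by_cases ht : t ∈ S
    · obtain ⟨x, hx⟩ := cauchySeq_tendsto_of_complete (hU.cauchySeq ht)
      exact ⟨x, fun _ => hx⟩
    · exact ⟨0, fun h => absurd h ht⟩
  choose f hf using hlim
  exact ⟨f, hU.tendstoUniformlyOn_of_tendsto fun t ht => hf t ht⟩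

/-- The limit is taken in the integrated identity F_k(t) - F_k(a) = ∫F_k', by dominated convergence.
Pointwise convergence of the derivatives with a common bound therefore suffices, provided the
limiting derivative is continuous. -/
theorem hasDerivWithinAt_of_tendsto [NormedSpace ℝ X] [CompleteSpace X] {F F' : ℕ → ℝ → X} {f f' : ℝ → X} {a b C : ℝ}
    (hF : ∀ k, ∀ t ∈ Icc a b, HasDerivWithinAt (F k) (F' k t) (Icc a b) t)
    (hF' : ∀ k, ContinuousOn (F' k) (Icc a b)) (hf' : ContinuousOn f' (Icc a b))
    (hlim : ∀ t ∈ Icc a b, Tendsto (fun k => F k t) atTop (𝓝 (f t)))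
    (hlim' : ∀ t ∈ Icc a b, Tendsto (fun k => F' k t) atTop (𝓝 (f' t)))
    (hC : ∀ k, ∀ t ∈ Icc a b, ‖F' k t‖ ≤ C) :
    ∀ t ∈ Icc a b, HasDerivWithinAt f (f' t) (Icc a b) t := by
  refine hasDerivWithinAt_of_eq_integral (c := f a) hf' fun t ht => ?_
  have hab : a ≤ b := ht.1.trans ht.2
  have hsub : Icc a t ⊆ Icc a b := Icc_subset_Icc_right ht.2
  have h1 : ∀ k, ∫ s in a..t, F' k s = F k t - F k a := fun k =>
    integral_eq_sub_of_hasDerivWithinAt_Icc ht.1 (fun s hs => (hF k s (hsub hs)).mono hsub)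
      (((hF' k).mono hsub).intervalIntegrable_of_Icc ht.1)
  have h2 : Tendsto (fun k => ∫ s in a..t, F' k s) atTop (𝓝 (∫ s in a..t, f' s)) := by
    refine intervalIntegral.tendsto_integral_filter_of_dominated_convergence (fun _ => C)
      (Eventually.of_forall fun k => ?_) (Eventually.of_forall fun k => ?_)
      intervalIntegrable_const (Eventually.of_forall fun s hs => ?_)
    · rw [uIoc_of_le ht.1]
      exact (((hF' k).mono hsub).mono Ioc_subset_Icc_self).aestronglyMeasurable measurableSet_Ioc
    · refine Eventually.of_forall fun s hs => ?_
      rw [uIoc_of_le ht.1] at hs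
      exact hC k s (hsub (Ioc_subset_Icc_self hs))
    · rw [uIoc_of_le ht.1] at hs
      exact hlim' s (hsub (Ioc_subset_Icc_self hs))
  have h3 : Tendsto (fun k => ∫ s in a..t, F' k s) atTop (𝓝 (f t - f a)) := by
    simp only [h1]
    exact (hlim t ht).sub (hlim a (left_mem_Icc.2 hab))
  rw [tendsto_nhds_unique h2 h3, add_sub_cancel]

end UniformLimits

/-! ### The linear propagator R(t,s) -/

section Propagator

variable {n : ℕ}

/-- The backward propagator of the frequency-truncated evolution. -/
noncomputable def freqProp (n : ℕ) (β : ℝ) (k : ℕ) (t : ℝ) :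
    ℝ → (L2C n × L2C n) →L[ℝ] (L2C n × L2C n) :=
  Classical.choose (exists_backward_propagator (continuous_freqGen (n := n) β k) t)

theorem freqProp_self (β : ℝ) (k : ℕ) (t : ℝ) : freqProp n β k t t = 1 :=
  (Classical.choose_spec (exists_backward_propagator (continuous_freqGen (n := n) β k) t)).1

theorem hasDerivAt_freqProp (β : ℝ) (k : ℕ) (t s : ℝ) :
    HasDerivAt (freqProp n β k t) (-(freqProp n β k t s ∘L freqGen n β k s)) s :=
  (Classical.choose_spec (exists_backward_propagator (continuous_freqGen (n := n) β k) t)).2 s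

theorem continuous_freqProp (β : ℝ) (k : ℕ) (t : ℝ) : Continuous (freqProp n β k t) :=
  continuous_iff_continuousAt.2 fun s => (hasDerivAt_freqProp β k t s).continuousAt

/-- Duhamel's formula for the frequency-truncated evolution. -/
theorem freq_duhamel {β : ℝ} {k : ℕ} {s t : ℝ} (hst : s ≤ t) {y z : ℝ → L2C n} {h : ℝ → L2C n}
    (hh : ContinuousOn h (Icc s t))
    (hy : ∀ τ ∈ Icc s t, HasDerivWithinAt y (z τ) (Icc s t) τ)
    (hz : ∀ τ ∈ Icc s t, HasDerivWithinAt z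
      (freqMul (laplaceSymbol n) k (y τ + damping β τ • z τ) + h τ) (Icc s t) τ) :
    y t = (freqProp n β k t s (y s, z s)).1 + ∫ τ in s..t, (freqProp n β k t τ (0, h τ)).1 := by
  have hH : ContinuousOn (fun τ => ((0 : L2C n), h τ)) (Icc s t) := continuousOn_const.prodMk hh
  have key := eq_add_integral_of_hasDerivWithinAt_affine (A := freqGen n β k)
    (H := fun τ => (0, h τ)) (x := fun τ => (y τ, z τ)) (Θ := freqProp n β k t) hst hH
    (fun τ _ => hasDerivAt_freqProp β k t τ) (freqProp_self β k t)
    (fun τ hτ => ((hy τ hτ).prodMk (hz τ hτ)).congr_deriv (by simp [freqGen_apply]))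
  have hi : IntervalIntegrable (fun τ => freqProp n β k t τ ((0 : L2C n), h τ)) volume s t :=
    ((continuous_freqProp β k t).continuousOn.clm_apply hH).intervalIntegrable_of_Icc hst
  have := congrArg (ContinuousLinearMap.fst ℝ (L2C n) (L2C n)) key
  rw [map_add, ← ContinuousLinearMap.intervalIntegral_comp_comm _ hi] at this
  exact this

theorem IsRegularSolution.freq_deriv {β : ℝ} {S : Set ℝ} {h : ℝ → L2 n} {u v : ℝ → H2 n}
    (H : IsRegularSolution β S h u v) (k : ℕ) :
    ∀ t ∈ S, HasDerivWithinAt (fun τ => freqProj n k (v τ).toH1.toL2)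
      (freqMul (laplaceSymbol n) k (freqProj n k (u t).toH1.toL2 +
        damping β t • freqProj n k (v t).toH1.toL2) + freqProj n k (h t)) S t := by
  intro t ht
  refine ((freqProj n k).hasFDerivAt.comp_hasDerivWithinAt t (H.deriv_v t ht)).congr_deriv ?_
  simp only [map_add, map_smul, H2.freqProj_laplacian]

/-- On the band |ξ| ≤ k an unforced solution satisfies a linear ODE with bounded coefficients, so
its data determine it. -/
theorem IsRegularSolution.freqProj_eq {β s t : ℝ} (hst : s ≤ t) {u v : ℝ → H2 n}
    (H : IsRegularSolution β (Ici s) 0 u v) (k : ℕ) : freqProj n k (u t).toH1.toL2 =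
      (freqProp n β k t s (freqProj n k (u s).toH1.toL2, freqProj n k (v s).toH1.toL2)).1 := by
  have H' := H.mono (Icc_subset_Ici_self : Icc s t ⊆ Ici s)
  have key := freq_duhamel (β := β) (k := k) (s := s) (t := t) hst
    (y := fun τ => freqProj n k (u τ).toH1.toL2) (z := fun τ => freqProj n k (v τ).toH1.toL2)
    (h := fun _ => 0) continuousOn_const
    (fun τ hτ => (freqProj n k).hasFDerivAt.comp_hasDerivWithinAt τ (H'.deriv_u τ hτ))
    (fun τ hτ => (H'.freq_deriv k τ hτ).congr_deriv (by simp))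
  have h0 : ∀ τ : ℝ, freqProp n β k t τ ((0 : L2C n), (0 : L2C n)) = 0 := fun τ => map_zero _
  simpa [h0] using key

theorem H1.continuous_toL2 : Continuous (H1.toL2 : H1 n → L2 n) := (H1.toL2L n).continuous

/-- `IsPropagated` only asserts the existence of approximating strong solutions. This formula shows
that the limit does not depend on them, as each band of r is a continuous function of the data. -/
theorem IsPropagated.freqProj_eq {β s t : ℝ} (hs : 0 ≤ s) (hst : s ≤ t) {f r : H1 n} {g : L2 n}
    (H : IsPropagated β t s f g r) (k : ℕ) :
    freqProj n k r.toL2 = (freqProp n β k t s (freqProj n k f.toL2, freqProj n k g)).1 := by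
  obtain ⟨F, G, U, hU, hF, hG, hr⟩ := H
  have h1 : ∀ j, freqProj n k (U j t).toH1.toL2 =
      (freqProp n β k t s (freqProj n k (F j).toH1.toL2, freqProj n k (G j).toH1.toL2)).1 := by
    intro j
    obtain ⟨v, hv, e1, e2⟩ := (hU j).exists_isRegularSolution hs
    rw [hv.freqProj_eq hst k, e1, e2]
  have c1 : Tendsto (fun j => freqProj n k (U j t).toH1.toL2) atTop (𝓝 (freqProj n k r.toL2)) :=
    ((freqProj n k).continuous.tendsto _).comp ((H1.continuous_toL2.tendsto _).comp hr)
  simp only [h1] at c1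
  refine tendsto_nhds_unique c1 ?_
  have c2 : Tendsto (fun j => (freqProj n k (F j).toH1.toL2, freqProj n k (G j).toH1.toL2)) atTop
      (𝓝 (freqProj n k f.toL2, freqProj n k g)) :=
    (((freqProj n k).continuous.tendsto _).comp ((H1.continuous_toL2.tendsto _).comp hF)).prodMk_nhds
      (((freqProj n k).continuous.tendsto _).comp hG)
  exact (continuous_fst.tendsto _).comp (((freqProp n β k t s).continuous.tendsto _).comp c2)

theorem IsRegularSolution.energy_le_homogeneous {β s t : ℝ} (hst : s ≤ t) {u v : ℝ → H2 n}
    (H : IsRegularSolution β (Ici s) 0 u v) : ‖(u t).toH1‖ ^ 2 ≤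
      Real.exp (2 * (t - s)) * (‖(u s).toH1‖ ^ 2 + ‖(v s).toH1.toL2‖ ^ 2) := by
  have := (H.mono (Icc_subset_Ici_self : Icc s t ⊆ Ici s)).energy_le continuousOn_const t
    (right_mem_Icc.2 hst)
  simp only [Pi.zero_apply, norm_zero, ne_eq, OfNat.ofNat_ne_zero, not_false_eq_true, zero_pow,
    intervalIntegral.integral_zero, add_zero] at this
  exact (le_add_of_nonneg_right (sq_nonneg _)).trans this

theorem IsPropagated.norm_sq_le {β s t : ℝ} (hs : 0 ≤ s) (hst : s ≤ t) {f r : H1 n} {g : L2 n}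
    (H : IsPropagated β t s f g r) :
    ‖r‖ ^ 2 ≤ Real.exp (2 * (t - s)) * (‖f‖ ^ 2 + ‖g‖ ^ 2) := by
  obtain ⟨F, G, U, hU, hF, hG, hr⟩ := H
  refine le_of_tendsto_of_tendsto (hr.norm.pow 2) (((hF.norm.pow 2).add (hG.norm.pow 2)).const_mul _)
    (Eventually.of_forall fun j => ?_)
  obtain ⟨v, hv, e1, e2⟩ := (hU j).exists_isRegularSolution hs
  have := hv.energy_le_homogeneous hst
  rwa [e1, e2] at this

/-- Comparing two approximations with their common limit z separates the two indices. -/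
theorem norm_sub_sq_le {X : Type*} [SeminormedAddCommGroup X] (x y z : X) :
    ‖x - y‖ ^ 2 ≤ 2 * ‖x - z‖ ^ 2 + 2 * ‖y - z‖ ^ 2 := by
  have h := norm_sub_le_norm_sub_add_norm_sub x z y
  rw [norm_sub_rev z y] at h
  nlinarith [norm_nonneg (x - y), sq_nonneg (‖x - z‖ - ‖y - z‖)]

/-- The linear propagator is defined on all of `H¹ × L²`. -/
theorem exists_isPropagated (β : ℝ) {s t : ℝ} (hs : 0 ≤ s) (hst : s ≤ t) (f : H1 n) (g : L2 n) :
    ∃ r, IsPropagated β t s f g r := by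
  have hex : ∀ k : ℕ, ∃ y z : ℝ → L2C n, y s = freqProj n k f.toL2 ∧ z s = freqProj n k g ∧
      (∀ t, HasDerivAt y (z t) t) ∧
      ∀ t, HasDerivAt z (freqMul (laplaceSymbol n) k (y t + damping β t • z t)) t := by
    intro k
    obtain ⟨y, z, h1, h2, h3, h4⟩ := exists_freq_solution (n := n) β k
      (continuous_const (y := (0 : L2 n))) s (freqProj n k f.toL2) (freqProj n k g)
    refine ⟨y, z, h1, h2, h3, fun t => ?_⟩
    have := h4 t
    rwa [map_zero, add_zero] at this
  choose y z hy0 hz0 hy hz using hex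
  -- The approximating strong solutions are band-limited: solving the truncated ODE and synthesizing
  -- gives exact solutions of the full equation, since the truncation commutes with it.
  have hstr : ∀ k, IsStrongSolution β s (H2.ofFreq n k (y k s)) (H2.ofFreq n k (z k s))
      (fun t => H2.ofFreq n k (y k t)) := fun k => isStrongSolution_ofFreq hs (hy k) (hz k)
  have hreg : ∀ k, IsRegularSolution β (Ici s) 0 (fun t => H2.ofFreq n k (y k t))
      (fun t => H2.ofFreq n k (z k t)) := fun k => by
    have := IsRegularSolution.of_freq (β := β) (k := k) (S := Ici s) (h := fun _ => (0 : L2 n))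
      (fun t _ => (hy k t).hasDerivWithinAt)
      (fun t _ => ((hz k t).congr_deriv (by simp)).hasDerivWithinAt)
    simp only [map_zero] at this
    exact this
  have hF : Tendsto (fun k => (H2.ofFreq n k (y k s)).toH1) atTop (𝓝 f) := by
    simp only [hy0, H2.toH1_ofFreq]
    exact H1.tendsto_ofFreq f
  have hG : Tendsto (fun k => (H2.ofFreq n k (z k s)).toH1.toL2) atTop (𝓝 g) := by
    simp only [hz0, H2.toH1_ofFreq, H1.toL2_ofFreq, freqMul_freqProj]
    exact tendsto_fourierInvL_freqProj g
  set δ : ℕ → ℝ := fun k => Real.exp (2 * (t - s)) * (2 * ‖(H2.ofFreq n k (y k s)).toH1 - f‖ ^ 2 +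
    2 * ‖(H2.ofFreq n k (z k s)).toH1.toL2 - g‖ ^ 2)
  have hδ : Tendsto δ atTop (𝓝 0) := by
    have h1 := ((tendsto_iff_norm_sub_tendsto_zero.1 hF).pow 2).const_mul 2
    have h2 := ((tendsto_iff_norm_sub_tendsto_zero.1 hG).pow 2).const_mul 2
    have h3 := (h1.add h2).const_mul (Real.exp (2 * (t - s)))
    rw [zero_pow two_ne_zero, mul_zero, add_zero, mul_zero] at h3
    exact h3
  obtain ⟨r, hr⟩ := exists_tendstoUniformlyOn_of_norm_sub_sq_le (S := ({t} : Set ℝ))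
    (F := fun k t => (H2.ofFreq n k (y k t)).toH1) hδ (by
      rintro k j t' rfl
      have h0 : IsRegularSolution β (Ici s) 0 (fun t => H2.ofFreq n k (y k t) - H2.ofFreq n j (y j t))
        (fun t => H2.ofFreq n k (z k t) - H2.ofFreq n j (z j t)) := by
        have := (hreg k).sub (hreg j)
        simp only [Pi.zero_apply, sub_zero] at this
        exact this
      refine (h0.energy_le_homogeneous hst).trans ?_
      have e1 := norm_sub_sq_le (H2.ofFreq n k (y k s)).toH1 (H2.ofFreq n j (y j s)).toH1 f
      have e2 := norm_sub_sq_le (H2.ofFreq n k (z k s)).toH1.toL2 (H2.ofFreq n j (z j s)).toH1.toL2 g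
      rw [← mul_add]
      refine mul_le_mul_of_nonneg_left ?_ (Real.exp_pos _).le
      calc _ ≤ _ := add_le_add e1 e2
        _ = _ := by ring)
  exact ⟨r t, fun k => H2.ofFreq n k (y k s), fun k => H2.ofFreq n k (z k s),
    fun k t => H2.ofFreq n k (y k t), hstr, hF, hG, hr.tendsto_at rfl⟩

end Propagator

/-! ### The forced linear equation -/

section WeakSolutions

variable {n : ℕ}

/-- Solutions on `[a,b]` of `u_tt - Δu - (1+t)^{-β} Δu_t = h` in
`C([a,b]; H¹) ∩ C¹([a,b]; L²)`, the equation being required after truncation of frequencies. -/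
structure IsWeakSolution (β a b : ℝ) (h : ℝ → L2 n) (u : ℝ → H1 n) (v : ℝ → L2 n) : Prop where
  cont_u : ContinuousOn u (Icc a b)
  deriv_u : ∀ t ∈ Icc a b, HasDerivWithinAt (fun τ => (u τ).toL2) (v t) (Icc a b) t
  cont_v : ContinuousOn v (Icc a b)
  freq_eq : ∀ k, ∀ t ∈ Icc a b, HasDerivWithinAt (fun τ => freqProj n k (v τ))
    (freqMul (laplaceSymbol n) k (freqProj n k (u t).toL2 + damping β t • freqProj n k (v t))
      + freqProj n k (h t)) (Icc a b) t

variable {β a b : ℝ} {h h' : ℝ → L2 n} {u u' : ℝ → H1 n} {v v' : ℝ → L2 n}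

theorem IsWeakSolution.sub (H : IsWeakSolution β a b h u v) (H' : IsWeakSolution β a b h' u' v') :
    IsWeakSolution β a b (fun t => h t - h' t) (fun t => u t - u' t) (fun t => v t - v' t) := by
  refine ⟨H.cont_u.sub H'.cont_u, fun t ht => (H.deriv_u t ht).sub (H'.deriv_u t ht),
    H.cont_v.sub H'.cont_v, fun k t ht => ?_⟩
  have e : ∀ τ, freqProj n k (v τ - v' τ) = freqProj n k (v τ) - freqProj n k (v' τ) :=
    fun τ => map_sub _ _ _
  simp only [e]
  refine ((H.freq_eq k t ht).sub (H'.freq_eq k t ht)).congr_deriv ?_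
  have e2 : (u t - u' t).toL2 = (u t).toL2 - (u' t).toL2 := rfl
  rw [e2]
  simp only [map_sub, map_add, map_smul, smul_sub]
  abel

theorem IsWeakSolution.mono {a' b' : ℝ} (H : IsWeakSolution β a b h u v)
    (hs : Icc a' b' ⊆ Icc a b) : IsWeakSolution β a' b' h u v :=
  ⟨H.cont_u.mono hs, fun t ht => (H.deriv_u t (hs ht)).mono hs, H.cont_v.mono hs,
    fun k t ht => (H.freq_eq k t (hs ht)).mono hs⟩

theorem IsWeakSolution.congr_forcing (H : IsWeakSolution β a b h u v)
    (hh : ∀ t ∈ Icc a b, h' t = h t) : IsWeakSolution β a b h' u v :=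
  ⟨H.cont_u, H.deriv_u, H.cont_v, fun k t ht => by rw [hh t ht]; exact H.freq_eq k t ht⟩

theorem continuousOn_toL2 {u : ℝ → H1 n} {S : Set ℝ} (hu : ContinuousOn u S) :
    ContinuousOn (fun t => (u t).toL2) S := H1.continuous_toL2.comp_continuousOn hu

theorem IsWeakSolution.glue {c : ℝ} (hab : a ≤ b) (hbc : b ≤ c) (H : IsWeakSolution β a b h u v)
    (H' : IsWeakSolution β b c h' u' v') (hu : u b = u' b) (hv : v b = v' b) (hh : h b = h' b) :
    IsWeakSolution β a c (fun t => if t ≤ b then h t else h' t)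
      (fun t => if t ≤ b then u t else u' t) (fun t => if t ≤ b then v t else v' t) := by
  refine ⟨continuousOn_glue hab hbc H.cont_u H'.cont_u hu, fun t ht => ?_,
    continuousOn_glue hab hbc H.cont_v H'.cont_v hv, fun k t ht => ?_⟩
  · have := hasDerivWithinAt_glue hab hbc H.deriv_u H'.deriv_u (by rw [hu]) hv t ht
    refine this.congr (fun s _ => ?_) ?_ <;> split_ifs <;> rfl
  · have := hasDerivWithinAt_glue hab hbc (H.freq_eq k) (H'.freq_eq k) (by rw [hv])
      (by rw [hu, hv, hh]) t ht
    refine HasDerivWithinAt.congr (this.congr_deriv ?_) (fun s _ => ?_) ?_ <;> split_ifs <;> rfl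

theorem norm_fourierInvL_freqProj_le (k : ℕ) (f : L2 n) : ‖fourierInvL n (freqProj n k f)‖ ≤ ‖f‖ :=
  (norm_fourierInvL_le _).trans (norm_freqProj_le k f)

/-- Each band of a weak solution synthesizes to a regular solution with truncated forcing. Its
energy estimate has constants free of k, and the limit k → ∞ recovers the full norms. -/
theorem IsWeakSolution.energy_le (H : IsWeakSolution β a b h u v) (hh : ContinuousOn h (Icc a b)) :
    ∀ t ∈ Icc a b, ‖u t‖ ^ 2 + ‖v t‖ ^ 2 ≤ Real.exp (2 * (t - a)) *
      (‖u a‖ ^ 2 + ‖v a‖ ^ 2 + ∫ s in a..t, ‖h s‖ ^ 2) := by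
  intro t ht
  have hsub : Icc a t ⊆ Icc a b := Icc_subset_Icc_right ht.2
  have hreg : ∀ k, IsRegularSolution β (Icc a b) (fun t => fourierInvL n (freqProj n k (h t)))
      (fun t => H2.ofFreq n k (freqProj n k (u t).toL2))
      (fun t => H2.ofFreq n k (freqProj n k (v t))) := fun k =>
    IsRegularSolution.of_freq
      (fun t ht => (freqProj n k).hasFDerivAt.comp_hasDerivWithinAt t (H.deriv_u t ht))
      (H.freq_eq k)
  have hlim : ∀ s, Tendsto (fun k => ‖H1.ofFreq n k (freqProj n k (u s).toL2)‖ ^ 2 +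
      ‖fourierInvL n (freqMul 1 k (freqProj n k (v s)))‖ ^ 2) atTop
      (𝓝 (‖u s‖ ^ 2 + ‖v s‖ ^ 2)) := by
    intro s
    have h2 := tendsto_fourierInvL_freqProj (v s)
    simp only [freqMul_freqProj]
    exact ((H1.tendsto_ofFreq (u s)).norm.pow 2).add (h2.norm.pow 2)
  refine le_of_tendsto_of_tendsto (hlim t)
    (((hlim a).add (tendsto_const_nhds (x := ∫ s in a..t, ‖h s‖ ^ 2))).const_mul _)
    (Eventually.of_forall fun k => ?_)
  have hc : ContinuousOn (fun t => fourierInvL n (freqProj n k (h t))) (Icc a b) :=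
    (fourierInvL n ∘L freqProj n k).continuous.comp_continuousOn hh
  refine ((hreg k).energy_le hc t ht).trans ?_
  simp only [H2.toH1_ofFreq, H1.toL2_ofFreq]
  refine mul_le_mul_of_nonneg_left ?_ (Real.exp_pos _).le
  refine add_le_add_right ?_ _
  refine intervalIntegral.integral_mono_on ht.1
    (((hc.mono hsub).norm.pow 2).intervalIntegrable_of_Icc ht.1)
    (((hh.mono hsub).norm.pow 2).intervalIntegrable_of_Icc ht.1) fun s _ => ?_
  exact pow_le_pow_left₀ (norm_nonneg _) (norm_fourierInvL_freqProj_le k _) 2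

theorem tendsto_integral_freqProj_sub {h : ℝ → L2 n} (hh : Continuous h) (a b : ℝ) :
    Tendsto (fun k => ∫ s in a..b, ‖fourierInvL n (freqProj n k (h s)) - h s‖ ^ 2) atTop (𝓝 0) := by
  have hc : ∀ k, Continuous fun s => ‖fourierInvL n (freqProj n k (h s)) - h s‖ ^ 2 := fun k =>
    ((((fourierInvL n ∘L freqProj n k).continuous.comp hh).sub hh).norm.pow 2)
  have := intervalIntegral.tendsto_integral_filter_of_dominated_convergence
    (μ := volume) (a := a) (b := b) (l := atTop) (f := fun _ => (0 : ℝ))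
    (F := fun k s => ‖fourierInvL n (freqProj n k (h s)) - h s‖ ^ 2)
    (fun s => (2 * ‖h s‖) ^ 2)
    (Eventually.of_forall fun k => (hc k).aestronglyMeasurable)
    (Eventually.of_forall fun k => Eventually.of_forall fun s _ => by
      rw [Real.norm_eq_abs, abs_of_nonneg (sq_nonneg _)]
      refine pow_le_pow_left₀ (norm_nonneg _) ((norm_sub_le _ _).trans ?_) 2
      linarith [norm_fourierInvL_freqProj_le k (h s)])
    (((continuous_const.mul hh.norm).pow 2).intervalIntegrable _ _)
    (Eventually.of_forall fun s _ => by
      have := (tendsto_iff_norm_sub_tendsto_zero.1 (tendsto_fourierInvL_freqProj (h s))).pow 2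
      rwa [zero_pow two_ne_zero] at this)
  simpa using this

/-- Solvability of the forced linear equation. -/
theorem exists_isWeakSolution (β : ℝ) {a b : ℝ} (hab : a ≤ b) {h : ℝ → L2 n} (hh : Continuous h)
    (f : H1 n) (g : L2 n) :
    ∃ (u : ℝ → H1 n) (v : ℝ → L2 n), IsWeakSolution β a b h u v ∧ u a = f ∧ v a = g := by
  choose y z hy0 hz0 hy hz using fun k => exists_freq_solution (n := n) β k hh a
    (freqProj n k f.toL2) (freqProj n k g)
  have hreg : ∀ k, IsRegularSolution β (Icc a b) (fun t => fourierInvL n (freqProj n k (h t)))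
      (fun t => H2.ofFreq n k (y k t)) (fun t => H2.ofFreq n k (z k t)) := fun k =>
    IsRegularSolution.of_freq (fun t _ => (hy k t).hasDerivWithinAt)
      (fun t _ => (hz k t).hasDerivWithinAt)
  have cy : ∀ k, Continuous (y k) := fun k =>
    continuous_iff_continuousAt.2 fun t => (hy k t).continuousAt
  have cz : ∀ k, Continuous (z k) := fun k =>
    continuous_iff_continuousAt.2 fun t => (hz k t).continuousAt
  have cP : ∀ k, Continuous fun t => fourierInvL n (freqProj n k (h t)) := fun k =>
    (fourierInvL n ∘L freqProj n k).continuous.comp hh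
  set U : ℕ → ℝ → H1 n := fun k t => H1.ofFreq n k (y k t) with hU
  set V : ℕ → ℝ → L2 n := fun k t => fourierInvL n (freqMul 1 k (z k t)) with hV
  have cU : ∀ k, Continuous (U k) := fun k => (H1.ofFreq n k).continuous.comp (cy k)
  have cV : ∀ k, Continuous (V k) := fun k =>
    (fourierInvL n ∘L freqMul 1 k).continuous.comp (cz k)
  have hF : Tendsto (fun k => U k a) atTop (𝓝 f) := by
    simp only [hU, hy0]
    exact H1.tendsto_ofFreq f
  have hG : Tendsto (fun k => V k a) atTop (𝓝 g) := by
    simp only [hV, hz0, freqMul_freqProj]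
    exact tendsto_fourierInvL_freqProj g
  have hI := tendsto_integral_freqProj_sub hh a b
  set δ : ℕ → ℝ := fun k => Real.exp (2 * (b - a)) * (2 * ‖U k a - f‖ ^ 2 + 2 * ‖V k a - g‖ ^ 2 +
    2 * ∫ s in a..b, ‖fourierInvL n (freqProj n k (h s)) - h s‖ ^ 2) with hδdef
  have hδ : Tendsto δ atTop (𝓝 0) := by
    have h1 := ((tendsto_iff_norm_sub_tendsto_zero.1 hF).pow 2).const_mul 2
    have h2 := ((tendsto_iff_norm_sub_tendsto_zero.1 hG).pow 2).const_mul 2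
    have h3 := ((h1.add h2).add (hI.const_mul 2)).const_mul (Real.exp (2 * (b - a)))
    rw [zero_pow two_ne_zero, mul_zero, add_zero, add_zero, mul_zero] at h3
    exact h3
  -- The levels k and j both solve the untruncated equation, with forcings truncated to different
  -- bands. Their difference is again a regular solution, and the energy estimate bounds it by the
  -- differences of data and forcing.
  have hdiff : ∀ k j, ∀ t ∈ Icc a b, ‖U k t - U j t‖ ^ 2 + ‖V k t - V j t‖ ^ 2 ≤ δ k + δ j := by
    intro k j t ht
    refine (((hreg k).sub (hreg j)).energy_le ((cP k).sub (cP j)).continuousOn t ht).trans ?_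
    have e0 : Real.exp (2 * (t - a)) ≤ Real.exp (2 * (b - a)) :=
      Real.exp_le_exp.2 (by linarith [ht.2])
    have e1 := norm_sub_sq_le (U k a) (U j a) f
    have e2 := norm_sub_sq_le (V k a) (V j a) g
    have ik : Continuous fun s => ‖fourierInvL n (freqProj n k (h s)) - h s‖ ^ 2 :=
      ((cP k).sub hh).norm.pow 2
    have ij : Continuous fun s => ‖fourierInvL n (freqProj n j (h s)) - h s‖ ^ 2 :=
      ((cP j).sub hh).norm.pow 2
    have ikj : Continuous fun s =>
        ‖fourierInvL n (freqProj n k (h s)) - fourierInvL n (freqProj n j (h s))‖ ^ 2 :=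
      ((cP k).sub (cP j)).norm.pow 2
    have e3 : ∫ s in a..t, ‖fourierInvL n (freqProj n k (h s)) -
        fourierInvL n (freqProj n j (h s))‖ ^ 2 ≤
        2 * (∫ s in a..b, ‖fourierInvL n (freqProj n k (h s)) - h s‖ ^ 2) +
        2 * ∫ s in a..b, ‖fourierInvL n (freqProj n j (h s)) - h s‖ ^ 2 := by
      refine (intervalIntegral.integral_mono_interval le_rfl ht.1 ht.2
        (Eventually.of_forall fun s => sq_nonneg _) (ikj.intervalIntegrable _ _)).trans ?_
      rw [← intervalIntegral.integral_const_mul, ← intervalIntegral.integral_const_mul,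
        ← intervalIntegral.integral_add ((ik.const_mul 2).intervalIntegrable _ _)
          ((ij.const_mul 2).intervalIntegrable _ _)]
      exact intervalIntegral.integral_mono_on hab (ikj.intervalIntegrable _ _)
        (((ik.const_mul 2).add (ij.const_mul 2)).intervalIntegrable _ _)
        fun s _ => norm_sub_sq_le _ _ _
    have e4 : (0 : ℝ) ≤ ∫ s in a..t, ‖fourierInvL n (freqProj n k (h s)) -
        fourierInvL n (freqProj n j (h s))‖ ^ 2 :=
      intervalIntegral.integral_nonneg ht.1 fun s _ => sq_nonneg _
    rw [hδdef]
    dsimp only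
    rw [← mul_add]
    refine mul_le_mul e0 ?_ (by positivity) (Real.exp_pos _).le
    calc _ ≤ _ := add_le_add (add_le_add e1 e2) e3
      _ = _ := by ring
  obtain ⟨u, hu⟩ := exists_tendstoUniformlyOn_of_norm_sub_sq_le (F := U) (S := Icc a b) hδ
    fun k j t ht => (le_add_of_nonneg_right (sq_nonneg _)).trans (hdiff k j t ht)
  obtain ⟨v, hv⟩ := exists_tendstoUniformlyOn_of_norm_sub_sq_le (F := V) (S := Icc a b) hδ
    fun k j t ht => (le_add_of_nonneg_left (sq_nonneg _)).trans (hdiff k j t ht)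
  have ha : a ∈ Icc a b := left_mem_Icc.2 hab
  have cu : ContinuousOn u (Icc a b) :=
    hu.continuousOn (Eventually.of_forall fun k => (cU k).continuousOn).frequently
  have cv : ContinuousOn v (Icc a b) :=
    hv.continuousOn (Eventually.of_forall fun k => (cV k).continuousOn).frequently
  obtain ⟨K, hK⟩ : ∃ K, ∀ k, ∀ t ∈ Icc a b, ‖U k t‖ ^ 2 + ‖V k t‖ ^ 2 ≤ K := by
    have hb := ((hF.norm.pow 2).add (hG.norm.pow 2)).bddAbove_range
    obtain ⟨K₀, hK₀⟩ := hb
    refine ⟨Real.exp (2 * (b - a)) * (K₀ + ∫ s in a..b, ‖h s‖ ^ 2), fun k t ht => ?_⟩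
    refine ((hreg k).energy_le (cP k).continuousOn t ht).trans ?_
    have e0 : Real.exp (2 * (t - a)) ≤ Real.exp (2 * (b - a)) :=
      Real.exp_le_exp.2 (by linarith [ht.2])
    have e1 : ‖U k a‖ ^ 2 + ‖V k a‖ ^ 2 ≤ K₀ := hK₀ ⟨k, rfl⟩
    have i1 : Continuous fun s => ‖fourierInvL n (freqProj n k (h s))‖ ^ 2 := (cP k).norm.pow 2
    have e2 : ∫ s in a..t, ‖fourierInvL n (freqProj n k (h s))‖ ^ 2 ≤ ∫ s in a..b, ‖h s‖ ^ 2 := by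
      refine (intervalIntegral.integral_mono_interval le_rfl ht.1 ht.2
        (Eventually.of_forall fun s => sq_nonneg _) (i1.intervalIntegrable _ _)).trans ?_
      exact intervalIntegral.integral_mono_on hab (i1.intervalIntegrable _ _)
        ((hh.norm.pow 2).intervalIntegrable _ _)
        fun s _ => pow_le_pow_left₀ (norm_nonneg _) (norm_fourierInvL_freqProj_le k _) 2
    have e4 : (0 : ℝ) ≤ ∫ s in a..t, ‖fourierInvL n (freqProj n k (h s))‖ ^ 2 :=
      intervalIntegral.integral_nonneg ht.1 fun s _ => sq_nonneg _
    exact mul_le_mul e0 (add_le_add e1 e2) (by positivity) (Real.exp_pos _).le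
  have hK' : ∀ k, ∀ t ∈ Icc a b, ‖(U k t).toL2‖ ≤ √K ∧ ‖V k t‖ ≤ √K := by
    intro k t ht
    have := hK k t ht
    constructor
    · refine (H1.norm_toL2_le _).trans (Real.le_sqrt_of_sq_le ?_)
      nlinarith [sq_nonneg ‖V k t‖]
    · refine Real.le_sqrt_of_sq_le ?_
      nlinarith [sq_nonneg ‖U k t‖]
  have lu : ∀ t ∈ Icc a b, Tendsto (fun k => (U k t).toL2) atTop (𝓝 (u t).toL2) := fun t ht =>
    (H1.continuous_toL2.tendsto _).comp (hu.tendsto_at ht)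
  refine ⟨u, v, ⟨cu, ?_, cv, fun j => ?_⟩, tendsto_nhds_unique (hu.tendsto_at ha) hF,
    tendsto_nhds_unique (hv.tendsto_at ha) hG⟩
  · exact hasDerivWithinAt_of_tendsto (F := fun k t => (U k t).toL2) (F' := V)
      (fun k => (hreg k).deriv_u)
      (fun k => (cV k).continuousOn) cv lu (fun t ht => hv.tendsto_at ht)
      fun k t ht => (hK' k t ht).2
  · obtain ⟨D, hD⟩ := isCompact_Icc.exists_bound_of_continuousOn
      (continuous_damping β).continuousOn (s := Icc a b)
    obtain ⟨B, hB⟩ := isCompact_Icc.exists_bound_of_continuousOn hh.continuousOn (s := Icc a b)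
    have cd := continuous_damping β
    have cU' : ∀ k, Continuous fun t => (U k t).toL2 := fun k => H1.continuous_toL2.comp (cU k)
    have cu' : ContinuousOn (fun t => (u t).toL2) (Icc a b) := continuousOn_toL2 cu
    refine hasDerivWithinAt_of_tendsto (F := fun k t => freqProj n j (V k t))
      (F' := fun k t => freqMul (laplaceSymbol n) j (freqProj n j (U k t).toL2 +
        damping β t • freqProj n j (V k t)) + freqProj n j (fourierInvL n (freqProj n k (h t))))
      (C := ‖freqMul (laplaceSymbol n) j‖ * (√K + D * √K) + B)
      (fun k => (hreg k).freq_deriv j) (fun k => ?_) ?_ (fun t ht => ?_) (fun t ht => ?_)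
      (fun k t ht => ?_)
    · refine Continuous.continuousOn ?_
      have := cU' k
      have := cV k
      have := cP k
      fun_prop
    · have := hh.continuousOn (s := Icc a b)
      have := cd.continuousOn (s := Icc a b)
      fun_prop
    · exact ((freqProj n j).continuous.tendsto _).comp (hv.tendsto_at ht)
    · have l1 : Tendsto (fun k => freqProj n j (U k t).toL2) atTop (𝓝 (freqProj n j (u t).toL2)) :=
        ((freqProj n j).continuous.tendsto _).comp (lu t ht)
      have l2 : Tendsto (fun k => freqProj n j (V k t)) atTop (𝓝 (freqProj n j (v t))) :=
        ((freqProj n j).continuous.tendsto _).comp (hv.tendsto_at ht)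
      have l3 : Tendsto (fun k => freqProj n j (fourierInvL n (freqProj n k (h t)))) atTop
          (𝓝 (freqProj n j (h t))) :=
        ((freqProj n j).continuous.tendsto _).comp (tendsto_fourierInvL_freqProj _)
      exact (((freqMul (laplaceSymbol n) j).continuous.tendsto _).comp
        (l1.add (l2.const_smul _))).add l3
    · refine (norm_add_le _ _).trans (add_le_add ?_ ?_)
      · refine (ContinuousLinearMap.le_opNorm _ _).trans ?_
        refine mul_le_mul_of_nonneg_left ?_ (norm_nonneg _)
        refine (norm_add_le _ _).trans (add_le_add ?_ ?_)
        · exact (norm_freqProj_le _ _).trans (hK' k t ht).1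
        · rw [norm_smul]
          exact mul_le_mul (hD t ht) ((norm_freqProj_le _ _).trans (hK' k t ht).2) (norm_nonneg _)
            ((norm_nonneg _).trans (hD t ht))
      · exact ((norm_freqProj_le _ _).trans (norm_fourierInvL_freqProj_le _ _)).trans (hB t ht)

end WeakSolutions

/-! ### Mild solutions and weak solutions coincide -/

section MildSolutions

variable {n : ℕ} {β p : ℝ} {u₀ : H1 n} {u₁ : L2 n} {N : H1 n → L2 n}

/-- `N` is the nonlinearity `u ↦ |u|^p` from `H¹` to `L²`. -/
def IsPowerMap (p : ℝ) (N : H1 n → L2 n) : Prop :=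
  ∀ f : H1 n, ∀ᵐ x, N f x = |f.toL2 x| ^ p

theorem IsPowerMap.eq_of_ae (hN : IsPowerMap p N) {f : H1 n} {g : L2 n}
    (hg : ∀ᵐ x, g x = |f.toL2 x| ^ p) : g = N f := by
  refine Lp.ext ?_
  filter_upwards [hg, hN f] with x h1 h2
  rw [h1, h2]

/-- The mild formula, projected to a band, is Duhamel's formula of the truncated ODE with the same
forcing and data. Hence every band of u is the ODE solution, and the second time derivative is read
off from the ODE. -/
theorem IsMildSolution.isWeakSolution (hN : IsPowerMap p N) (hNc : Continuous N) {T : ℝ}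
    (hT : 0 < T) {u : ℝ → H1 n} {v : ℝ → L2 n} (H : IsMildSolution β p u₀ u₁ T u v) :
    IsWeakSolution β 0 T (fun t => N (u t)) u v := by
  obtain ⟨cu, du, cv, hu0, hv0, hmild⟩ := H
  refine ⟨cu, du, cv, fun k => ?_⟩
  -- The ODE theorem requires a forcing that is continuous on the whole line.
  set h : ℝ → L2 n := fun t => N (u (projIcc 0 T hT.le t)) with hh
  have hc : Continuous h :=
    hNc.comp ((continuousOn_iff_continuous_domRestrict.1 cu).comp continuous_projIcc)
  have hhN : ∀ t ∈ Icc 0 T, h t = N (u t) := fun t ht => by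
    simp only [hh, projIcc_of_mem hT.le ht]
  obtain ⟨y, z, hy0, hz0, hy, hz⟩ := exists_freq_solution (n := n) β k hc 0
    (freqProj n k u₀.toL2) (freqProj n k u₁)
  have hyu : ∀ t ∈ Icc 0 T, freqProj n k (u t).toL2 = y t := by
    intro t ht
    obtain ⟨r, w, hr, hw, hwi, hut⟩ := hmild t ht
    have key := freq_duhamel (β := β) (k := k) ht.1 (y := y) (z := z)
      (h := fun τ => freqProj n k (h τ)) ((freqProj n k).continuous.comp hc).continuousOn
      (fun τ _ => (hy τ).hasDerivWithinAt) (fun τ _ => (hz τ).hasDerivWithinAt)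
    rw [key, hut]
    have e2 : (freqProj n k ∘L H1.toL2L n) (r + ∫ s in (0 : ℝ)..t, w s) =
        freqProj n k r.toL2 + ∫ s in (0 : ℝ)..t, freqProj n k (w s).toL2 := by
      rw [map_add, ← ContinuousLinearMap.intervalIntegral_comp_comm _ hwi]
      rfl
    refine Eq.trans e2 ?_
    rw [hr.freqProj_eq le_rfl ht.1 k, hy0, hz0]
    congr 1
    refine intervalIntegral.integral_congr fun s hs => ?_
    rw [uIcc_of_le ht.1] at hs
    obtain ⟨Ns, hNs, hprop⟩ := hw s hs
    have e3 : Ns = h s := by rw [hhN s ⟨hs.1, hs.2.trans ht.2⟩]; exact hN.eq_of_ae hNs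
    have e4 : (0 : H1 n).toL2 = 0 := rfl
    rw [hprop.freqProj_eq hs.1 hs.2 k, e3, e4, map_zero]
  -- Both sides are the derivative of the same function on [0,T]; derivatives within this interval
  -- are unique because T > 0.
  have hzv : ∀ t ∈ Icc 0 T, freqProj n k (v t) = z t := by
    intro t ht
    have d1 : HasDerivWithinAt (fun τ => freqProj n k (u τ).toL2) (freqProj n k (v t)) (Icc 0 T) t :=
      (freqProj n k).hasFDerivAt.comp_hasDerivWithinAt t (du t ht)
    have d2 : HasDerivWithinAt (fun τ => freqProj n k (u τ).toL2) (z t) (Icc 0 T) t :=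
      (hy t).hasDerivWithinAt.congr hyu (hyu t ht)
    exact (uniqueDiffOn_Icc hT t ht).eq_deriv _ d1 d2
  intro t ht
  rw [hyu t ht, hzv t ht, ← hhN t ht]
  exact (hz t).hasDerivWithinAt.congr hzv (hzv t ht)

/-- Both sides of the mild formula agree on every band by Duhamel's formula, and the bands determine
an element of H¹. -/
theorem IsWeakSolution.isMildSolution (hN : IsPowerMap p N) (hNc : Continuous N) {T : ℝ}
    {u : ℝ → H1 n} {v : ℝ → L2 n} (H : IsWeakSolution β 0 T (fun t => N (u t)) u v) :
    IsMildSolution β p (u 0) (v 0) T u v := by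
  refine ⟨H.cont_u, H.deriv_u, H.cont_v, rfl, rfl, fun t ht => ?_⟩
  obtain ⟨r, hr⟩ := exists_isPropagated β le_rfl ht.1 (u 0) (v 0)
  have hwex : ∀ s, ∃ w : H1 n, s ∈ Icc 0 t → IsPropagated β t s 0 (N (u s)) w := by
    intro s
    by_cases hs : s ∈ Icc 0 t
    · obtain ⟨w, hw⟩ := exists_isPropagated β hs.1 hs.2 (0 : H1 n) (N (u s))
      exact ⟨w, fun _ => hw⟩
    · exact ⟨0, fun h => absurd h hs⟩
  choose w hw using hwex
  have H' := H.mono (Icc_subset_Icc_right ht.2 : Icc 0 t ⊆ Icc 0 T)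
  have cN : ContinuousOn (fun s => N (u s)) (Icc 0 t) := hNc.comp_continuousOn H'.cont_u
  have e0 : (0 : H1 n).toL2 = 0 := rfl
  have hwf : ∀ k, ∀ s ∈ Icc 0 t, freqProj n k (w s).toL2 =
      (freqProp n β k t s (0, freqProj n k (N (u s)))).1 := by
    intro k s hs
    rw [(hw s hs).freqProj_eq hs.1 hs.2 k, e0, map_zero]
  -- The values w(s) were chosen separately for each s, so measurability is not automatic: w is the
  -- pointwise limit of its band truncations, which are continuous in s by the propagator formula.
  -- The energy bound on the propagator makes w bounded.
  have hwi : IntervalIntegrable w volume 0 t := by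
    rw [intervalIntegrable_iff_integrableOn_Ioc_of_le ht.1]
    obtain ⟨B, hB⟩ := isCompact_Icc.exists_bound_of_continuousOn cN
    refine IntegrableOn.of_bound (by simp) ?_ (Real.exp t * B) ?_
    · refine aestronglyMeasurable_of_tendsto_ae atTop
        (f := fun k s => H1.ofFreq n k (freqProj n k (w s).toL2)) (fun k => ?_)
        (Eventually.of_forall fun s => H1.tendsto_ofFreq (w s))
      have : SecondCountableTopologyEither ℝ (H1 n) := ⟨Or.inl inferInstance⟩
      refine ContinuousOn.aestronglyMeasurable ?_ measurableSet_Ioc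
      have c1 : ContinuousOn (fun s => H1.ofFreq n k
          (freqProp n β k t s (0, freqProj n k (N (u s)))).1) (Icc 0 t) := by
        have c2 : ContinuousOn (fun s => ((0 : L2C n), freqProj n k (N (u s)))) (Icc 0 t) :=
          continuousOn_const.prodMk ((freqProj n k).continuous.comp_continuousOn cN)
        exact (H1.ofFreq n k).continuous.comp_continuousOn (continuous_fst.comp_continuousOn
          ((continuous_freqProp β k t).continuousOn.clm_apply c2))
      exact (c1.congr fun s hs => by rw [hwf k s hs]).mono Ioc_subset_Icc_self
    · refine (ae_restrict_iff' measurableSet_Ioc).2 (Eventually.of_forall fun s hs => ?_)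
      have hs' := Ioc_subset_Icc_self hs
      have h1 := (hw s hs').norm_sq_le hs'.1 hs'.2
      rw [norm_zero, zero_pow two_ne_zero, zero_add] at h1
      have h2 : ‖N (u s)‖ ≤ B := hB s hs'
      have h3 : Real.exp (2 * (t - s)) ≤ Real.exp t ^ 2 := by
        rw [← Real.exp_nat_mul]
        refine Real.exp_le_exp.2 ?_
        push_cast
        linarith [hs'.1]
      have hB0 : 0 ≤ B := (norm_nonneg _).trans h2
      refine le_of_sq_le_sq ?_ (by positivity)
      rw [mul_pow]
      exact h1.trans (mul_le_mul h3 (pow_le_pow_left₀ (norm_nonneg _) h2 2) (sq_nonneg _)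
        (sq_nonneg _))
  refine ⟨r, w, hr, fun s hs => ⟨N (u s), hN (u s), hw s hs⟩, hwi, ?_⟩
  refine H1.toL2_injective (eq_of_freqProj_eq fun k => ?_)
  have key := freq_duhamel (β := β) (k := k) ht.1 (y := fun τ => freqProj n k (u τ).toL2)
    (z := fun τ => freqProj n k (v τ)) (h := fun τ => freqProj n k (N (u τ)))
    ((freqProj n k).continuous.comp_continuousOn cN)
    (fun τ hτ => (freqProj n k).hasFDerivAt.comp_hasDerivWithinAt τ (H'.deriv_u τ hτ))
    (H'.freq_eq k)
  have e2 : freqProj n k (r + ∫ s in (0 : ℝ)..t, w s).toL2 =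
      freqProj n k r.toL2 + ∫ s in (0 : ℝ)..t, freqProj n k (w s).toL2 := by
    have : (freqProj n k ∘L H1.toL2L n) (r + ∫ s in (0 : ℝ)..t, w s) =
        freqProj n k r.toL2 + ∫ s in (0 : ℝ)..t, freqProj n k (w s).toL2 := by
      rw [map_add, ← ContinuousLinearMap.intervalIntegral_comp_comm _ hwi]
      rfl
    exact this
  rw [key, e2, hr.freqProj_eq le_rfl ht.1 k]
  congr 1
  refine intervalIntegral.integral_congr fun s hs => ?_
  rw [uIcc_of_le ht.1] at hs
  exact (hwf k s hs).symm

end MildSolutions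

/-! ### Uniqueness and local existence -/

/-- Grönwall applied to the primitive of φ, which starts at 0 and whose derivative is at most K
times itself. -/
theorem eq_zero_of_le_mul_integral {a b K : ℝ} (hab : a ≤ b) {φ : ℝ → ℝ}
    (hφ : ContinuousOn φ (Icc a b)) (h0 : ∀ t ∈ Icc a b, 0 ≤ φ t)
    (hK : ∀ t ∈ Icc a b, φ t ≤ K * ∫ s in a..t, φ s) : ∀ t ∈ Icc a b, φ t = 0 := by
  set ψ : ℝ → ℝ := fun s => φ (projIcc a b hab s) with hψ
  have hc : Continuous ψ :=
    (continuousOn_iff_continuous_domRestrict.1 hφ).comp continuous_projIcc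
  have hφψ : ∀ t ∈ Icc a b, ψ t = φ t := fun t ht => by simp only [hψ, projIcc_of_mem hab ht]
  have hint : ∀ t ∈ Icc a b, ∫ s in a..t, φ s = ∫ s in a..t, ψ s := fun t ht => by
    refine intervalIntegral.integral_congr fun s hs => ?_
    rw [uIcc_of_le ht.1] at hs
    exact (hφψ s ⟨hs.1, hs.2.trans ht.2⟩).symm
  have hd : ∀ t, HasDerivAt (fun t => ∫ s in a..t, ψ s) (ψ t) t := fun t =>
    intervalIntegral.integral_hasDerivAt_right (hc.intervalIntegrable _ _)
      hc.aestronglyMeasurable.stronglyMeasurableAtFilter hc.continuousAt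
  have hpos : ∀ t ∈ Icc a b, 0 ≤ ∫ s in a..t, ψ s := fun t ht => by
    refine intervalIntegral.integral_nonneg ht.1 fun s hs => ?_
    rw [hφψ s ⟨hs.1, hs.2.trans ht.2⟩]
    exact h0 s ⟨hs.1, hs.2.trans ht.2⟩
  have hz := eq_zero_of_abs_deriv_le_mul_abs_self_of_eq_zero_right (a := a) (b := b) (K := K)
    (f := fun t => ∫ s in a..t, ψ s) (f' := ψ)
    (fun t _ => (hd t).continuousAt.continuousWithinAt)
    (fun t _ => (hd t).hasDerivWithinAt) intervalIntegral.integral_same (fun t ht => by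
      have ht' := Ico_subset_Icc_self ht
      rw [Real.norm_of_nonneg (hpos t ht'), hφψ t ht', Real.norm_of_nonneg (h0 t ht'), ← hint t ht']
      exact hK t ht')
  intro t ht
  refine le_antisymm ?_ (h0 t ht)
  have h1 := hK t ht
  have h2 : ∫ s in a..t, ψ s = 0 := hz t ht
  rwa [hint t ht, h2, mul_zero] at h1

section LocalTheory

variable {n : ℕ} {β a b : ℝ} {u u' : ℝ → H1 n} {v v' : ℝ → L2 n} {N : H1 n → L2 n}

/-- Lipschitz continuity on bounded sets. -/
def IsLipschitzOnBounded (N : H1 n → L2 n) : Prop :=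
  ∀ R : ℝ, ∃ L : ℝ, 0 ≤ L ∧ ∀ f g : H1 n, ‖f‖ ≤ R → ‖g‖ ≤ R → ‖N f - N g‖ ≤ L * ‖f - g‖

theorem IsLipschitzOnBounded.continuous (hL : IsLipschitzOnBounded N) : Continuous N := by
  refine continuous_iff_continuousAt.2 fun f => ?_
  obtain ⟨L, -, h⟩ := hL (‖f‖ + 1)
  refine tendsto_iff_norm_sub_tendsto_zero.2 ?_
  have h1 : Tendsto (fun g : H1 n => L * ‖g - f‖) (𝓝 f) (𝓝 0) := by
    have : Continuous fun g : H1 n => L * ‖g - f‖ := by fun_prop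
    simpa using this.tendsto f
  refine squeeze_zero' (Eventually.of_forall fun g => norm_nonneg _) ?_ h1
  filter_upwards [Metric.ball_mem_nhds f one_pos] with g hg
  refine h g f ?_ (by linarith)
  rw [mem_ball_iff_norm] at hg
  linarith [norm_le_norm_add_norm_sub f g, norm_sub_rev f g]

/-- Both solutions are bounded on the compact interval, so one Lipschitz constant serves, and the
energy estimate for the difference closes by Grönwall. -/
theorem IsWeakSolution.unique (hL : IsLipschitzOnBounded N) (hab : a ≤ b)
    (H : IsWeakSolution β a b (fun t => N (u t)) u v)
    (H' : IsWeakSolution β a b (fun t => N (u' t)) u' v') (hu : u a = u' a) (hv : v a = v' a) :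
    ∀ t ∈ Icc a b, u t = u' t := by
  obtain ⟨R, hR⟩ := isCompact_Icc.exists_bound_of_continuousOn H.cont_u
  obtain ⟨R', hR'⟩ := isCompact_Icc.exists_bound_of_continuousOn H'.cont_u
  obtain ⟨L, hL0, hLip⟩ := hL (max R R')
  have cN := hL.continuous
  have c1 : ContinuousOn (fun t => N (u t) - N (u' t)) (Icc a b) :=
    (cN.comp_continuousOn H.cont_u).sub (cN.comp_continuousOn H'.cont_u)
  have c2 : ContinuousOn (fun t => ‖u t - u' t‖ ^ 2) (Icc a b) := (H.cont_u.sub H'.cont_u).norm.pow 2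
  have hE := (H.sub H').energy_le c1
  have hz := eq_zero_of_le_mul_integral (K := Real.exp (2 * (b - a)) * L ^ 2) hab c2
    (fun t _ => sq_nonneg _) (fun t ht => by
      have h1 := hE t ht
      simp only [hu, hv, sub_self, norm_zero, ne_eq, OfNat.ofNat_ne_zero, not_false_eq_true,
        zero_pow, zero_add] at h1
      have hsub : Icc a t ⊆ Icc a b := Icc_subset_Icc_right ht.2
      have h2 : ∫ s in a..t, ‖N (u s) - N (u' s)‖ ^ 2 ≤ L ^ 2 * ∫ s in a..t, ‖u s - u' s‖ ^ 2 := by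
        rw [← intervalIntegral.integral_const_mul]
        refine intervalIntegral.integral_mono_on ht.1 ?_ ?_ fun s hs => ?_
        · exact ((c1.norm.pow 2).mono hsub).intervalIntegrable_of_Icc ht.1
        · exact ((c2.mono hsub).const_smul (L ^ 2)).intervalIntegrable_of_Icc ht.1
        · rw [← mul_pow]
          have hs' := hsub hs
          exact pow_le_pow_left₀ (norm_nonneg _) (hLip _ _ ((hR s hs').trans (le_max_left _ _))
            ((hR' s hs').trans (le_max_right _ _))) 2
      have h3 : 0 ≤ ∫ s in a..t, ‖u s - u' s‖ ^ 2 :=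
        intervalIntegral.integral_nonneg ht.1 fun s _ => sq_nonneg _
      have h4 : Real.exp (2 * (t - a)) ≤ Real.exp (2 * (b - a)) :=
        Real.exp_le_exp.2 (by linarith [ht.2])
      calc ‖u t - u' t‖ ^ 2 ≤ ‖u t - u' t‖ ^ 2 + ‖v t - v' t‖ ^ 2 := by
            linarith [sq_nonneg ‖v t - v' t‖]
        _ ≤ _ := h1
        _ ≤ Real.exp (2 * (b - a)) * (L ^ 2 * ∫ s in a..t, ‖u s - u' s‖ ^ 2) :=
            mul_le_mul h4 h2 (intervalIntegral.integral_nonneg ht.1 fun s _ => sq_nonneg _)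
              (Real.exp_nonneg _)
        _ = _ := by ring)
  intro t ht
  exact sub_eq_zero.1 (norm_eq_zero.1 (pow_eq_zero_iff two_ne_zero |>.1 (hz t ht)))

/-- Fixed point of z ↦ solution of the linear equation forced by N(z), in a ball of C([a,a+δ]; H¹).
The essential point is that δ is chosen before a, f and g: the energy estimate depends on the
elapsed time only. -/
theorem exists_local_isWeakSolution (hL : IsLipschitzOnBounded N) (β M : ℝ) :
    ∃ δ : ℝ, 0 < δ ∧ ∀ (a : ℝ) (f : H1 n) (g : L2 n), ‖f‖ ^ 2 + ‖g‖ ^ 2 ≤ M →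
      ∃ (u : ℝ → H1 n) (v : ℝ → L2 n),
        IsWeakSolution β a (a + δ) (fun t => N (u t)) u v ∧ u a = f ∧ v a = g := by
  -- This is the energy bound on a time interval of length at most 1 with forcing of squared norm at
  -- most 1; it makes the ball of radius R invariant.
  set R : ℝ := Real.sqrt (Real.exp 2 * (|M| + 1)) with hR
  have hRsq : R ^ 2 = Real.exp 2 * (|M| + 1) := Real.sq_sqrt (by positivity)
  have hR0 : 0 ≤ R := Real.sqrt_nonneg _
  obtain ⟨L, hL0, hLip⟩ := hL R
  set B : ℝ := ‖N 0‖ + L * R with hB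
  have hB0 : 0 ≤ B := by positivity
  have hNB : ∀ f : H1 n, ‖f‖ ≤ R → ‖N f‖ ≤ B := fun f hf => by
    have h1 := hLip f 0 hf (by simpa using hR0)
    have h2 := norm_le_norm_add_norm_sub (N 0) (N f)
    rw [norm_sub_rev] at h2
    rw [sub_zero] at h1
    have h3 : L * ‖f‖ ≤ L * R := mul_le_mul_of_nonneg_left hf hL0
    rw [hB]; linarith
  -- The three summands give δ ≤ 1, total squared forcing δB² ≤ 1, and squared contraction factor at
  -- most 1/4.
  set W : ℝ := 1 + B ^ 2 + 4 * Real.exp 2 * L ^ 2 with hW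
  have hW0 : 0 < W := by positivity
  set δ : ℝ := 1 / W with hδ
  have hδ0 : 0 < δ := by positivity
  have hδW : δ * W = 1 := by rw [hδ]; field_simp
  have hδ1 : δ ≤ 1 := by
    have : 0 ≤ δ * (B ^ 2 + 4 * Real.exp 2 * L ^ 2) := by positivity
    nlinarith
  have hδB : δ * B ^ 2 ≤ 1 := by
    have : 0 ≤ δ * (1 + 4 * Real.exp 2 * L ^ 2) := by positivity
    nlinarith
  have hδL : Real.exp 2 * (δ * L ^ 2) ≤ 1 / 4 := by
    have : 0 ≤ δ * (1 + B ^ 2) := by positivity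
    nlinarith
  refine ⟨δ, hδ0, fun a f g hfg => ?_⟩
  have hab : a ≤ a + δ := by linarith
  have hexp : ∀ t ∈ Icc a (a + δ), Real.exp (2 * (t - a)) ≤ Real.exp 2 := fun t ht =>
    Real.exp_le_exp.2 (by linarith [ht.2])
  have hcz : ∀ z : C(Icc a (a + δ), H1 n),
      Continuous fun t => N (z (projIcc a (a + δ) hab t)) := fun z =>
    hL.continuous.comp (z.continuous.comp continuous_projIcc)
  choose U V HU hUa hVa using fun z : C(Icc a (a + δ), H1 n) =>
    exists_isWeakSolution β hab (hcz z) f g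
  let Φ : C(Icc a (a + δ), H1 n) → C(Icc a (a + δ), H1 n) := fun z =>
    ⟨fun t => U z t, continuousOn_iff_continuous_domRestrict.1 (HU z).cont_u⟩
  have hΦ : ∀ z t, Φ z t = U z t := fun z t => rfl
  have hmaps : MapsTo Φ (Metric.closedBall 0 R) (Metric.closedBall 0 R) := by
    intro z hz
    rw [mem_closedBall_zero_iff] at hz ⊢
    refine (ContinuousMap.norm_le _ hR0).2 fun t => ?_
    rw [hΦ]
    have h1 := (HU z).energy_le (hcz z).continuousOn t t.2
    rw [hUa, hVa] at h1
    have h2 : ∫ s in a..(t : ℝ), ‖N (z (projIcc a (a + δ) hab s))‖ ^ 2 ≤ 1 := by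
      have h3 : ∫ s in a..(t : ℝ), ‖N (z (projIcc a (a + δ) hab s))‖ ^ 2 ≤
          ∫ s in a..(t : ℝ), B ^ 2 := by
        refine intervalIntegral.integral_mono_on t.2.1
          (((hcz z).norm.pow 2).intervalIntegrable _ _) intervalIntegrable_const fun s _ => ?_
        exact pow_le_pow_left₀ (norm_nonneg _) (hNB _ ((z.norm_coe_le_norm _).trans hz)) 2
      rw [intervalIntegral.integral_const, smul_eq_mul] at h3
      have h4 : ((t : ℝ) - a) * B ^ 2 ≤ δ * B ^ 2 :=
        mul_le_mul_of_nonneg_right (by linarith [t.2.2]) (sq_nonneg _)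
      linarith
    refine le_of_sq_le_sq ?_ hR0
    rw [hRsq]
    have h5 : ‖f‖ ^ 2 + ‖g‖ ^ 2 + ∫ s in a..(t : ℝ), ‖N (z (projIcc a (a + δ) hab s))‖ ^ 2 ≤
        |M| + 1 := by linarith [le_abs_self M]
    have h6 : 0 ≤ ‖f‖ ^ 2 + ‖g‖ ^ 2 + ∫ s in a..(t : ℝ),
        ‖N (z (projIcc a (a + δ) hab s))‖ ^ 2 := by
      have := intervalIntegral.integral_nonneg (μ := volume)
        (f := fun s => ‖N (z (projIcc a (a + δ) hab s))‖ ^ 2) t.2.1 fun s _ => sq_nonneg _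
      positivity
    linarith [sq_nonneg ‖V z t‖, mul_le_mul (hexp t t.2) h5 h6 (Real.exp_nonneg 2)]
  have hlip : ∀ z ∈ Metric.closedBall 0 R, ∀ z' ∈ Metric.closedBall 0 R,
      dist (Φ z) (Φ z') ≤ 1 / 2 * dist z z' := by
    intro z hz z' hz'
    rw [mem_closedBall_zero_iff] at hz hz'
    refine (ContinuousMap.dist_le (by positivity)).2 fun t => ?_
    rw [hΦ, hΦ, dist_eq_norm, dist_eq_norm]
    have h1 := ((HU z).sub (HU z')).energy_le ((hcz z).sub (hcz z')).continuousOn t t.2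
    simp only [hUa, hVa, sub_self, norm_zero, ne_eq, OfNat.ofNat_ne_zero, not_false_eq_true,
        zero_pow, zero_add] at h1
    have h3 : ∫ s in a..(t : ℝ), ‖N (z (projIcc a (a + δ) hab s)) -
        N (z' (projIcc a (a + δ) hab s))‖ ^ 2 ≤ ∫ s in a..(t : ℝ), (L * ‖z - z'‖) ^ 2 := by
      refine intervalIntegral.integral_mono_on t.2.1
        ((((hcz z).sub (hcz z')).norm.pow 2).intervalIntegrable _ _) intervalIntegrable_const
        fun s _ => ?_
      refine pow_le_pow_left₀ (norm_nonneg _) ((hLip _ _ ((z.norm_coe_le_norm _).trans hz)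
        ((z'.norm_coe_le_norm _).trans hz')).trans ?_) 2
      exact mul_le_mul_of_nonneg_left ((z - z').norm_coe_le_norm _) hL0
    rw [intervalIntegral.integral_const, smul_eq_mul] at h3
    have h4 : ((t : ℝ) - a) * (L * ‖z - z'‖) ^ 2 ≤ δ * (L * ‖z - z'‖) ^ 2 :=
      mul_le_mul_of_nonneg_right (by linarith [t.2.2]) (sq_nonneg _)
    refine le_of_sq_le_sq ?_ (by positivity)
    have h6 := intervalIntegral.integral_nonneg (μ := volume)
        (f := fun s => ‖N (z (projIcc a (a + δ) hab s)) -
          N (z' (projIcc a (a + δ) hab s))‖ ^ 2) t.2.1 fun s _ => sq_nonneg _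
    have h7 := mul_le_mul (hexp t t.2) (h3.trans h4) h6 (Real.exp_nonneg 2)
    have h8 := mul_le_mul_of_nonneg_right hδL (sq_nonneg ‖z - z'‖)
    calc ‖U z t - U z' t‖ ^ 2 ≤ Real.exp 2 * (δ * (L * ‖z - z'‖) ^ 2) := by
          linarith [sq_nonneg ‖V z t - V z' t‖]
      _ = Real.exp 2 * (δ * L ^ 2) * ‖z - z'‖ ^ 2 := by ring
      _ ≤ 1 / 4 * ‖z - z'‖ ^ 2 := h8
      _ = (1 / 2 * ‖z - z'‖) ^ 2 := by ring
  have hcontr : ContractingWith (1 / 2) (hmaps.restrict Φ _ _) := by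
    refine ⟨by norm_num, LipschitzWith.of_dist_le_mul fun z z' => ?_⟩
    have := hlip z z.2 z' z'.2
    simpa [Subtype.dist_eq] using this
  obtain ⟨z, -, hfix, -⟩ := ContractingWith.exists_fixedPoint'
    (Metric.isClosed_closedBall (x := (0 : C(Icc a (a + δ), H1 n))) (ε := R)).isComplete hmaps
    hcontr (Metric.mem_closedBall_self hR0) (edist_ne_top _ _)
  refine ⟨U z, V z, (HU z).congr_forcing fun t ht => ?_, hUa z, hVa z⟩
  have h1 : Φ z = z := hfix
  rw [projIcc_of_mem hab ht]
  have h2 := hΦ z ⟨t, ht⟩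
  rw [h1] at h2
  rw [h2]

end LocalTheory

/-! ### The blow-up alternative -/

section BlowupAlternative

variable {n : ℕ} {β p : ℝ} {u₀ : H1 n} {u₁ : L2 n} {N : H1 n → L2 n} {u : ℝ → H1 n} {v : ℝ → L2 n}

/-- Otherwise the norm is below some M at times arbitrarily close to T. The local existence time δ
belonging to M² is fixed, so restarting less than δ before T gives a solution beyond T. -/
theorem IsMaximalMildSolution.tendsto_atTop (hN : IsPowerMap p N) (hL : IsLipschitzOnBounded N)
    {T : ℝ} (H : IsMaximalMildSolution β p u₀ u₁ (T : EReal) u v) :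
    Tendsto (fun t => ‖u t‖ + ‖v t‖) (𝓝[<] T) atTop := by
  obtain ⟨⟨hT0, hmild⟩, hmax⟩ := H
  have hT : 0 < T := by exact_mod_cast hT0
  by_contra hcon
  rw [Filter.tendsto_atTop] at hcon
  push Not at hcon
  obtain ⟨M, hM⟩ := hcon
  obtain ⟨δ, hδ, hloc⟩ := exists_local_isWeakSolution hL β (M ^ 2)
  have hev : ∀ᶠ t in 𝓝[<] T, t ∈ Ioo (max 0 (T - δ)) T :=
    Ioo_mem_nhdsLT (max_lt hT (by linarith))
  obtain ⟨t₀, hbd, ht₀⟩ := (hM.and_eventually hev).exists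
  have ht0 : 0 < t₀ := (le_max_left _ _).trans_lt ht₀.1
  have ht1 : T < t₀ + δ := by linarith [(le_max_right 0 (T - δ)).trans_lt ht₀.1]
  have cN := hL.continuous
  have W₀ : ∀ t, t₀ ≤ t → t < T → IsWeakSolution β 0 t (fun t => N (u t)) u v := fun t h1 h2 =>
    (hmild t (ht0.trans_le h1) (by exact_mod_cast h2)).isWeakSolution hN cN (ht0.trans_le h1)
  have hdata := (hmild t₀ ht0 (by exact_mod_cast ht₀.2))
  obtain ⟨u', v', W', hu', hv'⟩ := hloc t₀ (u t₀) (v t₀) (by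
    nlinarith [norm_nonneg (u t₀), norm_nonneg (v t₀)])
  -- The glued function is a competitor for maximality. That it agrees with u on all of [0,T), also
  -- after t₀, is local uniqueness.
  have G := (W₀ t₀ le_rfl ht₀.2).glue ht0.le (by linarith) W' hu'.symm hv'.symm (by rw [hu'])
  have G' := G.congr_forcing
    (h' := fun t => N ((fun t => if t ≤ t₀ then u t else u' t) t)) (fun t _ => by
      dsimp only; split_ifs <;> rfl)
  have hlt := hmax ((t₀ + δ : ℝ) : EReal) (fun t => if t ≤ t₀ then u t else u' t)
    (fun t => if t ≤ t₀ then v t else v' t)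
    ⟨by exact_mod_cast (by linarith : (0 : ℝ) < t₀ + δ), fun T' h1 h2 => by
      have h2' : T' < t₀ + δ := by exact_mod_cast h2
      have := (G'.mono (Icc_subset_Icc_right h2'.le)).isMildSolution hN cN
      simp only [if_pos ht0.le] at this
      rwa [hdata.2.2.2.1, hdata.2.2.2.2.1] at this⟩ (fun t h1 h2 => by
      have h2' : t < T := by exact_mod_cast h2
      split_ifs with h3
      · rfl
      · push Not at h3
        exact (W'.mono (Icc_subset_Icc_right (by linarith))).unique hL h3.le
          ((W₀ t h3.le h2').mono (Icc_subset_Icc_left ht0.le)) hu' hv' t ⟨h3.le, le_rfl⟩)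
  have : t₀ + δ ≤ T := by exact_mod_cast hlt
  linarith

end BlowupAlternative

/-! ### Approximation of H¹ functions by test functions -/

section Mollification

open scoped Convolution
open ContinuousLinearMap

variable {n : ℕ} {ρ f g : Eucl n → ℝ}

theorem memLp_convolution_integrand (hρ : Continuous ρ) (hc : HasCompactSupport ρ)
    (hf : MemLp f 2 volume) (x : Eucl n) :
    Integrable (fun t => ρ t * f (x - t)) volume ∧
      Integrable (fun t => ρ t * f (x - t) ^ 2) volume := by
  have h1 : MemLp (fun t => f (x - t)) 2 volume :=
    hf.comp_measurePreserving (Measure.measurePreserving_sub_left volume x)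
  have h2 : MemLp ρ 2 volume := hρ.memLp_of_hasCompactSupport hc
  obtain ⟨B, hB⟩ := hc.exists_bound_of_continuous hρ
  exact ⟨h2.integrable_mul h1, h1.integrable_sq.bdd_mul hρ.aestronglyMeasurable
    (Eventually.of_forall hB)⟩

/-- Jensen's inequality for the probability density ρ, obtained from the nonnegativity of the
variance. -/
theorem convolution_sq_le (hρ : Continuous ρ) (hc : HasCompactSupport ρ) (h0 : ∀ x, 0 ≤ ρ x)
    (h1 : ∫ x, ρ x = 1) (hf : MemLp f 2 volume) (x : Eucl n) :
    ((ρ ⋆[lsmul ℝ ℝ] f : Eucl n → ℝ) x) ^ 2 ≤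
      (ρ ⋆[lsmul ℝ ℝ] (fun y => f y ^ 2) : Eucl n → ℝ) x := by
  obtain ⟨i1, i2⟩ := memLp_convolution_integrand hρ hc hf x
  simp only [convolution_lsmul, smul_eq_mul]
  set c := ∫ t, ρ t * f (x - t) with hcdef
  have i0 : Integrable ρ volume := hρ.integrable_of_hasCompactSupport hc
  have key : 0 ≤ ∫ t, ρ t * (f (x - t) - c) ^ 2 :=
    integral_nonneg fun t => mul_nonneg (h0 t) (sq_nonneg _)
  have e : (fun t => ρ t * (f (x - t) - c) ^ 2) = fun t =>
      ρ t * f (x - t) ^ 2 - 2 * c * (ρ t * f (x - t)) + c ^ 2 * ρ t := by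
    funext t; ring
  have e2 : ∫ t, (ρ t * f (x - t) ^ 2 - 2 * c * (ρ t * f (x - t)) + c ^ 2 * ρ t) =
      (∫ t, ρ t * f (x - t) ^ 2) - 2 * c * c + c ^ 2 * 1 := by
    have h3 := integral_sub i2 (i1.const_mul (2 * c))
    have h4 := integral_add (i2.sub (i1.const_mul (2 * c))) (i0.const_mul (c ^ 2))
    simp only [Pi.sub_apply] at h4
    rw [h4, h3, integral_const_mul, integral_const_mul, h1]
  rw [e, e2] at key
  nlinarith

theorem eLpNorm_convolution_le (hρ : ContDiff ℝ ∞ ρ) (hc : HasCompactSupport ρ)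
    (h0 : ∀ x, 0 ≤ ρ x) (h1 : ∫ x, ρ x = 1) (hf : MemLp f 2 volume) :
    eLpNorm (ρ ⋆[lsmul ℝ ℝ] f : Eucl n → ℝ) 2 volume ≤ eLpNorm f 2 volume := by
  have hsq := convolution_sq_le hρ.continuous hc h0 h1 hf
  have i0 : Integrable ρ volume := hρ.continuous.integrable_of_hasCompactSupport hc
  have i1 : Integrable (fun y => f y ^ 2) volume := hf.integrable_sq
  have hconv : Integrable (ρ ⋆[lsmul ℝ ℝ] (fun y => f y ^ 2) : Eucl n → ℝ) volume :=
    i0.integrable_convolution _ i1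
  have hcont : Continuous (ρ ⋆[lsmul ℝ ℝ] f : Eucl n → ℝ) :=
    (hc.contDiff_convolution_left (n := (⊤ : ℕ∞)) _ hρ (hf.locallyIntegrable one_le_two)).continuous
  have hint : Integrable (fun x => ((ρ ⋆[lsmul ℝ ℝ] f : Eucl n → ℝ) x) ^ 2) volume :=
    hconv.mono' (hcont.pow 2).aestronglyMeasurable (Eventually.of_forall fun x => by
      rw [Real.norm_of_nonneg (sq_nonneg _)]; exact hsq x)
  have hle : ∫ x, ((ρ ⋆[lsmul ℝ ℝ] f : Eucl n → ℝ) x) ^ 2 ≤ ∫ x, f x ^ 2 := by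
    refine (integral_mono hint hconv hsq).trans_eq ?_
    rw [integral_convolution _ i0 i1, h1]
    simp
  have hw : MemLp (ρ ⋆[lsmul ℝ ℝ] f : Eucl n → ℝ) 2 volume :=
    (memLp_two_iff_integrable_sq hcont.aestronglyMeasurable).2 hint
  rw [hw.eLpNorm_eq_integral_rpow_norm two_ne_zero ENNReal.ofNat_ne_top,
    hf.eLpNorm_eq_integral_rpow_norm two_ne_zero ENNReal.ofNat_ne_top]
  refine ENNReal.ofReal_le_ofReal (Real.rpow_le_rpow (by positivity) ?_ (by positivity))
  simpa using hle

/-- The derivative falls on the mollifier, and t ↦ ρ(x - t) is a test function for the weak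
derivative; the reflection accounts for the sign. -/
theorem partialDeriv_convolution {i : Fin n} {f g : L2 n} (h : IsWeakPartial i f g)
    (hρ : ContDiff ℝ ∞ ρ) (hc : HasCompactSupport ρ) (x : Eucl n) :
    partialDeriv i (ρ ⋆[lsmul ℝ ℝ] f : Eucl n → ℝ) x = (ρ ⋆[lsmul ℝ ℝ] g : Eucl n → ℝ) x := by
  have hf : LocallyIntegrable f (volume : Measure (Eucl n)) :=
    (Lp.memLp f).locallyIntegrable one_le_two
  have hd := hc.hasFDerivAt_convolution_left (L := lsmul ℝ ℝ) (μ := volume)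
    (hρ.of_le (by simp)) hf x
  have hconv : ConvolutionExistsAt (fderiv ℝ ρ) f x ((lsmul ℝ ℝ).precompL (Eucl n)) volume :=
    (hc.fderiv ℝ).convolutionExists_left _ (hρ.continuous_fderiv (by simp)) hf x
  unfold partialDeriv
  rw [hd.fderiv, convolution_def, integral_apply hconv, ← integral_sub_left_eq_self _ volume x]
  have hφ : ContDiff ℝ ∞ fun t => ρ (x - t) := hρ.comp (contDiff_const.sub contDiff_id)
  have hφc : HasCompactSupport fun t => ρ (x - t) :=
    hc.comp_homeomorph (Homeomorph.subLeft x)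
  have hw := h _ hφ hφc
  rw [convolution_lsmul_swap]
  have e : ∀ t, partialDeriv i (fun t => ρ (x - t)) t = - partialDeriv i ρ (x - t) := by
    intro t
    have h1 : HasFDerivAt (fun t => ρ (x - t))
        ((fderiv ℝ ρ (x - t)).comp (-ContinuousLinearMap.id ℝ (Eucl n))) t :=
      ((hρ.differentiable (by simp)) (x - t)).hasFDerivAt.comp t ((hasFDerivAt_id t).const_sub x)
    unfold partialDeriv
    rw [h1.fderiv]
    simp
  simp only [e, mul_neg, integral_neg, neg_inj] at hw
  simp only [precompL_apply, sub_sub_self, lsmul_apply, smul_eq_mul]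
  refine Eq.trans (integral_congr_ae (Eventually.of_forall fun t => ?_))
    (hw.trans (integral_congr_ae (Eventually.of_forall fun t => mul_comm _ _)))
  exact mul_comm _ _

/-- The standard mollifiers. -/
noncomputable def mollifier (n k : ℕ) : ContDiffBump (0 : Eucl n) :=
  ⟨((k : ℝ) + 1)⁻¹, 2 * ((k : ℝ) + 1)⁻¹, by positivity, by
    have : 0 < ((k : ℝ) + 1)⁻¹ := by positivity
    linarith⟩

theorem norm_fderiv_le_sum (w : Eucl n → ℝ) (x : Eucl n) :
    ‖fderiv ℝ w x‖ ≤ ∑ i, ‖partialDeriv i w x‖ := by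
  refine opNorm_le_bound _ (Finset.sum_nonneg fun i _ => norm_nonneg _) fun y => ?_
  have hy : y = ∑ i, y i • (EuclideanSpace.single i 1 : Eucl n) := by
    ext j
    simp [Pi.single_apply]
  conv_lhs => rw [hy, map_sum]
  rw [Finset.sum_mul]
  refine (norm_sum_le _ _).trans (Finset.sum_le_sum fun i _ => ?_)
  rw [map_smul, norm_smul, mul_comm]
  exact mul_le_mul_of_nonneg_left (PiLp.norm_apply_le y i) (norm_nonneg _)

theorem eLpNorm_fderiv_le_sum {w : Eucl n → ℝ} (hw : ContDiff ℝ ∞ w) :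
    eLpNorm (fderiv ℝ w) 2 volume ≤ ∑ i, eLpNorm (partialDeriv i w) 2 volume := by
  have h1 : eLpNorm (fderiv ℝ w) 2 volume ≤
      eLpNorm (∑ i, fun x => ‖partialDeriv i w x‖) 2 volume := by
    refine eLpNorm_mono_real fun x => ?_
    rw [Finset.sum_apply]
    exact norm_fderiv_le_sum w x
  refine h1.trans ((eLpNorm_sum_le (fun i _ =>
    (continuous_partialDeriv i hw).norm.aestronglyMeasurable) one_le_two).trans_eq ?_)
  simp only [eLpNorm_norm]

/-- Approximation almost everywhere by test functions which are bounded in `H¹`. -/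
theorem H1.exists_testFunction_approx (f : H1 n) :
    ∃ (w : ℕ → Eucl n → ℝ) (M : NNReal), (∀ k, ContDiff ℝ ∞ (w k)) ∧
      (∀ k, HasCompactSupport (w k)) ∧ (∀ k, eLpNorm (w k) 2 volume ≤ M) ∧
      (∀ k, eLpNorm (fderiv ℝ (w k)) 2 volume ≤ M) ∧
      ∀ᵐ x, Tendsto (fun k => w k x) atTop (𝓝 (f.toL2 x)) := by
  choose B hB0 hB using fun i => exists_bound_partialDeriv_dilatedCutoff (n := n) i
  set F : ℕ → L2 n → Eucl n → ℝ := fun k g => (mollifier n k).normed volume ⋆[lsmul ℝ ℝ] g with hF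
  have hρ : ∀ k, ContDiff ℝ ∞ ((mollifier n k).normed volume) := fun k =>
    (mollifier n k).contDiff_normed
  have hc : ∀ k, HasCompactSupport ((mollifier n k).normed volume) := fun k =>
    (mollifier n k).hasCompactSupport_normed
  have hFs : ∀ k (g : L2 n), ContDiff ℝ ∞ (F k g) := fun k g =>
    (hc k).contDiff_convolution_left (n := (⊤ : ℕ∞)) _ (hρ k) ((Lp.memLp g).locallyIntegrable one_le_two)
  have hFn : ∀ k (g : L2 n), eLpNorm (F k g) 2 volume ≤ eLpNorm g 2 volume := fun k g =>
    eLpNorm_convolution_le (hρ k) (hc k) (mollifier n k).nonneg_normed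
      (mollifier n k).integral_normed (Lp.memLp g)
  have hFd : ∀ k i, partialDeriv i (F k f.toL2) = F k (f.partial i) := fun k i => by
    funext x
    exact partialDeriv_convolution (H1.isWeakPartial f i) (hρ k) (hc k) x
  -- Mollification does not increase L² norms and commutes with ∂ᵢ; the extra terms with B come from
  -- derivatives of the cutoff in the Leibniz rule.
  set M : ℝ≥0∞ := eLpNorm f.toL2 2 volume +
    ∑ i, (eLpNorm (f.partial i) 2 volume + ENNReal.ofReal (B i) * eLpNorm f.toL2 2 volume) with hM
  have hMt : M ≠ ⊤ := by
    refine ENNReal.add_ne_top.2 ⟨Lp.eLpNorm_ne_top _, ENNReal.sum_ne_top.2 fun i _ =>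
      ENNReal.add_ne_top.2 ⟨Lp.eLpNorm_ne_top _, ENNReal.mul_ne_top ENNReal.ofReal_ne_top
        (Lp.eLpNorm_ne_top _)⟩⟩
  have hws : ∀ k, ContDiff ℝ ∞ (fun x => dilatedCutoff n k x * F k f.toL2 x) := fun k =>
    (contDiff_dilatedCutoff k).mul (hFs k _)
  refine ⟨fun k x => dilatedCutoff n k x * F k f.toL2 x, M.toNNReal, hws,
    fun k => (hasCompactSupport_dilatedCutoff k).mul_right, fun k => ?_, fun k => ?_, ?_⟩
  · rw [ENNReal.coe_toNNReal hMt]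
    refine le_trans (eLpNorm_mono fun x => ?_) ((hFn k f.toL2).trans le_self_add)
    rw [norm_mul]
    exact mul_le_of_le_one_left (norm_nonneg _) (abs_dilatedCutoff_le k x)
  · rw [ENNReal.coe_toNNReal hMt]
    refine (eLpNorm_fderiv_le_sum (hws k)).trans (le_trans (Finset.sum_le_sum fun i _ => ?_)
      le_add_self)
    have e : partialDeriv i (fun x => dilatedCutoff n k x * F k f.toL2 x) =
        (fun x => dilatedCutoff n k x * F k (f.partial i) x) +
          fun x => partialDeriv i (dilatedCutoff n k) x * F k f.toL2 x := by
      funext x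
      rw [partialDeriv_mul i ((contDiff_dilatedCutoff k).differentiable (by simp) x)
        ((hFs k _).differentiable (by simp) x), hFd]
      rfl
    have c1 := (contDiff_dilatedCutoff (n := n) k).continuous
    have c2 := continuous_partialDeriv i (contDiff_dilatedCutoff (n := n) k)
    rw [e]
    refine (eLpNorm_add_le (c1.mul (hFs k _).continuous).aestronglyMeasurable
      (c2.mul (hFs k _).continuous).aestronglyMeasurable one_le_two).trans (add_le_add ?_ ?_)
    · refine le_trans (eLpNorm_mono fun x => ?_) (hFn k (f.partial i))
      rw [Pi.mul_apply, norm_mul]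
      exact mul_le_of_le_one_left (norm_nonneg _) (abs_dilatedCutoff_le k x)
    · refine le_trans (eLpNorm_le_mul_eLpNorm_of_ae_le_mul (c := B i) (g := F k f.toL2)
        (Eventually.of_forall fun x => ?_) 2) (mul_le_mul_right (hFn k _) _)
      rw [Pi.mul_apply, norm_mul]
      refine mul_le_mul_of_nonneg_right ?_ (norm_nonneg _)
      refine (hB i k x).trans (mul_le_of_le_one_left (hB0 i) (inv_le_one_of_one_le₀ ?_))
      linarith [k.cast_nonneg (α := ℝ)]
  · have hlim := ContDiffBump.ae_convolution_tendsto_right_of_locallyIntegrable (μ := volume)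
      (φ := mollifier n) (l := atTop) (K := 2) (g := f.toL2)
      (by
        have : Tendsto (fun k : ℕ => 2 * ((k : ℝ) + 1)⁻¹) atTop (𝓝 (2 * 0)) :=
          tendsto_inv_succ.const_mul 2
        rw [mul_zero] at this
        exact this)
      (Eventually.of_forall fun k => le_rfl) ((Lp.memLp f.toL2).locallyIntegrable one_le_two)
    filter_upwards [hlim] with x hx
    simpa using (tendsto_dilatedCutoff x).mul hx

/-- Fatou's lemma along the approximating test functions: an a priori inequality for test functions
becomes an embedding of H¹ without any convergence in L^q. -/
theorem H1.memLp_of_bound (f : H1 n) {q : ℝ≥0∞} (h : ∀ M : NNReal, ∃ C : ℝ≥0∞, C ≠ ⊤ ∧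
    ∀ w : Eucl n → ℝ, ContDiff ℝ ∞ w → HasCompactSupport w → eLpNorm w 2 volume ≤ M →
      eLpNorm (fderiv ℝ w) 2 volume ≤ M → eLpNorm w q volume ≤ C) :
    MemLp f.toL2 q volume := by
  obtain ⟨w, M, hw, hc, h0, h1, hlim⟩ := H1.exists_testFunction_approx f
  obtain ⟨C, hC, hb⟩ := h M
  refine ⟨(Lp.memLp _).1, lt_of_le_of_lt (Lp.eLpNorm_lim_le_liminf_eLpNorm
    (fun k => (hw k).continuous.aestronglyMeasurable) _ hlim) ?_⟩
  refine lt_of_le_of_lt (liminf_le_of_frequently_le' (Frequently.of_forall fun k =>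
    hb (w k) (hw k) (hc k) (h0 k) (h1 k))) hC.lt_top

end Mollification

/-! ### Sobolev embeddings of H¹ -/

section Sobolev

variable {n : ℕ}

theorem eLpNorm_smul_fderiv_le {w a : Eucl n → ℝ} (ha : Continuous a) (hw : ContDiff ℝ ∞ w) :
    eLpNorm (fun x => a x • fderiv ℝ w x) 1 volume ≤
      eLpNorm a 2 volume * eLpNorm (fderiv ℝ w) 2 volume := by
  have h := eLpNorm_smul_le_mul_eLpNorm (p := 2) (q := 2) (r := 1) (μ := (volume : Measure (Eucl n)))
    (f := fun x => ‖fderiv ℝ w x‖) (φ := a)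
    (hw.continuous_fderiv (by simp)).norm.aestronglyMeasurable ha.aestronglyMeasurable
  rw [eLpNorm_norm (fderiv ℝ w)] at h
  refine (eLpNorm_mono fun x => ?_).trans h
  rw [Pi.smul_apply', norm_smul, norm_smul, norm_norm]

theorem fderiv_pow_eq_smul {w : Eucl n → ℝ} (hw : ContDiff ℝ ∞ w) (k : ℕ) :
    fderiv ℝ (fun x => w x ^ k) = fun x => (k * w x ^ (k - 1)) • fderiv ℝ w x := by
  funext x
  rw [((hw.differentiable (by simp) x).hasFDerivAt.pow k).fderiv]
  simp [nsmul_eq_mul]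

/-- Sobolev embedding in dimension `n ≥ 3`. -/
theorem H1.memLp_of_three_le (hn : 3 ≤ n) (f : H1 n) :
    MemLp f.toL2 (ENNReal.ofReal (2 * n / (n - 2))) volume := by
  have hn' : (3 : ℝ) ≤ n := by exact_mod_cast hn
  have h2 : (0 : ℝ) < n - 2 := by linarith
  refine f.memLp_of_bound fun M => ⟨SNormLESNormFDerivOfEqConst ℝ (volume : Measure (Eucl n)) 2 * M,
    by finiteness, fun w hw hc _ h1 => ?_⟩
  have := eLpNorm_le_eLpNorm_fderiv_of_eq (F := ℝ) (volume : Measure (Eucl n)) (u := w)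
    (hw.of_le (by simp)) hc (p := 2) (p' := (2 * n / (n - 2) : ℝ).toNNReal) one_le_two
    (by simp; omega) (by
      rw [Real.coe_toNNReal _ (by positivity)]
      simp only [finrank_euclideanSpace, Fintype.card_fin]
      push_cast
      field_simp)
  exact this.trans (mul_le_mul_right (by exact_mod_cast h1) _)

/-- The planar inequality ‖f‖₂ ≤ K‖∇f‖₁ applied to a power of w, with Cauchy-Schwarz on the
resulting gradient. Used for squares and then cubes, it reaches ‖w‖₆³ = ‖w³‖₂. -/
theorem eLpNorm_pow_le {w : Eucl 2 → ℝ} (hw : ContDiff ℝ ∞ w) (hc : HasCompactSupport w) (k : ℕ) :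
    eLpNorm (fun x => w x ^ (k + 1)) 2 volume ≤
      eLpNormLESNormFDerivOneConst (volume : Measure (Eucl 2)) 2 *
        (‖(k + 1 : ℝ)‖ₑ * eLpNorm (fun x => w x ^ k) 2 volume * eLpNorm (fderiv ℝ w) 2 volume) := by
  have h := eLpNorm_le_eLpNorm_fderiv_one (volume : Measure (Eucl 2))
    (u := fun x => w x ^ (k + 1)) ((hw.pow _).of_le (by simp))
    (hc.comp_left (g := fun y : ℝ => y ^ (k + 1)) (by simp)) (p := 2)
    (by
      rw [finrank_euclideanSpace, Fintype.card_fin]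
      exact NNReal.HolderConjugate.two_two)
  refine h.trans (mul_le_mul_right ?_ _)
  rw [fderiv_pow_eq_smul hw]
  refine (eLpNorm_smul_fderiv_le (by have := hw.continuous; fun_prop) hw).trans_eq ?_
  congr 1
  have := eLpNorm_const_smul (c := (k + 1 : ℝ)) (f := fun x => w x ^ k) (p := 2)
    (μ := (volume : Measure (Eucl 2)))
  simpa [Pi.smul_def] using this

/-- Sobolev embedding in dimension `n = 2`. -/
theorem H1.memLp_six (f : H1 2) : MemLp f.toL2 6 volume := by
  set K : ℝ≥0∞ := ENNReal.ofNNReal (eLpNormLESNormFDerivOneConst (volume : Measure (Eucl 2)) 2) with hK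
  refine f.memLp_of_bound fun M => ⟨(K * (‖(2 : ℝ) + 1‖ₑ * (K * (‖(1 : ℝ) + 1‖ₑ * M * M)) * M)) ^
    (3⁻¹ : ℝ), ?_, fun w hw hc h0 h1 => ?_⟩
  · have : K ≠ ⊤ := ENNReal.coe_ne_top
    finiteness
  have e1 := eLpNorm_pow_le hw hc 1
  have e2 := eLpNorm_pow_le hw hc 2
  simp only [pow_one] at e1
  norm_num only at e1 e2
  have e3 : eLpNorm w 6 volume ^ (3 : ℝ) = eLpNorm (fun x => w x ^ 3) 2 volume := by
    have := eLpNorm_norm_rpow (p := 2) (μ := (volume : Measure (Eucl 2))) w (q := 3) (by norm_num)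
    have e : (2 : ℝ≥0∞) * ENNReal.ofReal 3 = 6 := by
      rw [ENNReal.ofReal_ofNat]; norm_num
    rw [e] at this
    rw [← this, ← eLpNorm_norm (fun x => w x ^ 3)]
    congr 1
    funext x
    rw [norm_pow]
    norm_cast
  rw [ENNReal.le_rpow_inv_iff (by norm_num), e3]
  refine e2.trans ?_
  norm_num only [Nat.cast_ofNat]
  gcongr
  refine e1.trans ?_
  gcongr

/-- Sobolev embedding in dimension `n = 1`. -/
theorem H1.memLp_top (f : H1 1) : MemLp f.toL2 ⊤ volume := by
  refine f.memLp_of_bound fun M => ⟨(‖(2 : ℝ)‖ₑ * M * M) ^ (2⁻¹ : ℝ), by finiteness,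
    fun w hw hc h0 h1 => ?_⟩
  rw [eLpNorm_exponent_top]
  refine eLpNormEssSup_le_of_ae_enorm_bound (Eventually.of_forall fun x => ?_)
  rw [ENNReal.le_rpow_inv_iff (by norm_num)]
  set e : ℝ ≃ₗᵢ[ℝ] Eucl 1 := (OrthonormalBasis.singleton (Fin 1) ℝ).repr with he
  have hsq : ContDiff ℝ ∞ fun y => w y ^ 2 := hw.pow 2
  have hγ : ContDiff ℝ 1 fun t => w (e t) ^ 2 :=
    (hsq.comp e.toContinuousLinearEquiv.contDiff).of_le (by simp)
  have hγc : HasCompactSupport fun t => w (e t) ^ 2 :=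
    (hc.comp_homeomorph e.toHomeomorph).comp_left (g := fun y : ℝ => y ^ 2) (by simp)
  have hd : ∀ t, ‖deriv (fun t => w (e t) ^ 2) t‖ₑ ≤ ‖fderiv ℝ (fun y => w y ^ 2) (e t)‖ₑ := by
    intro t
    have h1 : HasFDerivAt (fun y => w y ^ 2) (fderiv ℝ (fun y => w y ^ 2) (e t)) (e t) :=
      (hsq.differentiable (by simp) (e t)).hasFDerivAt
    have h2 := (h1.comp t e.toContinuousLinearEquiv.hasFDerivAt).hasDerivAt
    have h3 : deriv (fun t => w (e t) ^ 2) t = fderiv ℝ (fun y => w y ^ 2) (e t) (e 1) := h2.deriv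
    rw [h3]
    refine enorm_le_iff_norm_le.2 ((ContinuousLinearMap.le_opNorm _ _).trans_eq ?_)
    rw [e.norm_map, norm_one, mul_one]
  -- On the line w(x)² is the integral of (w²)' = 2ww' over a half-line, which Cauchy-Schwarz later
  -- controls.
  have key : ‖w x ^ 2‖ₑ ≤ eLpNorm (fderiv ℝ fun y => w y ^ 2) 1 volume := by
    have h1 := HasCompactSupport.integral_Iic_deriv_eq hγ hγc (e.symm x)
    rw [e.apply_symm_apply] at h1
    rw [← h1, eLpNorm_one_eq_lintegral_enorm,
      ← e.measurePreserving.lintegral_comp_emb e.toHomeomorph.measurableEmbedding]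
    refine (enorm_integral_le_lintegral_enorm _).trans ((setLIntegral_le_lintegral _ _).trans ?_)
    exact lintegral_mono hd
  have e1 : ‖w x‖ₑ ^ (2 : ℝ) = ‖w x ^ 2‖ₑ := by
    rw [enorm_pow]; norm_cast
  rw [e1]
  refine key.trans ?_
  rw [fderiv_pow_eq_smul hw]
  refine (eLpNorm_smul_fderiv_le (by have := hw.continuous; fun_prop) hw).trans ?_
  have := eLpNorm_const_smul (c := (2 : ℝ)) (f := w) (p := 2)
    (μ := (volume : Measure (Eucl 1)))
  have e2 : eLpNorm (fun x => ((2 : ℕ) : ℝ) * w x ^ (2 - 1)) 2 volume =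
      ‖(2 : ℝ)‖ₑ * eLpNorm w 2 volume := by
    simpa [Pi.smul_def] using this
  rw [e2]
  gcongr

/-- Pointwise |f|^r ≤ |f|² + |f|^q, according to whether |f| is below or above 1. -/
theorem MeasureTheory.MemLp.rpow_of_between {f : Eucl n → ℝ} {r q : ℝ} (hf : MemLp f 2 volume)
    (hq : MemLp f (ENNReal.ofReal q) volume) (h2 : 2 ≤ r) (hrq : r ≤ q) :
    MemLp f (ENNReal.ofReal r) volume := by
  have hr0 : 0 < r := by linarith
  have hq0 : 0 < q := by linarith
  rw [← integrable_norm_rpow_iff hf.1 (by simpa using hr0) ENNReal.ofReal_ne_top,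
    ENNReal.toReal_ofReal hr0.le]
  have i1 := hf.integrable_norm_rpow two_ne_zero ENNReal.ofNat_ne_top
  have i2 := hq.integrable_norm_rpow (by simpa using hq0) ENNReal.ofReal_ne_top
  rw [ENNReal.toReal_ofReal hq0.le] at i2
  simp only [ENNReal.toReal_ofNat] at i1
  refine (i1.add i2).mono' (by
    have := hf.1.norm.aemeasurable
    exact (this.pow_const r).aestronglyMeasurable) (Eventually.of_forall fun x => ?_)
  rw [Real.norm_of_nonneg (by positivity), Pi.add_apply]
  have h0 := norm_nonneg (f x)
  rcases le_total ‖f x‖ 1 with h | h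
  · rcases h0.eq_or_lt with h3 | h3
    · rw [← h3, Real.zero_rpow hr0.ne']; positivity
    · exact (Real.rpow_le_rpow_of_exponent_ge h3 h h2).trans (le_add_of_nonneg_right (by positivity))
  · exact (Real.rpow_le_rpow_of_exponent_le h hrq).trans (le_add_of_nonneg_left (by positivity))

theorem MeasureTheory.MemLp.rpow_of_top {f : Eucl n → ℝ} {r : ℝ} (hf : MemLp f 2 volume)
    (hq : MemLp f ⊤ volume) (h2 : 2 ≤ r) : MemLp f (ENNReal.ofReal r) volume := by
  have hr0 : 0 < r := by linarith
  rw [← integrable_norm_rpow_iff hf.1 (by simpa using hr0) ENNReal.ofReal_ne_top,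
    ENNReal.toReal_ofReal hr0.le]
  have i1 := hf.integrable_norm_rpow two_ne_zero ENNReal.ofNat_ne_top
  simp only [ENNReal.toReal_ofNat] at i1
  obtain ⟨C, hC⟩ : ∃ C, ∀ᵐ x, ‖f x‖ ≤ C := by
    have := hq.2
    rw [eLpNorm_exponent_top] at this
    refine ⟨(eLpNormEssSup f volume).toReal, ?_⟩
    filter_upwards [enorm_ae_le_eLpNormEssSup f volume] with x hx
    rw [← toReal_enorm]
    exact ENNReal.toReal_mono this.ne hx
  refine (i1.const_mul (C ^ (r - 2))).mono' (by
    have := hf.1.norm.aemeasurable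
    exact (this.pow_const r).aestronglyMeasurable) ?_
  filter_upwards [hC] with x hx
  rw [Real.norm_of_nonneg (by positivity)]
  have h0 := norm_nonneg (f x)
  rcases h0.eq_or_lt with h3 | h3
  · rw [← h3, Real.zero_rpow hr0.ne', Real.zero_rpow two_ne_zero, mul_zero]
  · have : ‖f x‖ ^ r = ‖f x‖ ^ (r - 2) * ‖f x‖ ^ (2 : ℝ) := by
      rw [← Real.rpow_add h3]; ring_nf
    rw [this]
    exact mul_le_mul_of_nonneg_right (Real.rpow_le_rpow h0 hx (by linarith)) (by positivity)

/-- The condition on p gives 2p ≤ 6 if n = 2, and 2p ≤ 2n/(n-2) if n ≥ 3, because (n+1)(n-2) ≤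
n(n-1). -/
theorem H1.memLp {p : ℝ} (hn : 1 ≤ n) (hp : 1 < p) (hpn : p * (n - 1) ≤ n + 1) (f : H1 n) :
    MemLp f.toL2 (ENNReal.ofReal (2 * p)) volume := by
  have h2 : MemLp f.toL2 2 volume := Lp.memLp _
  obtain rfl | rfl | hn3 : n = 1 ∨ n = 2 ∨ 3 ≤ n := by omega
  · exact h2.rpow_of_top f.memLp_top (by linarith)
  · refine h2.rpow_of_between (q := 6) (by simpa using f.memLp_six) (by linarith) ?_
    norm_num at hpn
    linarith
  · refine h2.rpow_of_between (f.memLp_of_three_le hn3) (by linarith) ?_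
    have hn' : (3 : ℝ) ≤ n := by exact_mod_cast hn3
    rw [le_div_iff₀ (by linarith)]
    nlinarith

end Sobolev

/-! ### The nonlinearity as a locally Lipschitz map from H¹ to L² -/

/-- For 0 ≤ y ≤ x with x > 0, Bernoulli's inequality (y/x)^p ≥ 1 + p(y/x - 1) replaces the mean
value theorem. -/
theorem abs_rpow_sub_rpow_le {p : ℝ} (hp : 1 < p) (a b : ℝ) :
    ‖|a| ^ p - |b| ^ p‖ ≤ p * (‖a - b‖ * ‖(|a| + |b|) ^ (p - 1)‖) := by
  have key : ∀ x y : ℝ, 0 ≤ y → y ≤ x → x ^ p - y ^ p ≤ p * ((x - y) * (x + y) ^ (p - 1)) := by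
    intro x y hy hxy
    rcases (hy.trans hxy).eq_or_lt with h0 | h0
    · have : y = 0 := le_antisymm (hxy.trans h0.ge) hy
      simp [← h0, this]
    · have h1 := one_add_mul_self_le_rpow_one_add (s := y / x - 1)
        (by linarith [div_nonneg hy h0.le]) hp.le
      rw [add_sub_cancel, Real.div_rpow hy h0.le, le_div_iff₀ (by positivity)] at h1
      have h2 : x ^ p = x ^ (p - 1) * x := by
        rw [← Real.rpow_add_one h0.ne', sub_add_cancel]
      have h3 : x ^ p - y ^ p ≤ p * ((x - y) * x ^ (p - 1)) := by
        have : (1 + p * (y / x - 1)) * x ^ p = x ^ p - p * ((x - y) * x ^ (p - 1)) := by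
          rw [h2]; field_simp; ring
        linarith
      refine h3.trans ?_
      have := Real.rpow_le_rpow h0.le (by linarith : x ≤ x + y) (by linarith : 0 ≤ p - 1)
      gcongr
  have hsum : 0 ≤ (|a| + |b|) ^ (p - 1) := by positivity
  rw [Real.norm_of_nonneg hsum]
  rcases le_total |b| |a| with h | h
  · rw [Real.norm_of_nonneg (sub_nonneg.2 (Real.rpow_le_rpow (abs_nonneg _) h (by linarith)))]
    refine (key _ _ (abs_nonneg _) h).trans ?_
    gcongr
    exact abs_sub_abs_le_abs_sub a b
  · rw [norm_sub_rev, norm_sub_rev a b,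
      Real.norm_of_nonneg (sub_nonneg.2 (Real.rpow_le_rpow (abs_nonneg _) h (by linarith)))]
    refine (key _ _ (abs_nonneg _) h).trans ?_
    rw [add_comm |b| |a|]
    gcongr
    exact abs_sub_abs_le_abs_sub b a

section Nemytskii

variable {n : ℕ}

/-- A linear embedding of `H¹` into `L^q` is bounded. -/
theorem H1.exists_eLpNorm_le {q : ℝ≥0∞} (hq : 1 ≤ q) (h : ∀ f : H1 n, MemLp f.toL2 q volume) :
    ∃ K : ℝ, 0 ≤ K ∧ ∀ f : H1 n, eLpNorm f.toL2 q volume ≤ ENNReal.ofReal (K * ‖f‖) := by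
  have : Fact (1 ≤ q) := ⟨hq⟩
  let Λ : H1 n →ₗ[ℝ] Lp ℝ q (volume : Measure (Eucl n)) :=
    { toFun := fun f => (h f).toLp _
      map_add' := fun f g => by
        rw [← MemLp.toLp_add (h f) (h g), MemLp.toLp_eq_toLp_iff]
        exact Lp.coeFn_add f.toL2 g.toL2
      map_smul' := fun c f => by
        rw [RingHom.id_apply, ← MemLp.toLp_const_smul c (h f), MemLp.toLp_eq_toLp_iff]
        exact Lp.coeFn_smul c f.toL2 }
  -- Closed graph theorem: convergence in L² and in L^q both imply convergence in measure, so the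
  -- two limits agree almost everywhere.
  have hclosed : ∀ (u : ℕ → H1 n) (x : H1 n) (y : Lp ℝ q (volume : Measure (Eucl n))),
      Tendsto u atTop (𝓝 x) → Tendsto (Λ ∘ u) atTop (𝓝 y) → y = Λ x := by
    intro u x y hu hy
    have m1 : TendstoInMeasure volume (fun k => ⇑(u k).toL2) atTop x.toL2 :=
      tendstoInMeasure_of_tendsto_Lp ((H1.continuous_toL2.tendsto x).comp hu)
    have m2 : TendstoInMeasure volume (fun k => ⇑(Λ (u k))) atTop y :=
      tendstoInMeasure_of_tendsto_Lp hy
    have m3 : TendstoInMeasure volume (fun k => ⇑(u k).toL2) atTop y :=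
      m2.congr_left fun k => (h (u k)).coeFn_toLp
    exact Lp.ext ((tendstoInMeasure_ae_unique m3 m1).trans (h x).coeFn_toLp.symm)
  let Λ' := ContinuousLinearMap.ofSeqClosedGraph hclosed
  refine ⟨‖Λ'‖, norm_nonneg _, fun f => ?_⟩
  have h1 : ‖(h f).toLp _‖ ≤ ‖Λ'‖ * ‖f‖ := Λ'.le_opNorm f
  rw [Lp.norm_toLp] at h1
  rw [← ENNReal.ofReal_toReal (h f).eLpNorm_ne_top]
  exact ENNReal.ofReal_le_ofReal h1

theorem memLp_abs_rpow {p : ℝ} (hp : 1 < p) {f : Eucl n → ℝ}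
    (hf : MemLp f (ENNReal.ofReal (2 * p)) volume) : MemLp (fun x => |f x| ^ p) 2 volume := by
  have hm := hf.1.norm.aemeasurable
  refine ⟨(hm.pow_const p).aestronglyMeasurable, ?_⟩
  have h := eLpNorm_norm_rpow (p := 2) (μ := (volume : Measure (Eucl n))) f (q := p) (by linarith)
  rw [ENNReal.ofReal_mul zero_le_two, ENNReal.ofReal_ofNat] at hf
  have h2 := hf.2
  simp only [Real.norm_eq_abs] at h
  rw [h]
  exact ENNReal.rpow_lt_top_of_nonneg (by linarith) h2.ne

/-- Hölder with 1/2 = 1/(2p) + (p-1)/(2p), applied to the pointwise difference bound. -/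
theorem eLpNorm_abs_rpow_sub_le {p : ℝ} (hp : 1 < p) {f g : Eucl n → ℝ}
    (hf : MemLp f (ENNReal.ofReal (2 * p)) volume) (hg : MemLp g (ENNReal.ofReal (2 * p)) volume) :
    eLpNorm (fun x => |f x| ^ p - |g x| ^ p) 2 volume ≤
      ENNReal.ofReal p * (eLpNorm (f - g) (ENNReal.ofReal (2 * p)) volume *
        (eLpNorm f (ENNReal.ofReal (2 * p)) volume +
          eLpNorm g (ENNReal.ofReal (2 * p)) volume) ^ (p - 1)) := by
  have hp1 : 0 < p - 1 := by linarith
  have hmf := hf.1.norm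
  have hmg := hg.1.norm
  have hm : AEStronglyMeasurable (fun x => (|f x| + |g x|) ^ (p - 1)) volume :=
    ((hmf.add hmg).aemeasurable.pow_const (p - 1)).aestronglyMeasurable
  have hH : ENNReal.HolderTriple (ENNReal.ofReal (2 * p)) (ENNReal.ofReal (2 * p / (p - 1))) 2 := by
    refine ⟨?_⟩
    rw [← ENNReal.ofReal_inv_of_pos (by positivity), ← ENNReal.ofReal_inv_of_pos (by positivity),
      ← ENNReal.ofReal_add (by positivity) (by positivity), ← ENNReal.ofReal_ofNat 2,
      ← ENNReal.ofReal_inv_of_pos (by positivity)]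
    congr 1
    field_simp
    ring
  have h1 := eLpNorm_smul_le_mul_eLpNorm (p := ENNReal.ofReal (2 * p))
    (q := ENNReal.ofReal (2 * p / (p - 1))) (r := 2) hm (hf.1.sub hg.1)
  have h2 := eLpNorm_norm_rpow (p := ENNReal.ofReal (2 * p / (p - 1)))
    (μ := (volume : Measure (Eucl n))) (fun x => |f x| + |g x|) hp1
  have e1 : ENNReal.ofReal (2 * p / (p - 1)) * ENNReal.ofReal (p - 1) = ENNReal.ofReal (2 * p) := by
    rw [← ENNReal.ofReal_mul (by positivity), div_mul_cancel₀ _ hp1.ne']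
  have e2 : (fun x => ‖|f x| + |g x|‖ ^ (p - 1)) = fun x => (|f x| + |g x|) ^ (p - 1) := by
    funext x
    rw [Real.norm_of_nonneg (by positivity)]
  rw [e1, e2] at h2
  have h3 : eLpNorm (fun x => |f x| + |g x|) (ENNReal.ofReal (2 * p)) volume ≤
      eLpNorm f (ENNReal.ofReal (2 * p)) volume + eLpNorm g (ENNReal.ofReal (2 * p)) volume := by
    refine (eLpNorm_add_le hmf hmg ?_).trans_eq ?_
    · rw [← ENNReal.ofReal_one]
      exact ENNReal.ofReal_le_ofReal (by linarith)
    · rw [eLpNorm_norm, eLpNorm_norm]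
  refine (eLpNorm_le_mul_eLpNorm_of_ae_le_mul (c := p)
    (Eventually.of_forall fun x => ?_) 2).trans (mul_le_mul_right (h1.trans
      (mul_le_mul_right (h2.trans_le (ENNReal.rpow_le_rpow h3 hp1.le)) _)) _)
  rw [Pi.smul_apply', norm_smul]
  exact abs_rpow_sub_rpow_le hp _ _

theorem exists_isPowerMap {p : ℝ} (hn : 1 ≤ n) (hp : 1 < p) (hpn : p * (n - 1) ≤ n + 1) :
    ∃ N : H1 n → L2 n, IsPowerMap p N ∧ IsLipschitzOnBounded N := by
  have hmem := fun f : H1 n => f.memLp hn hp hpn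
  obtain ⟨K, hK0, hK⟩ := H1.exists_eLpNorm_le (n := n) (by
    rw [← ENNReal.ofReal_one]
    exact ENNReal.ofReal_le_ofReal (by linarith)) hmem
  have hpow : IsPowerMap p fun f : H1 n => (memLp_abs_rpow hp (hmem f)).toLp _ := fun f =>
    (memLp_abs_rpow hp (hmem f)).coeFn_toLp
  refine ⟨_, hpow, fun R => ⟨p * (K * (K * |R| + K * |R|) ^ (p - 1)), by positivity,
    fun f g hf hg => ?_⟩⟩
  have h1 := eLpNorm_abs_rpow_sub_le hp (hmem f) (hmem g)
  have h2 : eLpNorm (⇑f.toL2 - ⇑g.toL2) (ENNReal.ofReal (2 * p)) volume ≤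
      ENNReal.ofReal (K * ‖f - g‖) := by
    refine le_trans (le_of_eq (eLpNorm_congr_ae ?_)) (hK (f - g))
    exact (Lp.coeFn_sub f.toL2 g.toL2).symm
  have hb : ∀ f : H1 n, ‖f‖ ≤ R →
      eLpNorm f.toL2 (ENNReal.ofReal (2 * p)) volume ≤ ENNReal.ofReal (K * |R|) := fun f hf =>
    (hK f).trans (ENNReal.ofReal_le_ofReal (by
      have := hf.trans (le_abs_self R)
      gcongr))
  have h3 : eLpNorm (fun x => |f.toL2 x| ^ p - |g.toL2 x| ^ p) 2 volume ≤
      ENNReal.ofReal (p * (K * (K * |R| + K * |R|) ^ (p - 1)) * ‖f - g‖) := by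
    refine h1.trans ((mul_le_mul_right (mul_le_mul' h2 (ENNReal.rpow_le_rpow
      (add_le_add (hb f hf) (hb g hg)) (by linarith))) _).trans_eq ?_)
    rw [← ENNReal.ofReal_add (by positivity) (by positivity),
      ENNReal.ofReal_rpow_of_nonneg (by positivity) (by linarith),
      ← ENNReal.ofReal_mul (by positivity), ← ENNReal.ofReal_mul (by linarith)]
    congr 1
    ring
  rw [← MemLp.toLp_sub, Lp.norm_toLp]
  exact ENNReal.toReal_le_of_le_ofReal (by positivity) h3

end Nemytskii

/-! ### The weak formulation against test functions -/

section Pairing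

variable {n : ℕ}

/-- The Laplacian of a smooth function. -/
noncomputable def laplacianFun (ψ : Eucl n → ℝ) (x : Eucl n) : ℝ :=
  ∑ i, partialDeriv i (partialDeriv i ψ) x

theorem contDiff_laplacianFun {ψ : Eucl n → ℝ} (hψ : ContDiff ℝ ∞ ψ) :
    ContDiff ℝ ∞ (laplacianFun ψ) :=
  ContDiff.sum fun i _ => contDiff_partialDeriv i (contDiff_partialDeriv i hψ)

theorem hasCompactSupport_laplacianFun {ψ : Eucl n → ℝ} (hc : HasCompactSupport ψ) :
    HasCompactSupport (laplacianFun ψ) := by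
  refine hc.of_isClosed_subset (isClosed_tsupport _) (closure_minimal (fun x hx => ?_)
    (isClosed_tsupport _))
  by_contra h
  refine hx (Finset.sum_eq_zero fun i _ => ?_)
  have h0 : ψ =ᶠ[𝓝 x] 0 := notMem_tsupport_iff_eventuallyEq.1 h
  have h1 : partialDeriv i ψ =ᶠ[𝓝 x] 0 := by
    filter_upwards [h0.eventuallyEq_nhds] with y hy
    simp [partialDeriv, hy.fderiv_eq]
  simp [partialDeriv, h1.fderiv_eq]

/-- A test function as an element of `L²`. -/
noncomputable def testL2 {ψ : Eucl n → ℝ} (hψ : ContDiff ℝ ∞ ψ) (hc : HasCompactSupport ψ) : L2 n :=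
  (memLp_testFunction hψ hc).toLp ψ

theorem inner_testL2 {ψ : Eucl n → ℝ} (hψ : ContDiff ℝ ∞ ψ) (hc : HasCompactSupport ψ) (f : L2 n) :
    inner ℝ f (testL2 hψ hc) = ∫ x, f x * ψ x := by
  rw [real_inner_comm]
  exact (L2.integral_mul_eq_inner f _).symm

theorem isWeakPartial_testFunction {φ : Eucl n → ℝ} (hφ : ContDiff ℝ ∞ φ)
    (hc : HasCompactSupport φ) (i : Fin n) :
    IsWeakPartial i (testL2 hφ hc)
      (testL2 (contDiff_partialDeriv i hφ) (hasCompactSupport_partialDeriv i hc)) :=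
  isWeakPartial_toLp hφ hc i

/-- Supplies the hypothesis under which the next two results treat D as the Laplacian of Ψ. -/
theorem freqProj_testL2_laplacian {ψ : Eucl n → ℝ} (hψ : ContDiff ℝ ∞ ψ)
    (hc : HasCompactSupport ψ) (k : ℕ) :
    freqProj n k (testL2 (contDiff_laplacianFun hψ) (hasCompactSupport_laplacianFun hc)) =
      freqMul (laplaceSymbol n) k (fourierL n (testL2 hψ hc)) := by
  have e : testL2 (contDiff_laplacianFun hψ) (hasCompactSupport_laplacianFun hc) =
      ∑ i, testL2 (contDiff_partialDeriv i (contDiff_partialDeriv i hψ))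
        (hasCompactSupport_partialDeriv i (hasCompactSupport_partialDeriv i hc)) := by
    refine Lp.ext ?_
    have h1 := MemLp.coeFn_toLp (memLp_testFunction (contDiff_laplacianFun hψ)
      (hasCompactSupport_laplacianFun hc))
    have h2 : ∀ i, ∀ᵐ x, testL2 (contDiff_partialDeriv i (contDiff_partialDeriv i hψ))
        (hasCompactSupport_partialDeriv i (hasCompactSupport_partialDeriv i hc)) x =
          partialDeriv i (partialDeriv i ψ) x := fun i => MemLp.coeFn_toLp _
    filter_upwards [h1, ae_all_iff.2 h2, Lp.coeFn_finsetSum (Finset.univ) fun i =>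
      testL2 (contDiff_partialDeriv i (contDiff_partialDeriv i hψ))
        (hasCompactSupport_partialDeriv i (hasCompactSupport_partialDeriv i hc))] with x a1 a2 a3
    rw [a3, Finset.sum_apply]
    refine a1.trans ?_
    simp only [a2]
    rfl
  rw [e, map_sum, laplaceSymbol, freqMul_sum]
  refine Finset.sum_congr rfl fun i _ => ?_
  rw [freqProj_apply, (isWeakPartial_testFunction (contDiff_partialDeriv i hψ)
    (hasCompactSupport_partialDeriv i hc) i).freqMul_one_fourierL]
  have h1 := (isWeakPartial_testFunction hψ hc i).freqMul_one_fourierL k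
  have h2 : freqMul (derivSymbol i) k (fourierL n (testL2 (contDiff_partialDeriv i hψ)
      (hasCompactSupport_partialDeriv i hc))) = freqMul (derivSymbol i) k (freqMul 1 k (fourierL n
        (testL2 (contDiff_partialDeriv i hψ) (hasCompactSupport_partialDeriv i hc)))) := by
    rw [freqMul_freqMul, mul_one]
  rw [h2, h1, freqMul_freqMul]

variable {β a b : ℝ} {h : ℝ → L2 n} {u : ℝ → H1 n} {v : ℝ → L2 n}

/-- On each band the Laplacian symbol is real and moves onto Ψ, producing D. The derivatives are
then bounded uniformly in k and converge pointwise, so the truncation can be removed. -/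
theorem IsWeakSolution.hasDerivWithinAt_inner (H : IsWeakSolution β a b h u v)
    (hh : ContinuousOn h (Icc a b)) {Ψ D : L2 n}
    (hD : ∀ k, freqProj n k D = freqMul (laplaceSymbol n) k (fourierL n Ψ)) :
    ∀ t ∈ Icc a b, HasDerivWithinAt (fun τ => inner ℝ (v τ) Ψ)
      (inner ℝ ((u t).toL2 + damping β t • v t) D + inner ℝ (h t) Ψ) (Icc a b) t := by
  have cU : ContinuousOn (fun t => (u t).toL2 + damping β t • v t) (Icc a b) :=
    (continuousOn_toL2 H.cont_u).add ((continuous_damping β).continuousOn.smul H.cont_v)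
  obtain ⟨B, hB⟩ := isCompact_Icc.exists_bound_of_continuousOn cU
  obtain ⟨B', hB'⟩ := isCompact_Icc.exists_bound_of_continuousOn hh
  refine hasDerivWithinAt_of_tendsto (C := B * ‖D‖ + B' * ‖Ψ‖)
    (F := fun k t => inner ℝ (freqProj n k (v t)) (fourierL n Ψ))
    (F' := fun k t => inner ℝ (freqProj n k ((u t).toL2 + damping β t • v t)) (freqProj n k D) +
      inner ℝ (freqProj n k (h t)) (fourierL n Ψ)) (fun k t ht => ?_) (fun k => ?_) ?_
    (fun t _ => ?_) (fun t _ => ?_) (fun k t ht => ?_)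
  · refine ((H.freq_eq k t ht).inner ℝ (hasDerivWithinAt_const t _ (fourierL n Ψ))).congr_deriv ?_
    rw [inner_zero_right, zero_add, inner_add_left, inner_freqMul_of_real laplaceSymbol_im, hD k,
      map_add, map_smul]
  · exact (((freqProj n k).continuous.comp_continuousOn cU).inner continuousOn_const).add
      (((freqProj n k).continuous.comp_continuousOn hh).inner continuousOn_const)
  · exact (cU.inner continuousOn_const).add (hh.inner continuousOn_const)
  · rw [← inner_fourierL]
    exact (tendsto_freqProj _).inner tendsto_const_nhds
  · rw [← inner_fourierL _ D, ← inner_fourierL _ Ψ]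
    exact ((tendsto_freqProj _).inner (tendsto_freqProj _)).add
      ((tendsto_freqProj _).inner tendsto_const_nhds)
  · refine (norm_add_le _ _).trans (add_le_add ?_ ?_)
    · refine (norm_inner_le_norm _ _).trans (mul_le_mul ((norm_freqProj_le k _).trans (hB t ht))
        (norm_freqProj_le k _) (norm_nonneg _) ((norm_nonneg _).trans (hB t ht)))
    · refine (norm_inner_le_norm _ _).trans (mul_le_mul ((norm_freqProj_le k _).trans (hB' t ht))
        (norm_fourierL _).le (norm_nonneg _) ((norm_nonneg _).trans (hB' t ht)))

/-- The weak formulation with test function `e(t) Ψ(x)`. -/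
theorem IsWeakSolution.integral_identity {T : ℝ} (hT : 0 ≤ T) (H : IsWeakSolution β 0 T h u v)
    (hh : ContinuousOn h (Icc 0 T)) {Ψ D : L2 n}
    (hD : ∀ k, freqProj n k D = freqMul (laplaceSymbol n) k (fourierL n Ψ))
    {e e₁ e₂ : ℝ → ℝ} (he : ∀ t, HasDerivAt e (e₁ t) t) (he₁ : ∀ t, HasDerivAt e₁ (e₂ t) t)
    (he₂ : Continuous e₂) (h0 : e 0 = 1) (h0' : e₁ 0 = 0) (hT0 : e T = 0) (hT0' : e₁ T = 0) :
    (∫ t in (0 : ℝ)..T, e t * inner ℝ (h t) Ψ) + (inner ℝ (v 0) Ψ - inner ℝ (u 0).toL2 D) =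
      ∫ t in (0 : ℝ)..T, (e₂ t * inner ℝ (u t).toL2 Ψ +
        (e₁ t * (1 + t) ^ (-β) + e t * (-β * (1 + t) ^ (-β - 1)) - e t) *
          inner ℝ (u t).toL2 D) := by
  have ce : Continuous e := continuous_iff_continuousAt.2 fun t => (he t).continuousAt
  have ce₁ : Continuous e₁ := continuous_iff_continuousAt.2 fun t => (he₁ t).continuousAt
  have cu := continuousOn_toL2 H.cont_u
  have c1 : ∀ Y : L2 n, ContinuousOn (fun t => inner ℝ (h t) Y) (Icc 0 T) := fun Y =>
    hh.inner continuousOn_const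
  have c2 : ∀ Y : L2 n, ContinuousOn (fun t => inner ℝ (u t).toL2 Y) (Icc 0 T) := fun Y =>
    cu.inner continuousOn_const
  have hpos : ∀ t ∈ Icc 0 T, (1 + t) ≠ 0 := fun t ht => by linarith [ht.1]
  have c3 : ∀ s : ℝ, ContinuousOn (fun t : ℝ => (1 + t) ^ s) (Icc 0 T) := fun s =>
    ContinuousOn.rpow_const (by fun_prop) fun t ht => Or.inl (hpos t ht)
  have cL : ContinuousOn (fun t => e t * inner ℝ (h t) Ψ) (Icc 0 T) := ce.continuousOn.mul (c1 Ψ)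
  have cR : ContinuousOn (fun t => e₂ t * inner ℝ (u t).toL2 Ψ +
        (e₁ t * (1 + t) ^ (-β) + e t * (-β * (1 + t) ^ (-β - 1)) - e t) *
          inner ℝ (u t).toL2 D) (Icc 0 T) :=
    (he₂.continuousOn.mul (c2 Ψ)).add ((((ce₁.continuousOn.mul (c3 _)).add
      (ce.continuousOn.mul (continuousOn_const.mul (c3 _)))).sub ce.continuousOn).mul (c2 D))
  -- Two integrations by parts in time are encoded in this primitive: its subtracted terms are
  -- chosen so that every term containing v cancels.
  have dF : ∀ t ∈ Icc 0 T, HasDerivWithinAt (fun t => e t * inner ℝ (v t) Ψ -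
      e₁ t * inner ℝ (u t).toL2 Ψ - e t * (1 + t) ^ (-β) * inner ℝ (u t).toL2 D)
      (e t * inner ℝ (h t) Ψ - (e₂ t * inner ℝ (u t).toL2 Ψ +
        (e₁ t * (1 + t) ^ (-β) + e t * (-β * (1 + t) ^ (-β - 1)) - e t) *
          inner ℝ (u t).toL2 D)) (Icc 0 T) t := by
    intro t ht
    have d1 := H.hasDerivWithinAt_inner hh hD t ht
    have d2 : ∀ Y : L2 n, HasDerivWithinAt (fun τ => inner ℝ (u τ).toL2 Y) (inner ℝ (v t) Y)
        (Icc 0 T) t := fun Y => by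
      have := (H.deriv_u t ht).inner ℝ (hasDerivWithinAt_const t (Icc 0 T) Y)
      rwa [inner_zero_right, zero_add] at this
    have d3 : HasDerivAt (fun t : ℝ => (1 + t) ^ (-β)) (-β * (1 + t) ^ (-β - 1)) t := by
      have := ((hasDerivAt_id t).const_add 1).rpow_const (p := -β) (Or.inl (hpos t ht))
      simpa using this
    have d4 := (((he t).hasDerivWithinAt.mul d1).sub ((he₁ t).hasDerivWithinAt.mul (d2 Ψ))).sub
      (((he t).mul d3).hasDerivWithinAt.mul (d2 D))
    refine d4.congr_deriv ?_
    rw [inner_add_left, inner_smul_left, damping_of_nonneg ht.1]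
    simp only [conj_trivial, Pi.mul_apply]
    ring
  have key := integral_eq_sub_of_hasDerivWithinAt_Icc hT dF
    ((cL.sub cR).intervalIntegrable_of_Icc hT)
  rw [intervalIntegral.integral_sub (cL.intervalIntegrable_of_Icc hT)
    (cR.intervalIntegrable_of_Icc hT), h0, h0', hT0, hT0', add_zero, Real.one_rpow] at key
  linarith

end Pairing

/-! ### Young's inequality and the limiting argument -/

section Estimates

variable {n : ℕ}

/-- Young's inequality for the factors θ a q^{1/p} and A/θ, discarding the constants 1/p and
(p-1)/p. The parameter θ decides which term is small. -/
theorem mul_le_rpow_add_rpow {p θ a A q : ℝ} (hp : 1 < p) (hθ : 0 < θ) (ha : 0 ≤ a) (hA : 0 ≤ A)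
    (hq : 0 ≤ q) :
    a * (A * q ^ (1 / p)) ≤ θ ^ p * (a ^ p * q) + (A / θ) ^ (p / (p - 1)) := by
  have hp0 : 0 < p := by linarith
  have hconj : p.HolderConjugate (p / (p - 1)) := Real.HolderConjugate.conjExponent hp
  have h := Real.young_inequality_of_nonneg (a := θ * a * q ^ (1 / p)) (b := A / θ)
    (by positivity) (by positivity) hconj
  have e1 : θ * a * q ^ (1 / p) * (A / θ) = a * (A * q ^ (1 / p)) := by field_simp
  have e2 : (θ * a * q ^ (1 / p)) ^ p = θ ^ p * (a ^ p * q) := by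
    rw [Real.mul_rpow (by positivity) (by positivity), Real.mul_rpow hθ.le ha,
      ← Real.rpow_mul hq, one_div_mul_cancel hp0.ne', Real.rpow_one]
    ring
  rw [e1, e2] at h
  have h1 : θ ^ p * (a ^ p * q) / p ≤ θ ^ p * (a ^ p * q) := div_le_self (by positivity) hp.le
  have h2 : (A / θ) ^ (p / (p - 1)) / (p / (p - 1)) ≤ (A / θ) ^ (p / (p - 1)) :=
    div_le_self (by positivity) hconj.symm.lt.le
  linarith

theorem integral_mul_le_of_weight {p θ A : ℝ} (hp : 1 < p) (hθ : 0 < θ) (hA : 0 ≤ A)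
    {f : L2 n} {w q : Eucl n → ℝ} {S : Set (Eucl n)} (hS : MeasurableSet S) (hS' : volume S ≠ ⊤)
    (hw : MemLp w 2 volume) (hfq : Integrable (fun x => |f x| ^ p * q x) volume)
    (hq : ∀ x, 0 ≤ q x) (hwq : ∀ x, |w x| ≤ A * q x ^ (1 / p)) (hwS : ∀ x ∉ S, w x = 0) :
    ∫ x, f x * w x ≤ θ ^ p * (∫ x, |f x| ^ p * q x) +
      (A / θ) ^ (p / (p - 1)) * volume.real S := by
  have i1 : Integrable (fun x => f x * w x) volume := (Lp.memLp f).integrable_mul hw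
  have i2 : Integrable (S.indicator fun _ => (A / θ) ^ (p / (p - 1))) volume :=
    (integrable_indicator_iff hS).2 (integrableOn_const hS')
  have h := integral_mono i1 ((hfq.const_mul (θ ^ p)).add i2) (fun x => by
    rw [Pi.add_apply]
    by_cases hx : x ∈ S
    · rw [indicator_of_mem hx]
      refine le_trans ?_ (mul_le_rpow_add_rpow hp hθ (abs_nonneg (f x)) hA (hq x))
      refine (le_abs_self _).trans ?_
      rw [abs_mul]
      exact mul_le_mul_of_nonneg_left (hwq x) (abs_nonneg _)
    · rw [indicator_of_notMem hx, hwS x hx, mul_zero, add_zero]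
      have := hq x
      positivity)
  simp only [Pi.add_apply] at h
  rw [integral_add (hfq.const_mul _) i2, integral_const_mul, integral_indicator hS,
    setIntegral_const, smul_eq_mul, mul_comm (volume.real S)] at h
  exact h

/-- This settles the critical case. A small fixed θ absorbs half of I and shows that I is bounded,
so its increments tend to 0. A large θ then makes Cθ^{-r} small, and afterwards k is taken so large
that the increment term is small too, leaving nothing to balance d → c > 0. -/
theorem false_of_forall_le_rpow {p r C c : ℝ} {I d : ℕ → ℝ} (hp : 0 < p) (hr : 0 < r) (hc : 0 < c)
    (hI0 : ∀ k, 0 ≤ I k) (hI : Monotone I) (hd : Tendsto d atTop (𝓝 c))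
    (h : ∀ (θ : ℝ) (k : ℕ), 0 < θ →
      I (k + 1) + d (k + 1) ≤ θ ^ p * (I (k + 1) - I k) + C * θ ^ (-r)) : False := by
  have hd' : ∀ᶠ k in atTop, c / 2 ≤ d (k + 1) :=
    ((tendsto_add_atTop_iff_nat 1).2 hd).eventually (eventually_ge_nhds (by linarith))
  have hbdd : BddAbove (range I) := by
    obtain ⟨k₀, hk₀⟩ := eventually_atTop.1 hd'
    set θ : ℝ := (1 / 2) ^ (1 / p) with hθ
    have hθ0 : 0 < θ := by positivity
    have hθp : θ ^ p = 1 / 2 := by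
      rw [hθ, ← Real.rpow_mul (by norm_num), one_div_mul_cancel hp.ne', Real.rpow_one]
    refine ⟨2 * (C * θ ^ (-r)), ?_⟩
    rintro _ ⟨k, rfl⟩
    have h1 := h θ (max k k₀) hθ0
    have h2 := hk₀ (max k k₀) (le_max_right _ _)
    have h3 : I k ≤ I (max k k₀ + 1) := hI ((le_max_left _ _).trans (Nat.le_succ _))
    rw [hθp] at h1
    linarith [hI0 (max k k₀)]
  have hlim := tendsto_atTop_ciSup hI hbdd
  have hD : Tendsto (fun k => I (k + 1) - I k) atTop (𝓝 0) := by
    simpa using ((tendsto_add_atTop_iff_nat 1).2 hlim).sub hlim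
  have hθ : Tendsto (fun θ : ℝ => C * θ ^ (-r)) atTop (𝓝 0) := by
    simpa using (tendsto_rpow_neg_atTop hr).const_mul C
  obtain ⟨θ, h1, h2⟩ := ((hθ.eventually (eventually_lt_nhds (by linarith : (0 : ℝ) < c / 8))).and
    (eventually_gt_atTop 0)).exists
  have hD' : Tendsto (fun k => θ ^ p * (I (k + 1) - I k)) atTop (𝓝 0) := by
    simpa using hD.const_mul (θ ^ p)
  obtain ⟨k, h3, h4⟩ := ((hD'.eventually (eventually_lt_nhds (by linarith : (0 : ℝ) < c / 8))).and
    hd').exists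
  linarith [h θ k h2, hI0 (k + 1)]

end Estimates

/-! ### Cutoff functions dominating their own derivatives -/

section Cutoffs

variable {n : ℕ}

/-- Second derivatives of h^{m+2} retain a factor h^m, and (m+2)/p ≤ m turns this into the 1/p power
of the cutoff needed for Young's inequality. -/
theorem pow_le_pow_add_two_rpow {p y : ℝ} {m : ℕ} (hp : 1 < p) (hm : (m : ℝ) + 2 ≤ p * m)
    (hy : 0 ≤ y) (hy1 : y ≤ 1) : y ^ m ≤ (y ^ (m + 2)) ^ (1 / p) := by
  have hp0 : 0 < p := by linarith
  have hm0 : m ≠ 0 := by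
    rintro rfl
    norm_num at hm
  rw [one_div, Real.le_rpow_inv_iff_of_pos (by positivity) (by positivity) hp0]
  rcases hy.eq_or_lt with h | h
  · rw [← h, zero_pow hm0, Real.zero_rpow hp0.ne']
    positivity
  · rw [← Real.rpow_natCast, ← Real.rpow_mul hy, ← Real.rpow_natCast]
    refine Real.rpow_le_rpow_of_exponent_ge h hy1 ?_
    push_cast
    linarith

/-- A temporal cutoff function `e`, with first and second derivatives `e₁`, `e₂`. -/
structure IsTimeCutoff (p C : ℝ) (e e₁ e₂ : ℝ → ℝ) : Prop where
  hasDerivAt : ∀ t, HasDerivAt e (e₁ t) t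
  hasDerivAt_deriv : ∀ t, HasDerivAt e₁ (e₂ t) t
  continuous_deriv2 : Continuous e₂
  nonneg : ∀ t, 0 ≤ e t
  le_one : ∀ t, e t ≤ 1
  eq_one : ∀ t, |t| < 1 → e t = 1
  eq_zero : ∀ t, 2 ≤ |t| → e t = 0
  deriv_eq_zero : ∀ t, |t| < 1 → e₁ t = 0
  deriv2_eq_zero : ∀ t, |t| < 1 → e₂ t = 0
  abs_deriv_le : ∀ t, |e₁ t| ≤ C * e t ^ (1 / p)
  abs_deriv2_le : ∀ t, |e₂ t| ≤ C * e t ^ (1 / p)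

/-- A spatial cutoff function. -/
structure IsSpaceCutoff (p C : ℝ) (g : Eucl n → ℝ) : Prop where
  contDiff : ContDiff ℝ ∞ g
  hasCompactSupport : HasCompactSupport g
  nonneg : ∀ x, 0 ≤ g x
  le_one : ∀ x, g x ≤ 1
  eq_one : ∀ x, ‖x‖ < 1 → g x = 1
  eq_zero : ∀ x, 2 ≤ ‖x‖ → g x = 0
  laplacian_eq_zero : ∀ x, ‖x‖ < 1 → laplacianFun g x = 0
  abs_laplacian_le : ∀ x, |laplacianFun g x| ≤ C * g x ^ (1 / p)

theorem exists_isTimeCutoff {p : ℝ} (hp : 1 < p) :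
    ∃ (C : ℝ) (e e₁ e₂ : ℝ → ℝ), 0 ≤ C ∧ IsTimeCutoff p C e e₁ e₂ := by
  -- This is the condition m + 2 ≤ pm; the cutoff is the power m + 2 of a bump function.
  obtain ⟨m, hm'⟩ := exists_nat_ge (2 / (p - 1))
  have hm : (m : ℝ) + 2 ≤ p * m := by
    rw [div_le_iff₀ (by linarith)] at hm'
    linarith
  let h : ContDiffBump (0 : ℝ) := ⟨1, 2, one_pos, one_lt_two⟩
  have hs : ContDiff ℝ ∞ h := h.contDiff
  have hs1 : ContDiff ℝ ∞ (deriv h) := (contDiff_infty_iff_deriv.1 hs).2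
  have hs2 : ContDiff ℝ ∞ (deriv (deriv h)) := (contDiff_infty_iff_deriv.1 hs1).2
  have d0 : ∀ t, HasDerivAt h (deriv h t) t := fun t =>
    (hs.differentiable (by simp) t).hasDerivAt
  have d1 : ∀ t, HasDerivAt (deriv h) (deriv (deriv h) t) t := fun t =>
    (hs1.differentiable (by simp) t).hasDerivAt
  have hc : HasCompactSupport h := h.hasCompactSupport
  obtain ⟨B₁, hB₁⟩ := hc.deriv.exists_bound_of_continuous hs1.continuous
  obtain ⟨B₂, hB₂⟩ := hc.deriv.deriv.exists_bound_of_continuous hs2.continuous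
  simp only [Real.norm_eq_abs] at hB₁ hB₂
  have hB₁0 : 0 ≤ B₁ := (abs_nonneg _).trans (hB₁ 0)
  have hB₂0 : 0 ≤ B₂ := (abs_nonneg _).trans (hB₂ 0)
  have h0 : ∀ t, 0 ≤ h t := fun t => h.nonneg
  have h1 : ∀ t, h t ≤ 1 := fun t => h.le_one
  have hone : ∀ t, |t| < 1 → h =ᶠ[𝓝 t] fun _ => 1 := fun t ht =>
    h.eventuallyEq_one_of_mem_ball (by simpa using ht)
  have hd1 : ∀ t, |t| < 1 → deriv h t = 0 := fun t ht => by
    rw [(hone t ht).deriv_eq]; simp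
  have hd2 : ∀ t, |t| < 1 → deriv (deriv h) t = 0 := fun t ht => by
    have : deriv h =ᶠ[𝓝 t] fun _ => 0 := by
      filter_upwards [(isOpen_lt continuous_abs continuous_const).mem_nhds ht] with s hs'
      exact hd1 s hs'
    rw [this.deriv_eq]; simp
  have hpow : ∀ t, h t ^ m ≤ (h t ^ (m + 2)) ^ (1 / p) := fun t =>
    pow_le_pow_add_two_rpow hp hm (h0 t) (h1 t)
  set C : ℝ := (m + 2) * (B₁ + ((m + 1) * B₁ ^ 2 + B₂)) with hC
  have hC0 : 0 ≤ C := by positivity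
  refine ⟨C, fun t => h t ^ (m + 2), fun t => (m + 2) * h t ^ (m + 1) * deriv h t,
    fun t => (m + 2) * h t ^ m * ((m + 1) * deriv h t ^ 2 + h t * deriv (deriv h) t), hC0,
    ⟨fun t => ?_, fun t => ?_, ?_, fun t => pow_nonneg (h0 t) _,
      fun t => pow_le_one₀ (h0 t) (h1 t), fun t ht => ?_, fun t ht => ?_, fun t ht => ?_,
      fun t ht => ?_, fun t => ?_, fun t => ?_⟩⟩
  · refine ((d0 t).pow (m + 2)).congr_deriv ?_
    simp
  · refine ((((d0 t).pow (m + 1)).const_mul ((m : ℝ) + 2)).mul (d1 t)).congr_deriv ?_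
    simp only [Nat.add_sub_cancel, Pi.pow_apply]
    push_cast
    ring
  · have c0 := hs.continuous
    have c1 := hs1.continuous
    have c2 := hs2.continuous
    fun_prop
  · rw [(hone t ht).eq_of_nhds, one_pow]
  · rw [h.zero_of_le_dist (by simpa using ht), zero_pow (by omega)]
  · rw [hd1 t ht, mul_zero]
  · rw [hd1 t ht, hd2 t ht]; ring
  · refine le_trans ?_ (mul_le_mul_of_nonneg_left (hpow t) hC0)
    rw [abs_mul, abs_of_nonneg (by have := h0 t; positivity), pow_succ]
    have a1 := hB₁ t
    have a2 := h0 t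
    have a3 := h1 t
    calc ((m : ℝ) + 2) * (h t ^ m * h t) * |deriv h t| ≤ (m + 2) * (h t ^ m * 1) * B₁ := by gcongr
      _ = ((m + 2) * B₁) * h t ^ m := by ring
      _ ≤ C * h t ^ m := by
        rw [hC]; gcongr
        have : 0 ≤ (m + 1) * B₁ ^ 2 + B₂ := by positivity
        linarith
  · refine le_trans ?_ (mul_le_mul_of_nonneg_left (hpow t) hC0)
    have a1 := hB₁ t
    have a2 := h0 t
    have a3 := h1 t
    have a4 := hB₂ t
    rw [abs_mul, abs_of_nonneg (by positivity)]
    have b1 : |(m + 1) * deriv h t ^ 2 + h t * deriv (deriv h) t| ≤ (m + 1) * B₁ ^ 2 + B₂ := by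
      refine (abs_add_le _ _).trans (add_le_add ?_ ?_)
      · rw [abs_mul, abs_of_nonneg (by positivity), abs_pow]
        gcongr
      · rw [abs_mul, abs_of_nonneg a2]
        calc h t * |deriv (deriv h) t| ≤ 1 * B₂ := by gcongr
          _ = B₂ := one_mul _
    calc ((m : ℝ) + 2) * h t ^ m * |(m + 1) * deriv h t ^ 2 + h t * deriv (deriv h) t| ≤
          (m + 2) * h t ^ m * (B₁ + ((m + 1) * B₁ ^ 2 + B₂)) := by
          gcongr; linarith
      _ = C * h t ^ m := by rw [hC]; ring

theorem partialDeriv_pow (i : Fin n) {w : Eucl n → ℝ} (hw : ContDiff ℝ ∞ w) (k : ℕ) :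
    partialDeriv i (fun x => w x ^ (k + 1)) = fun x => (k + 1) * w x ^ k * partialDeriv i w x := by
  funext x
  unfold partialDeriv
  rw [fderiv_pow_eq_smul hw]
  simp

theorem laplacianFun_pow {w : Eucl n → ℝ} (hw : ContDiff ℝ ∞ w) (m : ℕ) (x : Eucl n) :
    laplacianFun (fun x => w x ^ (m + 2)) x = (m + 2) * w x ^ m *
      ∑ i, ((m + 1) * partialDeriv i w x ^ 2 + w x * partialDeriv i (partialDeriv i w) x) := by
  unfold laplacianFun
  rw [Finset.mul_sum]
  refine Finset.sum_congr rfl fun i _ => ?_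
  rw [partialDeriv_pow i hw (m + 1)]
  have hs : ContDiff ℝ ∞ fun x => (((m + 1 : ℕ) : ℝ) + 1) * w x ^ (m + 1) :=
    contDiff_const.mul (hw.pow _)
  rw [partialDeriv_mul i (hs.differentiable (by simp) x)
    ((contDiff_partialDeriv i hw).differentiable (by simp) x)]
  have e : partialDeriv i (fun x => (((m + 1 : ℕ) : ℝ) + 1) * w x ^ (m + 1)) x =
      (((m + 1 : ℕ) : ℝ) + 1) * ((m + 1) * w x ^ m * partialDeriv i w x) := by
    rw [partialDeriv_mul i (differentiableAt_const _) ((hw.pow _).differentiable (by simp) x),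
      partialDeriv_pow i hw m]
    simp [partialDeriv]
  rw [e]
  push_cast
  ring

theorem exists_isSpaceCutoff (n : ℕ) {p : ℝ} (hp : 1 < p) :
    ∃ (C : ℝ) (g : Eucl n → ℝ), 0 ≤ C ∧ IsSpaceCutoff p C g := by
  obtain ⟨m, hm'⟩ := exists_nat_ge (2 / (p - 1))
  have hm : (m : ℝ) + 2 ≤ p * m := by
    rw [div_le_iff₀ (by linarith)] at hm'
    linarith
  have hs : ContDiff ℝ ∞ (cutoff n) := (cutoff n).contDiff
  have hc : HasCompactSupport (cutoff n) := (cutoff n).hasCompactSupport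
  choose B₁ hB₁0 hB₁ using fun i => exists_bound_partialDeriv i hs hc
  choose B₂ hB₂0 hB₂ using fun i => exists_bound_partialDeriv i (contDiff_partialDeriv i hs)
    (hasCompactSupport_partialDeriv i hc)
  have h0 : ∀ x, 0 ≤ cutoff n x := fun x => (cutoff n).nonneg
  have h1 : ∀ x, cutoff n x ≤ 1 := fun x => (cutoff n).le_one
  have hone : ∀ x, ‖x‖ < 1 → cutoff n x = 1 := fun x hx =>
    (cutoff n).one_of_mem_closedBall (by simpa [cutoff] using hx.le)
  have hpow : ∀ x, cutoff n x ^ m ≤ (cutoff n x ^ (m + 2)) ^ (1 / p) := fun x =>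
    pow_le_pow_add_two_rpow hp hm (h0 x) (h1 x)
  set C : ℝ := (m + 2) * ∑ i, ((m + 1) * B₁ i ^ 2 + B₂ i) with hC
  have hC0 : 0 ≤ C := mul_nonneg (by positivity) (Finset.sum_nonneg fun i _ => by
    have := hB₂0 i; positivity)
  refine ⟨C, fun x => cutoff n x ^ (m + 2), hC0, ⟨hs.pow _,
    hc.comp_left (g := fun y : ℝ => y ^ (m + 2)) (by simp), fun x => pow_nonneg (h0 x) _,
    fun x => pow_le_one₀ (h0 x) (h1 x), fun x hx => by rw [hone x hx, one_pow], fun x hx => ?_,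
    fun x hx => ?_, fun x => ?_⟩⟩
  · rw [(cutoff n).zero_of_le_dist (by simpa [cutoff] using hx), zero_pow (by omega)]
  · have hU : {y : Eucl n | ‖y‖ < 1} ∈ 𝓝 x := (isOpen_lt continuous_norm continuous_const).mem_nhds hx
    have e0 : ∀ y : Eucl n, ‖y‖ < 1 → ∀ i, partialDeriv i (fun x => cutoff n x ^ (m + 2)) y = 0 := by
      intro y hy i
      have : (fun x => cutoff n x ^ (m + 2)) =ᶠ[𝓝 y] fun _ => 1 := by
        filter_upwards [(isOpen_lt continuous_norm continuous_const).mem_nhds hy] with z hz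
        rw [hone z hz, one_pow]
      simp [partialDeriv, this.fderiv_eq]
    refine Finset.sum_eq_zero fun i _ => ?_
    have : partialDeriv i (fun x => cutoff n x ^ (m + 2)) =ᶠ[𝓝 x] fun _ => 0 := by
      filter_upwards [hU] with y hy
      exact e0 y hy i
    rw [partialDeriv, this.fderiv_eq]
    simp
  · refine le_trans ?_ (mul_le_mul_of_nonneg_left (hpow x) hC0)
    have a2 := h0 x
    have a3 := h1 x
    rw [laplacianFun_pow hs, abs_mul, abs_of_nonneg (by positivity)]
    have b1 : |∑ i, ((m + 1) * partialDeriv i (cutoff n) x ^ 2 +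
        cutoff n x * partialDeriv i (partialDeriv i (cutoff n)) x)| ≤
        ∑ i, ((m + 1) * B₁ i ^ 2 + B₂ i) := by
      refine (Finset.abs_sum_le_sum_abs _ _).trans (Finset.sum_le_sum fun i _ => ?_)
      have a1 := hB₁ i x
      have a4 := hB₂ i x
      refine (abs_add_le _ _).trans (add_le_add ?_ ?_)
      · rw [abs_mul, abs_of_nonneg (by positivity), abs_pow]
        gcongr
      · rw [abs_mul, abs_of_nonneg a2]
        calc _ ≤ 1 * B₂ i := by gcongr
          _ = B₂ i := one_mul _
    refine (mul_le_mul_of_nonneg_left b1 (by positivity)).trans_eq ?_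
    rw [hC]
    ring

theorem laplacianFun_comp_smul (g : Eucl n → ℝ) (c : ℝ) (x : Eucl n) :
    laplacianFun (fun x => g (c • x)) x = c ^ 2 * laplacianFun g (c • x) := by
  unfold laplacianFun
  rw [Finset.mul_sum]
  refine Finset.sum_congr rfl fun i _ => ?_
  have e : partialDeriv i (fun x => g (c • x)) = fun x => c * partialDeriv i g (c • x) := by
    funext y
    exact partialDeriv_comp_smul i g c y
  rw [e]
  have e2 : partialDeriv i (fun x => c * partialDeriv i g (c • x)) x =
      c * partialDeriv i (fun x => partialDeriv i g (c • x)) x := by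
    unfold partialDeriv
    rw [show (fun x => c * (fderiv ℝ g (c • x)) (EuclideanSpace.single i 1)) =
      c • fun x => (fderiv ℝ g (c • x)) (EuclideanSpace.single i 1) from rfl, fderiv_const_smul_field]
    rfl
  rw [e2, partialDeriv_comp_smul]
  ring

end Cutoffs

/-! ### Scaling of the test functions -/

section Scaling

variable {n : ℕ} {p C C' σ β : ℝ} {e e₁ e₂ : ℝ → ℝ} {g : Eucl n → ℝ}

/-- The spatial cutoff at scale `R ^ σ`. -/
noncomputable def scaledCutoff (g : Eucl n → ℝ) (σ R : ℝ) (x : Eucl n) : ℝ := g (R ^ (-σ) • x)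

theorem IsSpaceCutoff.contDiff_scaled (hg : IsSpaceCutoff p C' g) (σ R : ℝ) :
    ContDiff ℝ ∞ (scaledCutoff g σ R) := hg.contDiff.comp (contDiff_const_smul _)

theorem IsSpaceCutoff.hasCompactSupport_scaled (hg : IsSpaceCutoff p C' g) (σ : ℝ) {R : ℝ}
    (hR : 0 < R) : HasCompactSupport (scaledCutoff g σ R) :=
  hg.hasCompactSupport.comp_smul (Real.rpow_pos_of_pos hR _).ne'

theorem laplacianFun_scaled (g : Eucl n → ℝ) (σ R : ℝ) (x : Eucl n) :
    laplacianFun (scaledCutoff g σ R) x = (R ^ (-σ)) ^ 2 * laplacianFun g (R ^ (-σ) • x) :=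
  laplacianFun_comp_smul g _ x

/-- The coefficient `(1+t)^{-β}` and its derivative at times of order `R`. -/
theorem rpow_damping_le (hσ : 1 ≤ σ) (hβ : -β ≤ 2 * σ - 1) {R t : ℝ} (hR : 1 ≤ R) (ht : 0 ≤ t)
    (htR : t ≤ 2 * R) :
    |(1 + t) ^ (-β)| ≤ 3 ^ (2 * σ - 1) * (1 + |β|) * R ^ (2 * σ - 1) ∧
      |-β * (1 + t) ^ (-β - 1)| ≤ 3 ^ (2 * σ - 1) * (1 + |β|) * R ^ (2 * σ - 2) := by
  have h1 : 1 ≤ 1 + t := by linarith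
  have h2 : 1 + t ≤ 3 * R := by linarith
  have hR0 : 0 < R := by linarith
  -- Since 1 + t ≥ 1, the exponent -β may be raised to 2σ - 1, which is positive because σ ≥ 1; then
  -- 1 + t ≤ 3R can be inserted.
  have a1 : (1 + t) ^ (-β) ≤ 3 ^ (2 * σ - 1) * R ^ (2 * σ - 1) := by
    rw [← Real.mul_rpow (by norm_num) hR0.le]
    exact (Real.rpow_le_rpow_of_exponent_le h1 hβ).trans
      (Real.rpow_le_rpow (by linarith) h2 (by linarith))
  have a2 : (1 + t) ^ (-β - 1) ≤ 3 ^ (2 * σ - 1) * R ^ (2 * σ - 2) := by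
    calc (1 + t) ^ (-β - 1) ≤ (1 + t) ^ (2 * σ - 2) :=
          Real.rpow_le_rpow_of_exponent_le h1 (by linarith)
      _ ≤ (3 * R) ^ (2 * σ - 2) := Real.rpow_le_rpow (by linarith) h2 (by linarith)
      _ = 3 ^ (2 * σ - 2) * R ^ (2 * σ - 2) := Real.mul_rpow (by norm_num) hR0.le
      _ ≤ 3 ^ (2 * σ - 1) * R ^ (2 * σ - 2) := by
          refine mul_le_mul_of_nonneg_right ?_ (by positivity)
          exact Real.rpow_le_rpow_of_exponent_le (by norm_num) (by linarith)
  have hb := abs_nonneg β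
  have p1 : 0 ≤ (3 : ℝ) ^ (2 * σ - 1) * R ^ (2 * σ - 1) := by positivity
  have p2 : 0 ≤ (3 : ℝ) ^ (2 * σ - 1) * R ^ (2 * σ - 2) := by positivity
  constructor
  · rw [abs_of_nonneg (by positivity)]
    nlinarith [mul_nonneg p1 hb]
  · rw [abs_mul, abs_neg, abs_of_nonneg (by positivity : 0 ≤ (1 + t) ^ (-β - 1))]
    have := mul_le_mul_of_nonneg_left a2 hb
    nlinarith

/-- The cutoff at scale R/2 has died out wherever a derivative of the one at scale R can be nonzero,
so subtracting it costs nothing. The factor R^{-2} is common to all four terms, by the choice of σ.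
-/
theorem weight_le (hp : 1 < p) (hC : 0 ≤ C) (hC' : 0 ≤ C') (he : IsTimeCutoff p C e e₁ e₂)
    (hg : IsSpaceCutoff p C' g) (hσ : 1 ≤ σ) (hβ : -β ≤ 2 * σ - 1) {R t : ℝ} (hR : 1 ≤ R)
    (ht : 0 ≤ t) (htR : t ≤ 2 * R) (x : Eucl n) :
    0 ≤ e (t / R) * scaledCutoff g σ R x - e (t / (R / 2)) * scaledCutoff g σ (R / 2) x ∧
    |(R⁻¹ * (R⁻¹ * e₂ (t / R))) * scaledCutoff g σ R x +
      (R⁻¹ * e₁ (t / R) * (1 + t) ^ (-β) + e (t / R) * (-β * (1 + t) ^ (-β - 1)) - e (t / R)) *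
        laplacianFun (scaledCutoff g σ R) x| ≤
      ((C + (C * (3 ^ (2 * σ - 1) * (1 + |β|)) + 3 ^ (2 * σ - 1) * (1 + |β|) + 1) * C') *
        R ^ (-2 : ℝ)) *
      (e (t / R) * scaledCutoff g σ R x -
        e (t / (R / 2)) * scaledCutoff g σ (R / 2) x) ^ (1 / p) := by
  have hR0 : 0 < R := by linarith
  have hp0 : 0 < p := by linarith
  obtain ⟨hb1, hb2⟩ := rpow_damping_le hσ hβ hR ht htR
  rw [laplacianFun_scaled]
  set B : ℝ := 3 ^ (2 * σ - 1) * (1 + |β|) with hB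
  have hB0 : 0 ≤ B := by positivity
  set b := (1 + t) ^ (-β) with hbdef
  set b' := -β * (1 + t) ^ (-β - 1) with hb'def
  set c := R ^ (-σ) with hc
  have hc0 : 0 < c := Real.rpow_pos_of_pos hR0 _
  have hcsq : c ^ 2 = R ^ (-(2 * σ)) := by
    rw [hc, ← Real.rpow_natCast, ← Real.rpow_mul hR0.le]
    congr 1
    push_cast
    ring
  -- These are the scales of the terms e'bΔg, eb'Δg, eΔg and e''g, with b = (1+t)^{-β}. The third is
  -- where σ ≥ 1 is needed.
  have r1 : R⁻¹ * R ^ (2 * σ - 1) * c ^ 2 = R ^ (-2 : ℝ) := by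
    rw [hcsq, ← Real.rpow_neg_one, ← Real.rpow_add hR0, ← Real.rpow_add hR0]
    congr 1
    ring
  have r2 : R ^ (2 * σ - 2) * c ^ 2 = R ^ (-2 : ℝ) := by
    rw [hcsq, ← Real.rpow_add hR0]
    congr 1
    ring
  have r3 : c ^ 2 ≤ R ^ (-2 : ℝ) := by
    rw [hcsq]
    exact Real.rpow_le_rpow_of_exponent_le hR (by linarith)
  have r4 : R⁻¹ * R⁻¹ = R ^ (-2 : ℝ) := by
    rw [← Real.rpow_neg_one, ← Real.rpow_add hR0]
    norm_num
  have habs : |t / R| = t / R := abs_of_nonneg (by positivity)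
  have hc2 : (R / 2) ^ (-σ) = 2 ^ σ * c := by
    rw [Real.div_rpow hR0.le (by norm_num), Real.rpow_neg (by norm_num : (0 : ℝ) ≤ 2), div_inv_eq_mul,
      mul_comm]
  -- Inside, e'' and Δg vanish and the left side is 0. Outside, t ≥ R or |x| ≥ R^σ; either one puts
  -- the argument of the cutoff at scale R/2 at distance at least 2 (in space because 2^σ ≥ 2).
  by_cases hin : t < R ∧ ‖c • x‖ < 1
  · have t1 : |t / R| < 1 := by rw [habs, div_lt_one hR0]; exact hin.1
    rw [he.deriv2_eq_zero _ t1, hg.laplacian_eq_zero _ hin.2, he.eq_one _ t1]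
    have hx : scaledCutoff g σ R x = 1 := hg.eq_one _ hin.2
    rw [hx]
    have hle : e (t / (R / 2)) * scaledCutoff g σ (R / 2) x ≤ 1 :=
      mul_le_one₀ (he.le_one _) (hg.nonneg _) (hg.le_one _)
    refine ⟨by linarith, ?_⟩
    simp only [mul_zero, zero_mul, add_zero, abs_zero]
    have : 0 ≤ 1 * 1 - e (t / (R / 2)) * scaledCutoff g σ (R / 2) x := by linarith
    positivity
  · have hz : e (t / (R / 2)) * scaledCutoff g σ (R / 2) x = 0 := by
      rw [not_and_or, not_lt, not_lt] at hin
      rcases hin with h | h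
      · rw [he.eq_zero, zero_mul]
        rw [abs_of_nonneg (by positivity), le_div_iff₀ (by positivity)]
        linarith
      · have : scaledCutoff g σ (R / 2) x = 0 := by
          refine hg.eq_zero _ ?_
          rw [hc2, mul_smul, norm_smul, Real.norm_of_nonneg (by positivity)]
          have h2 : (2 : ℝ) ≤ 2 ^ σ := by
            simpa using Real.rpow_le_rpow_of_exponent_le (one_le_two (α := ℝ)) hσ
          nlinarith
        rw [this, mul_zero]
    have hsc : scaledCutoff g σ R x = g (c • x) := rfl
    rw [hz, sub_zero, hsc]
    have e0 := he.nonneg (t / R)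
    have e1 := he.le_one (t / R)
    have g0 := hg.nonneg (c • x)
    have g1 := hg.le_one (c • x)
    refine ⟨mul_nonneg e0 g0, ?_⟩
    rw [Real.mul_rpow e0 g0]
    have hroot : ∀ y : ℝ, 0 ≤ y → y ≤ 1 → y ≤ y ^ (1 / p) := fun y h0 h1 => by
      rcases h0.eq_or_lt with h | h
      · rw [← h]; positivity
      · conv_lhs => rw [← Real.rpow_one y]
        exact Real.rpow_le_rpow_of_exponent_ge h h1 (by rw [div_le_one hp0]; exact hp.le)
    have eE := hroot _ e0 e1
    have gG := hroot _ g0 g1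
    have k1 := he.abs_deriv_le (t / R)
    have k2 := he.abs_deriv2_le (t / R)
    have k3 := hg.abs_laplacian_le (c • x)
    set E := e (t / R) ^ (1 / p) with hE
    set G := g (c • x) ^ (1 / p) with hG
    have hE0 : 0 ≤ E := by positivity
    have hG0 : 0 ≤ G := by positivity
    have m1 : |R⁻¹ * (R⁻¹ * e₂ (t / R)) * g (c • x)| ≤ R ^ (-2 : ℝ) * (C * E) * G := by
      rw [← mul_assoc, r4, abs_mul, abs_mul, abs_of_nonneg g0, abs_of_nonneg (by positivity)]
      gcongr
    have m2 : |R⁻¹ * e₁ (t / R) * b + e (t / R) * b' - e (t / R)| ≤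
        R⁻¹ * (C * E) * (B * R ^ (2 * σ - 1)) + E * (B * R ^ (2 * σ - 2)) + E := by
      refine (abs_sub _ _).trans (add_le_add ((abs_add_le _ _).trans (add_le_add ?_ ?_)) ?_)
      · rw [abs_mul, abs_mul, abs_of_nonneg (by positivity : 0 ≤ R⁻¹)]
        gcongr
      · rw [abs_mul, abs_of_nonneg e0]
        gcongr
      · rw [abs_of_nonneg e0]
        exact eE
    have m3 : |c ^ 2 * laplacianFun g (c • x)| ≤ c ^ 2 * (C' * G) := by
      rw [abs_mul, abs_of_nonneg (by positivity)]
      gcongr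
    refine (abs_add_le _ _).trans ?_
    rw [abs_mul (_ + _ - _)]
    have m4 := mul_le_mul m2 m3 (abs_nonneg _) (by positivity)
    have m5 : (R⁻¹ * (C * E) * (B * R ^ (2 * σ - 1)) + E * (B * R ^ (2 * σ - 2)) + E) *
        (c ^ 2 * (C' * G)) = (C * B * (R⁻¹ * R ^ (2 * σ - 1) * c ^ 2) +
          B * (R ^ (2 * σ - 2) * c ^ 2) + c ^ 2) * (C' * (E * G)) := by ring
    rw [m5, r1, r2] at m4
    have m6 : (C * B * R ^ (-2 : ℝ) + B * R ^ (-2 : ℝ) + c ^ 2) * (C' * (E * G)) ≤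
        (C * B * R ^ (-2 : ℝ) + B * R ^ (-2 : ℝ) + R ^ (-2 : ℝ)) * (C' * (E * G)) := by
      gcongr
    have m7 : R ^ (-2 : ℝ) * (C * E) * G +
        (C * B * R ^ (-2 : ℝ) + B * R ^ (-2 : ℝ) + R ^ (-2 : ℝ)) * (C' * (E * G)) =
        (C + (C * B + B + 1) * C') * R ^ (-2 : ℝ) * (E * G) := by ring
    linarith

end Scaling

/-! ### Nonexistence of global solutions -/

section Nonexistence

variable {n : ℕ} {p C C' σ β : ℝ} {e e₁ e₂ : ℝ → ℝ} {g : Eucl n → ℝ} {N : H1 n → L2 n}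

/-- The scaled spatial cutoff as an element of `L²`. -/
noncomputable def IsSpaceCutoff.scaledL2 (hg : IsSpaceCutoff p C' g) (σ : ℝ) {R : ℝ} (hR : 0 < R) :
    L2 n := testL2 (hg.contDiff_scaled σ R) (hg.hasCompactSupport_scaled σ hR)

/-- The Laplacian of the scaled spatial cutoff as an element of `L²`. -/
noncomputable def IsSpaceCutoff.laplacianL2 (hg : IsSpaceCutoff p C' g) (σ : ℝ) {R : ℝ}
    (hR : 0 < R) : L2 n := testL2 (contDiff_laplacianFun (hg.contDiff_scaled σ R))
      (hasCompactSupport_laplacianFun (hg.hasCompactSupport_scaled σ hR))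

theorem IsSpaceCutoff.inner_scaledL2 (hg : IsSpaceCutoff p C' g) (σ : ℝ) {R : ℝ} (hR : 0 < R)
    (f : L2 n) : inner ℝ f (hg.scaledL2 σ hR) = ∫ x, f x * scaledCutoff g σ R x :=
  inner_testL2 _ _ f

theorem IsSpaceCutoff.inner_laplacianL2 (hg : IsSpaceCutoff p C' g) (σ : ℝ) {R : ℝ} (hR : 0 < R)
    (f : L2 n) : inner ℝ f (hg.laplacianL2 σ hR) =
      ∫ x, f x * laplacianFun (scaledCutoff g σ R) x :=
  inner_testL2 _ _ f

theorem IsSpaceCutoff.integrable_mul_scaled (hg : IsSpaceCutoff p C' g) (σ : ℝ) {R : ℝ}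
    (hR : 0 < R) (f : L2 n) : Integrable (fun x => f x * scaledCutoff g σ R x) volume :=
  (Lp.memLp f).integrable_mul
    (memLp_testFunction (hg.contDiff_scaled σ R) (hg.hasCompactSupport_scaled σ hR))

theorem IsSpaceCutoff.integrable_mul_laplacian (hg : IsSpaceCutoff p C' g) (σ : ℝ) {R : ℝ}
    (hR : 0 < R) (f : L2 n) :
    Integrable (fun x => f x * laplacianFun (scaledCutoff g σ R) x) volume :=
  (Lp.memLp f).integrable_mul (memLp_testFunction (contDiff_laplacianFun (hg.contDiff_scaled σ R))
      (hasCompactSupport_laplacianFun (hg.hasCompactSupport_scaled σ hR)))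

theorem IsSpaceCutoff.integral_abs_rpow_mul (hg : IsSpaceCutoff p C' g) (hN : IsPowerMap p N)
    (σ : ℝ) {R R' : ℝ} (hR : 0 < R) (hR' : 0 < R') (f : H1 n) (α α' : ℝ) :
    Integrable (fun x => |f.toL2 x| ^ p *
      (α * scaledCutoff g σ R x - α' * scaledCutoff g σ R' x)) volume ∧
    ∫ x, |f.toL2 x| ^ p * (α * scaledCutoff g σ R x - α' * scaledCutoff g σ R' x) =
      α * inner ℝ (N f) (hg.scaledL2 σ hR) - α' * inner ℝ (N f) (hg.scaledL2 σ hR') := by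
  have ae : (fun x => |f.toL2 x| ^ p * (α * scaledCutoff g σ R x - α' * scaledCutoff g σ R' x))
      =ᵐ[volume] fun x => α * (N f x * scaledCutoff g σ R x) -
        α' * (N f x * scaledCutoff g σ R' x) := by
    filter_upwards [hN f] with x hx
    rw [hx]
    ring
  have i1 := (hg.integrable_mul_scaled σ hR (N f)).const_mul α
  have i2 := (hg.integrable_mul_scaled σ hR' (N f)).const_mul α'
  refine ⟨(i1.sub i2).congr ae.symm, ?_⟩
  rw [integral_congr_ae ae, integral_sub i1 i2, integral_const_mul, integral_const_mul,
    hg.inner_scaledL2, hg.inner_scaledL2]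

/-- The test function inequality at a fixed time: Young's inequality in x with weight φ_R - φ_{R/2},
the error being proportional to the volume of the spatial support. -/
theorem slice_estimate (hp : 1 < p) (hC : 0 ≤ C) (hC' : 0 ≤ C') (he : IsTimeCutoff p C e e₁ e₂)
    (hg : IsSpaceCutoff p C' g) (hN : IsPowerMap p N) (hσ : 1 ≤ σ) (hβ : -β ≤ 2 * σ - 1) {R t θ : ℝ}
    (hR : 1 ≤ R) (hR0 : 0 < R) (hR2 : 0 < R / 2) (ht : 0 ≤ t) (htR : t ≤ 2 * R) (hθ : 0 < θ)
    (f : H1 n) :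
    0 ≤ e (t / R) * inner ℝ (N f) (hg.scaledL2 σ hR0) -
        e (t / (R / 2)) * inner ℝ (N f) (hg.scaledL2 σ hR2) ∧
    R⁻¹ * (R⁻¹ * e₂ (t / R)) * inner ℝ f.toL2 (hg.scaledL2 σ hR0) +
      (R⁻¹ * e₁ (t / R) * (1 + t) ^ (-β) + e (t / R) * (-β * (1 + t) ^ (-β - 1)) - e (t / R)) *
        inner ℝ f.toL2 (hg.laplacianL2 σ hR0) ≤
      θ ^ p * (e (t / R) * inner ℝ (N f) (hg.scaledL2 σ hR0) -
        e (t / (R / 2)) * inner ℝ (N f) (hg.scaledL2 σ hR2)) +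
      (((C + (C * (3 ^ (2 * σ - 1) * (1 + |β|)) + 3 ^ (2 * σ - 1) * (1 + |β|) + 1) * C') *
        R ^ (-2 : ℝ)) / θ) ^ (p / (p - 1)) *
        volume.real (Metric.closedBall (0 : Eucl n) (R ^ σ * 2)) := by
  obtain ⟨hi, hint⟩ := hg.integral_abs_rpow_mul hN σ hR0 hR2 f (e (t / R)) (e (t / (R / 2)))
  have hw := weight_le hp hC hC' he hg hσ hβ hR ht htR
  have hq : ∀ x, 0 ≤ e (t / R) * scaledCutoff g σ R x -
      e (t / (R / 2)) * scaledCutoff g σ (R / 2) x := fun x => (hw x).1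
  refine ⟨?_, ?_⟩
  · rw [← hint]
    exact integral_nonneg fun x => mul_nonneg (by positivity) (hq x)
  set α₂ := R⁻¹ * (R⁻¹ * e₂ (t / R)) with hα₂
  set α := R⁻¹ * e₁ (t / R) * (1 + t) ^ (-β) + e (t / R) * (-β * (1 + t) ^ (-β - 1)) - e (t / R)
    with hα
  set A := (C + (C * (3 ^ (2 * σ - 1) * (1 + |β|)) + 3 ^ (2 * σ - 1) * (1 + |β|) + 1) * C') *
        R ^ (-2 : ℝ) with hA
  have hA0 : 0 ≤ A := by positivity
  have hwL : MemLp (fun x => α₂ * scaledCutoff g σ R x + α * laplacianFun (scaledCutoff g σ R) x) 2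
      volume := ((memLp_testFunction (hg.contDiff_scaled σ R)
        (hg.hasCompactSupport_scaled σ hR0)).const_mul α₂).add
      ((memLp_testFunction (contDiff_laplacianFun (hg.contDiff_scaled σ R))
      (hasCompactSupport_laplacianFun (hg.hasCompactSupport_scaled σ hR0))).const_mul α)
  have key := integral_mul_le_of_weight hp hθ hA0 (f := f.toL2)
    (S := Metric.closedBall (0 : Eucl n) (R ^ σ * 2)) measurableSet_closedBall
    measure_closedBall_lt_top.ne hwL hi hq (fun x => (hw x).2) (fun x hx => by
      have hx' : 2 ≤ ‖R ^ (-σ) • x‖ := by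
        rw [mem_closedBall_zero_iff, not_le] at hx
        rw [norm_smul, Real.norm_of_nonneg (by positivity), Real.rpow_neg hR0.le, ← div_eq_inv_mul,
          le_div_iff₀ (by positivity)]
        linarith
      have h1 : scaledCutoff g σ R x = 0 := hg.eq_zero _ hx'
      have h2 : laplacianFun g (R ^ (-σ) • x) = 0 := by
        have := hg.abs_laplacian_le (R ^ (-σ) • x)
        rw [hg.eq_zero _ hx', Real.zero_rpow (by positivity), mul_zero] at this
        exact abs_nonpos_iff.1 this
      rw [h1, laplacianFun_scaled, h2]
      ring)
  rw [hint] at key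
  refine le_of_eq_of_le ?_ key
  have e1 : (fun x => f.toL2 x * (α₂ * scaledCutoff g σ R x +
      α * laplacianFun (scaledCutoff g σ R) x)) = fun x => α₂ * (f.toL2 x * scaledCutoff g σ R x) +
        α * (f.toL2 x * laplacianFun (scaledCutoff g σ R) x) := by
    funext x; ring
  rw [e1, integral_add ((hg.integrable_mul_scaled σ hR0 _).const_mul _)
    ((hg.integrable_mul_laplacian σ hR0 _).const_mul _), integral_const_mul, integral_const_mul,
    hg.inner_scaledL2, hg.inner_laplacianL2]

/-- Dominated convergence, with the integrable data as majorants: at each point the cutoff is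
eventually 1 and its Laplacian eventually 0. -/
theorem tendsto_inner_scaledL2 (hC' : 0 ≤ C') (hg : IsSpaceCutoff p C' g) (hσ : 1 ≤ σ) (hp : 0 < p)
    {f f' : L2 n} (hf : Integrable f volume) (hf' : Integrable f' volume)
    {R : ℕ → ℝ} (hR : ∀ k, 0 < R k) (hR1 : ∀ k, 1 ≤ R k) (hlim : Tendsto R atTop atTop) :
    Tendsto (fun k => inner ℝ f' (hg.scaledL2 σ (hR k)) - inner ℝ f (hg.laplacianL2 σ (hR k)))
      atTop (𝓝 (∫ x, f' x)) := by
  have hsmall : ∀ x : Eucl n, ∀ᶠ k in atTop, ‖R k ^ (-σ) • x‖ < 1 := fun x => by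
    have h1 : Tendsto (fun k => R k ^ (-σ) • x) atTop (𝓝 ((0 : ℝ) • x)) :=
      ((tendsto_rpow_neg_atTop (by linarith)).comp hlim).smul_const x
    rw [zero_smul] at h1
    have h2 := h1.norm
    rw [norm_zero] at h2
    exact h2.eventually (eventually_lt_nhds one_pos)
  have l1 : Tendsto (fun k => ∫ x, f' x * scaledCutoff g σ (R k) x) atTop (𝓝 (∫ x, f' x)) := by
    refine tendsto_integral_of_dominated_convergence (fun x => ‖f' x‖)
      (fun k => (hg.integrable_mul_scaled σ (hR k) f').1) hf'.norm
      (fun k => Eventually.of_forall fun x => ?_) (Eventually.of_forall fun x => ?_)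
    · have h0 : 0 ≤ scaledCutoff g σ (R k) x := hg.nonneg _
      rw [norm_mul, Real.norm_of_nonneg h0]
      exact mul_le_of_le_one_right (norm_nonneg _) (hg.le_one _)
    · refine tendsto_const_nhds.congr' ?_
      filter_upwards [hsmall x] with k hk
      have : scaledCutoff g σ (R k) x = 1 := hg.eq_one _ hk
      rw [this, mul_one]
  have l2 : Tendsto (fun k => ∫ x, f x * laplacianFun (scaledCutoff g σ (R k)) x) atTop
      (𝓝 (∫ x : Eucl n, (0 : ℝ))) := by
    refine tendsto_integral_of_dominated_convergence (fun x => ‖f x‖ * C')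
      (fun k => (hg.integrable_mul_laplacian σ (hR k) f).1) (hf.norm.mul_const _)
      (fun k => Eventually.of_forall fun x => ?_) (Eventually.of_forall fun x => ?_)
    · rw [norm_mul, laplacianFun_scaled]
      refine mul_le_mul_of_nonneg_left ?_ (norm_nonneg _)
      rw [norm_mul, Real.norm_of_nonneg (by positivity)]
      have h1 : (R k ^ (-σ)) ^ 2 ≤ 1 := pow_le_one₀ (by have := hR k; positivity)
        (Real.rpow_le_one_of_one_le_of_nonpos (hR1 k) (by linarith))
      have h2 : ‖laplacianFun g (R k ^ (-σ) • x)‖ ≤ C' * 1 :=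
        (hg.abs_laplacian_le _).trans (mul_le_mul_of_nonneg_left
          (Real.rpow_le_one (hg.nonneg _) (hg.le_one _) (by positivity)) hC')
      calc _ ≤ 1 * (C' * 1) := mul_le_mul h1 h2 (norm_nonneg _) zero_le_one
        _ = C' := by ring
    · refine tendsto_const_nhds.congr' ?_
      filter_upwards [hsmall x] with k hk
      rw [laplacianFun_scaled, hg.laplacian_eq_zero _ hk, mul_zero, mul_zero]
  rw [integral_zero] at l2
  simpa only [hg.inner_scaledL2, hg.inner_laplacianL2, sub_zero] using l1.sub l2

variable {u : ℝ → H1 n} {v : ℝ → L2 n}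

/-- Nonexistence of global solutions. -/
theorem not_global_of_integral_pos (hp : 1 < p) (hN : IsPowerMap p N) (hNc : Continuous N)
    (hσ : 1 ≤ σ) (hβ : -β ≤ 2 * σ - 1) (hpσ : p * (n * σ - 1) ≤ n * σ + 1)
    (hu₀ : Integrable (u 0).toL2 volume) (hu₁ : Integrable (v 0) volume) (hpos : 0 < ∫ x, v 0 x) :
    ¬ ∀ T, 0 < T → IsWeakSolution β 0 T (fun t => N (u t)) u v := by
  intro H
  obtain ⟨C, e, e₁, e₂, hC, he⟩ := exists_isTimeCutoff hp
  obtain ⟨C', g, hC', hg⟩ := exists_isSpaceCutoff n hp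
  -- With dyadic scales, R/2 is the previous scale, and the weight φ_R - φ_{R/2} yields increments
  -- of a single sequence I.
  set R : ℕ → ℝ := fun k => 2 ^ k with hRdef
  have hR : ∀ k, 0 < R k := fun k => by positivity
  have hR1 : ∀ k, 1 ≤ R k := fun k => one_le_pow₀ one_le_two
  have hRlim : Tendsto R atTop atTop := tendsto_pow_atTop_atTop_of_one_lt one_lt_two
  have hRs : ∀ k, R (k + 1) = 2 * R k := fun k => by simp only [hRdef]; ring
  have hRh : ∀ k, R (k + 1) / 2 = R k := fun k => by rw [hRs]; ring
  set r := p / (p - 1) with hr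
  have hp1 : 0 < p - 1 := by linarith
  have hr0 : 0 < r := by positivity
  set C₀ := C + (C * (3 ^ (2 * σ - 1) * (1 + |β|)) + 3 ^ (2 * σ - 1) * (1 + |β|) + 1) * C' with hC₀
  have hC₀0 : 0 ≤ C₀ := by positivity
  set V := volume.real (Metric.closedBall (0 : Eucl n) 2) with hV
  set J : ℕ → ℝ → ℝ := fun k t => e (t / R k) * inner ℝ (N (u t)) (hg.scaledL2 σ (hR k)) with hJ
  have ce : Continuous e := continuous_iff_continuousAt.2 fun t => (he.hasDerivAt t).continuousAt
  have ce₁ : Continuous e₁ :=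
    continuous_iff_continuousAt.2 fun t => (he.hasDerivAt_deriv t).continuousAt
  have ce₂ := he.continuous_deriv2
  have cNu : ∀ T, ContinuousOn (fun t => N (u t)) (Icc 0 T) := fun T => by
    rcases lt_or_ge 0 T with hT | hT
    · exact hNc.comp_continuousOn (H T hT).cont_u
    · exact (hNc.comp_continuousOn (H 1 one_pos).cont_u).mono (Icc_subset_Icc_right (by linarith))
  have cJ : ∀ k T, ContinuousOn (J k) (Icc 0 T) := fun k T =>
    (Continuous.continuousOn (by fun_prop)).mul ((cNu T).inner continuousOn_const)
  have iJ : ∀ k a b, 0 ≤ a → a ≤ b → IntervalIntegrable (J k) volume a b := fun k a b ha hab =>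
    ((cJ k b).mono (Icc_subset_Icc_left ha)).intervalIntegrable_of_Icc hab
  set I : ℕ → ℝ := fun k => ∫ t in (0 : ℝ)..2 * R k, J k t with hI
  have hslice := fun (k : ℕ) (t θ : ℝ) (ht : t ∈ Icc 0 (2 * R (k + 1))) (hθ : 0 < θ) =>
    slice_estimate hp hC hC' he hg hN hσ hβ (hR1 (k + 1)) (hR (k + 1))
      (by rw [hRh]; exact hR k) ht.1 ht.2 hθ (u t)
  simp only [hRh] at hslice
  have hJmono : ∀ k, ∀ t ∈ Icc 0 (2 * R (k + 1)), J k t ≤ J (k + 1) t := fun k t ht =>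
    sub_nonneg.1 (hslice k t 1 ht one_pos).1
  have hJzero : ∀ k t, 2 * R k ≤ t → J k t = 0 := fun k t ht => by
    have h0 : 0 ≤ t := by linarith [hR k]
    simp only [hJ]
    rw [he.eq_zero, zero_mul]
    rw [abs_of_nonneg (div_nonneg h0 (hR k).le), le_div_iff₀ (hR k)]
    exact ht
  -- Both scales must be integrated over the same interval; the smaller one vanishes on the added
  -- part.
  have hIext : ∀ k, ∫ t in (0 : ℝ)..2 * R (k + 1), J k t = I k := fun k => by
    have hRk := hR k
    rw [← intervalIntegral.integral_add_adjacent_intervals (iJ k 0 (2 * R k) le_rfl (by linarith))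
      (iJ k (2 * R k) (2 * R (k + 1)) (by linarith) (by rw [hRs]; linarith))]
    have : ∫ t in (2 * R k)..2 * R (k + 1), J k t = ∫ t in (2 * R k)..2 * R (k + 1), (0 : ℝ) := by
      refine intervalIntegral.integral_congr fun t ht => ?_
      rw [uIcc_of_le (by rw [hRs]; linarith)] at ht
      exact hJzero k t ht.1
    rw [this, intervalIntegral.integral_zero, add_zero]
  have hImono : Monotone I := monotone_nat_of_le_succ fun k => by
    rw [← hIext k]
    have := hR (k + 1)
    exact intervalIntegral.integral_mono_on (by linarith) (iJ _ _ _ le_rfl (by linarith))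
      (iJ _ _ _ le_rfl (by linarith)) (hJmono k)
  have hJ0 : ∀ k t, 0 ≤ J k t := fun k t => by
    refine mul_nonneg (he.nonneg _) ?_
    rw [hg.inner_scaledL2]
    refine integral_nonneg_of_ae ?_
    filter_upwards [hN (u t)] with x hx
    rw [hx]
    exact mul_nonneg (by positivity) (hg.nonneg _)
  have hI0 : ∀ k, 0 ≤ I k := fun k =>
    intervalIntegral.integral_nonneg (by have := hR k; linarith) fun t _ => hJ0 k t
  refine false_of_forall_le_rpow (C := 2 * C₀ ^ r * V) (by linarith : 0 < p) hr0 hpos hI0 hImono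
    (tendsto_inner_scaledL2 hC' hg hσ (by linarith) hu₀ hu₁ hR hR1 hRlim) fun θ k hθ => ?_
  have hRk := hR (k + 1)
  have hT : 0 < 2 * R (k + 1) := by linarith
  have W := H _ hT
  have hdiv : ∀ t : ℝ, HasDerivAt (fun t => t / R (k + 1)) (R (k + 1))⁻¹ t := fun t => by
    simpa using (hasDerivAt_id t).div_const (R (k + 1))
  have hend : 2 * R (k + 1) / R (k + 1) = 2 := by field_simp
  have h2 : (2 : ℝ) ≤ |2| := le_abs_self _
  have hE2 : e 2 = 0 := he.eq_zero 2 h2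
  -- The final time 2R is where the temporal cutoff reaches 0; its derivative vanishes there too,
  -- being bounded by a multiple of e^{1/p}.
  have key := W.integral_identity hT.le (cNu _) (Ψ := hg.scaledL2 σ hRk)
    (D := hg.laplacianL2 σ hRk) (fun j => freqProj_testL2_laplacian _ _ j)
    (e := fun t => e (t / R (k + 1))) (e₁ := fun t => (R (k + 1))⁻¹ * e₁ (t / R (k + 1)))
    (e₂ := fun t => (R (k + 1))⁻¹ * ((R (k + 1))⁻¹ * e₂ (t / R (k + 1))))
    (fun t => ((he.hasDerivAt (t / R (k + 1))).comp t (hdiv t)).congr_deriv (mul_comm _ _))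
    (fun t => (((he.hasDerivAt_deriv (t / R (k + 1))).comp t (hdiv t)).const_mul
      (R (k + 1))⁻¹).congr_deriv (by ring))
    (by fun_prop) (by rw [zero_div]; exact he.eq_one 0 (by simp))
    (by rw [zero_div, he.deriv_eq_zero 0 (by simp), mul_zero])
    (by rw [hend, hE2])
    (by
      have := he.abs_deriv_le 2
      rw [hE2, Real.zero_rpow (by positivity), mul_zero] at this
      rw [hend, abs_nonpos_iff.1 this, mul_zero])
  have hle : I (k + 1) + (inner ℝ (v 0) (hg.scaledL2 σ hRk) -
      inner ℝ (u 0).toL2 (hg.laplacianL2 σ hRk)) ≤ ∫ t in (0 : ℝ)..2 * R (k + 1),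
        (θ ^ p * (J (k + 1) t - J k t) + (C₀ * R (k + 1) ^ (-2 : ℝ) / θ) ^ r *
          volume.real (Metric.closedBall (0 : Eucl n) (R (k + 1) ^ σ * 2))) := by
    rw [hI]
    refine key.trans_le (intervalIntegral.integral_mono_on hT.le ?_ ?_ fun t ht =>
      (hslice k t θ ht hθ).2)
    · have cu := continuousOn_toL2 W.cont_u
      have hpos : ∀ t ∈ Icc 0 (2 * R (k + 1)), (1 + t) ≠ 0 := fun t ht => by linarith [ht.1]
      have c3 : ∀ s : ℝ, ContinuousOn (fun t : ℝ => (1 + t) ^ s) (Icc 0 (2 * R (k + 1))) :=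
        fun s => ContinuousOn.rpow_const (by fun_prop) fun t ht => Or.inl (hpos t ht)
      have ca : ContinuousOn (fun t => e (t / R (k + 1))) (Icc 0 (2 * R (k + 1))) :=
        Continuous.continuousOn (by fun_prop)
      have cb : ContinuousOn (fun t => (R (k + 1))⁻¹ * e₁ (t / R (k + 1)))
        (Icc 0 (2 * R (k + 1))) := Continuous.continuousOn (by fun_prop)
      have cc : ContinuousOn (fun t => (R (k + 1))⁻¹ * ((R (k + 1))⁻¹ * e₂ (t / R (k + 1))))
        (Icc 0 (2 * R (k + 1))) := Continuous.continuousOn (by fun_prop)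
      exact ContinuousOn.intervalIntegrable_of_Icc hT.le
        ((cc.mul (cu.inner continuousOn_const)).add ((((cb.mul (c3 _)).add
          (ca.mul (continuousOn_const.mul (c3 _)))).sub ca).mul (cu.inner continuousOn_const)))
    · exact ContinuousOn.intervalIntegrable_of_Icc hT.le
        ((continuousOn_const.mul ((cJ _ _).sub (cJ _ _))).add continuousOn_const)
  refine hle.trans ?_
  rw [intervalIntegral.integral_add
    (((iJ _ _ _ le_rfl hT.le).sub (iJ _ _ _ le_rfl hT.le)).const_mul _) intervalIntegrable_const,
    intervalIntegral.integral_const_mul, intervalIntegral.integral_sub (iJ _ _ _ le_rfl hT.le)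
    (iJ _ _ _ le_rfl hT.le), hIext, intervalIntegral.integral_const, smul_eq_mul, sub_zero]
  refine add_le_add le_rfl ?_
  have hvol : volume.real (Metric.closedBall (0 : Eucl n) (R (k + 1) ^ σ * 2)) =
      (R (k + 1) ^ σ) ^ n * V := by
    rw [Measure.real, Measure.addHaar_closedBall_mul _ _ (by positivity) (by norm_num),
      finrank_euclideanSpace, Fintype.card_fin, ENNReal.toReal_mul,
      ENNReal.toReal_ofReal (by positivity)]
    rfl
  rw [hvol]
  set ρ := R (k + 1) with hρ
  -- The only use of the upper bound on p: with r = p/(p-1) it is equivalent to p(nσ-1) ≤ nσ+1. Here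
  -- 1 comes from the time interval, σn from the volume and -2r from the weight.
  have hexp : 1 + σ * n - 2 * r ≤ 0 := by
    have : 1 + σ * n ≤ 2 * r := by
      rw [hr, mul_div_assoc', le_div_iff₀ hp1]
      linarith
    linarith
  have hρpow : ρ * (ρ ^ (-2 : ℝ)) ^ r * (ρ ^ σ) ^ n = ρ ^ (1 + σ * n - 2 * r) := by
    have h1 : ρ ^ (1 + σ * n - 2 * r) = ρ ^ (1 : ℝ) * ρ ^ (-2 * r) * ρ ^ (σ * n) := by
      rw [← Real.rpow_add hRk, ← Real.rpow_add hRk]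
      congr 1
      ring
    rw [h1, Real.rpow_one, Real.rpow_mul hRk.le, Real.rpow_mul_natCast hRk.le]
  have hone : ρ ^ (1 + σ * n - 2 * r) ≤ 1 := Real.rpow_le_one_of_one_le_of_nonpos (hR1 _) hexp
  have hV0 : 0 ≤ V := measureReal_nonneg
  calc 2 * ρ * ((C₀ * ρ ^ (-2 : ℝ) / θ) ^ r * ((ρ ^ σ) ^ n * V)) =
        2 * C₀ ^ r * V * θ ^ (-r) * (ρ * (ρ ^ (-2 : ℝ)) ^ r * (ρ ^ σ) ^ n) := by
        rw [Real.div_rpow (by positivity) hθ.le, Real.mul_rpow hC₀0 (by positivity),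
          Real.rpow_neg hθ.le]
        ring
    _ ≤ 2 * C₀ ^ r * V * θ ^ (-r) * 1 := by
        rw [hρpow]
        exact mul_le_mul_of_nonneg_left hone (by positivity)
    _ = 2 * C₀ ^ r * V * θ ^ (-r) := mul_one _

end Nonexistence

/-! ### Conclusion -/

/-- Clears the denominator in the conditions on p. When it is not positive the quotient carries no
restriction, and the product form holds by its sign. -/
theorem mul_le_of_ofReal_le_div {p a b : ℝ} (hp : 0 ≤ p) (hb : 0 ≤ b)
    (h : ENNReal.ofReal p ≤ ENNReal.ofReal b / ENNReal.ofReal a) : p * a ≤ b := by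
  rcases le_or_gt a 0 with ha | ha
  · exact (mul_nonpos_of_nonneg_of_nonpos hp ha).trans hb
  · rw [ENNReal.le_div_iff_mul_le (Or.inl (by simpa using ha)) (Or.inl ENNReal.ofReal_ne_top),
      ← ENNReal.ofReal_mul hp, ENNReal.ofReal_le_ofReal_iff hb] at h
    exact h

theorem theorem1 (n : ℕ) (hn : 1 ≤ n) (β p : ℝ) (hp : 1 < p)
    (hexp :
      (-1 ≤ β ∧ ENNReal.ofReal p ≤ ENNReal.ofReal (n + 1) / ENNReal.ofReal (n - 1)) ∨
      (β ≤ -1 ∧ ENNReal.ofReal p ≤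
        ENNReal.ofReal (n * (1 - β) + 2) / ENNReal.ofReal (n * (1 - β) - 2)))
    (u₀ : H1 n) (u₁ : L2 n)
    (hu₀ : Integrable (fun x => u₀.toL2 x) volume)
    (hu₁ : Integrable (fun x => u₁ x) volume)
    (hpos : 0 < ∫ x, u₁ x)
    (Tmax : EReal) (u : ℝ → H1 n) (v : ℝ → L2 n)
    (hu : IsMaximalMildSolution β p u₀ u₁ Tmax u v) :
    ∃ T : ℝ, Tmax = (T : EReal) ∧
      Tendsto (fun t => ‖u t‖ + ‖v t‖) (𝓝[<] T) atTop := by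
  have hn1 : (1 : ℝ) ≤ n := by exact_mod_cast hn
  -- Both ranges of β reduce to one condition: σ is the smallest number with σ ≥ 1 and 2σ ≥ 1 - β,
  -- and nσ plays the role of the dimension.
  obtain ⟨σ, hσ, hβ, hpσ⟩ : ∃ σ : ℝ, 1 ≤ σ ∧ -β ≤ 2 * σ - 1 ∧ p * (n * σ - 1) ≤ n * σ + 1 := by
    rcases hexp with ⟨hβ, h⟩ | ⟨hβ, h⟩
    · refine ⟨1, le_rfl, by linarith, ?_⟩
      rw [mul_one]
      exact mul_le_of_ofReal_le_div (by linarith) (by linarith) h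
    · refine ⟨(1 - β) / 2, by linarith, by linarith, ?_⟩
      have := mul_le_of_ofReal_le_div (by linarith)
        (by have := mul_nonneg (by linarith : (0 : ℝ) ≤ n) (by linarith : 0 ≤ 1 - β); linarith) h
      linarith
  -- Since σ ≥ 1, the condition at nσ is at least as strong as the one at n, which the Sobolev
  -- embedding uses.
  have hpn : p * (n - 1) ≤ n + 1 := by
    have : (p - 1) * n ≤ (p - 1) * (n * σ) :=
      mul_le_mul_of_nonneg_left (le_mul_of_one_le_right (by linarith) hσ) (by linarith)
    linarith
  obtain ⟨N, hN, hL⟩ := exists_isPowerMap hn hp hpn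
  induction Tmax with
  | bot => exact absurd hu.1.1 (by simp)
  | coe T => exact ⟨T, rfl, hu.tendsto_atTop hN hL⟩
  | top =>
    have hmild : ∀ T : ℝ, 0 < T → IsMildSolution β p u₀ u₁ T u v := fun T hT =>
      hu.1.2 T hT (EReal.coe_lt_top T)
    obtain ⟨-, -, -, h0, h1, -⟩ := hmild 1 one_pos
    subst h0 h1
    exact absurd (fun T hT => (hmild T hT).isWeakSolution hN hL.continuous hT)
      (not_global_of_integral_pos hp hN hL.continuous hσ hβ hpσ hu₀ hu₁ hpos)
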